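/- Let $\Lambda$ be a lattice in a $g$-dimensional real vector space $V$, let $V^\vee=\mathrm{Hom}_{\mathbb R}(V,\mathbb R)$, $\Lambda^\vee=\mathrm{Hom}_{\mathbb Z}(\Lambda,\mathbb Z)=\{\mu\in V^\vee:\mu(\Lambda)\subset\mathbb Z\}$, $T=V/\Lambda$, $\hat T=V^\vee/\Lambda^\vee$, and let $p\colon T\times\hat T\to T$ be the projection. Let $\mathcal P$ be the Poincaré bundle on $T\times\hat T$, i.e. the $U(1)$ line bundle with factor of automorphy $$a_{\mathcal P}(x,y,\lambda,\mu)=e^{i\pi\mu(\lambda)}\,e^{i\pi(y(\lambda)-\mu(x))},\qquad (x,y)\in V\times V^\vee,\ (\lambda,\mu)\in\Lambda\times\Lambda^\vee .$$ After the change of gauge by $\phi(x,y)=e^{-i\pi y(x)}$ its factor of automorphy becomes $e^{-2\pi i\mu(x)}$, and in this gauge $\mathcal P$ carries the connection $\nabla_{\mathcal P}=d+2\pi i\sum_j y_j\,dx^j$, where $x^j$ are linear coordinates on $V$ and $y_j$ the dual coordinates on $V^\vee$. Let $\mathcal P^\vee$ be the dual bundle with the dual connection $d-2\pi i\sum_j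 y_j\,dx^j$, and let $\hat\nabla_2$ be the $\hat T$-component of that connection. Thus the smooth sections of $\mathcal P^\vee$ over an open $W\subset T\times\hat T$ are the smooth functions $s$ on the inverse image of $W$ in $V\times V^\vee$ with $s(x+\lambda,y+\mu)=e^{2\pi i\mu(x)}s(x,y)$ for all $(\lambda,\mu)\in\Lambda\times\Lambda^\vee$, and $\ker\hat\nabla_2$ is the sheaf of $\mathbb C$-vector spaces on $T\times\hat T$ formed by those $s$ whose derivatives in the $y$-directions vanish. Then: 1. $R^jp_\ast\ker\hat\nabla_2=0$ for $j=0,\dots,g-1$; 2. $R^gp_\ast\ker\hat\nabla_2\simeq\mathbb C(0)$, the one-dimensional skyscraper sheaf at $0\in T$; 3. $H^j(T\times\hat T,\ker\hat\nabla_2)=0$ for $j=0,\dots,g-1$, and $H^g(T\times\hat T,\ker\hat\nabla_2)\simeq\mathbb C$. -/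

import Mathlib

open CategoryTheory TopologicalSpace Opposite
open scoped ContDiff Topology

noncomputable section

namespace PoincareTorus

variable {V : Type} [NormedAddCommGroup V] [NormedSpace ℝ V]

/-! ### The torus, the dual torus and their product -/

/-- The dual lattice `Λ^∨ = Hom(Λ, ℤ)`, realised inside `V^∨` as the functionals that are
integral on `Λ`. -/
def dualLattice (Λ : Submodule ℤ V) : Submodule ℤ (StrongDual ℝ V) where
  carrier := {m | ∀ l ∈ Λ, ∃ n : ℤ, m l = n}
  add_mem' := by
    intro a b ha hb l hl
    obtain ⟨n, hn⟩ := ha l hl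
    obtain ⟨k, hk⟩ := hb l hl
    exact ⟨n + k, by simp [hn, hk]⟩
  zero_mem' := fun l _ => ⟨0, by simp⟩
  smul_mem' := by
    intro c a ha l hl
    obtain ⟨n, hn⟩ := ha l hl
    exact ⟨c * n, by simp [hn]⟩

/-- The torus `T = V / Λ`. -/
abbrev Torus (Λ : Submodule ℤ V) : TopCat.{0} := TopCat.of (V ⧸ Λ)

/-- The dual torus `T̂ = V^∨ / Λ^∨`. -/
abbrev DualTorus (Λ : Submodule ℤ V) : TopCat.{0} := TopCat.of (StrongDual ℝ V ⧸ dualLattice Λ)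

/-- The product `T × T̂`. -/
abbrev TorusProd (Λ : Submodule ℤ V) : TopCat.{0} :=
  TopCat.of ((V ⧸ Λ) × (StrongDual ℝ V ⧸ dualLattice Λ))

/-- The first projection `p : T × T̂ → T`. -/
def proj (Λ : Submodule ℤ V) : TorusProd Λ ⟶ Torus Λ :=
  TopCat.ofHom ⟨Prod.fst, continuous_fst⟩

/-- The universal covering `V × V^∨ → T × T̂`. -/
def cover (Λ : Submodule ℤ V) (v : V × StrongDual ℝ V) : TorusProd Λ :=
  (Submodule.Quotient.mk v.1, Submodule.Quotient.mk v.2)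

theorem continuous_cover (Λ : Submodule ℤ V) : Continuous (cover Λ) :=
  ((continuous_quot_mk : Continuous (Quot.mk _ : V → V ⧸ Λ)).comp continuous_fst).prodMk
    ((continuous_quot_mk :
      Continuous (Quot.mk _ : StrongDual ℝ V → StrongDual ℝ V ⧸ dualLattice Λ)).comp
        continuous_snd)

/-- The inverse image in `V × V^∨` of an open subset of `T × T̂`. -/
def coverOpen (Λ : Submodule ℤ V) (W : Opens (TorusProd Λ)) : Opens (V × StrongDual ℝ V) :=
  ⟨cover Λ ⁻¹' W, W.isOpen.preimage (continuous_cover Λ)⟩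

theorem coverOpen_mono (Λ : Submodule ℤ V) {W W' : Opens (TorusProd Λ)} (h : W ≤ W') :
    coverOpen Λ W ≤ coverOpen Λ W' := fun _ hv => h hv

/-! ### The Poincaré bundle and its connection -/

/-- The alternating form `A((x, y), (x', y')) = y(x') - y'(x)` of the Poincaré bundle. -/
def altForm (v w : V × StrongDual ℝ V) : ℝ := v.2 w.1 - w.2 v.1

/-- The semicharacter `χ(λ, μ) = exp(iπ μ(λ))` of the Poincaré bundle. -/
def semichar (l : V × StrongDual ℝ V) : ℂ := Complex.exp (Real.pi * Complex.I * (l.2 l.1 : ℝ))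

/-- The factor of automorphy `χ(l) exp(iπ A(v, l))` of the Poincaré bundle attached to the pair
`(A, χ)`. -/
def poincareFactor (v l : V × StrongDual ℝ V) : ℂ :=
  semichar l * Complex.exp (Real.pi * Complex.I * (altForm v l : ℝ))

/-- The gauge transformation `φ(x, y) = exp(-iπ y(x))`. -/
def gauge (v : V × StrongDual ℝ V) : ℂ := Complex.exp (-(Real.pi * Complex.I * (v.2 v.1 : ℝ)))

/-- The factor of automorphy of the dual `P^∨` of the Poincaré bundle: the inverse of the factor
of automorphy `φ(v + l) a(v, l) φ(v)⁻¹` of the Poincaré bundle in the gauge `φ`. -/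
def dualFactor (v l : V × StrongDual ℝ V) : ℂ :=
  (gauge (v + l) * poincareFactor v l * (gauge v)⁻¹)⁻¹

theorem dualFactor_eq (v l : V × StrongDual ℝ V) :
    dualFactor v l = Complex.exp (2 * Real.pi * Complex.I * (l.2 v.1 : ℝ)) := by
  simp only [dualFactor, gauge, poincareFactor, semichar, altForm]
  rw [← Complex.exp_neg, ← Complex.exp_add, ← Complex.exp_add, ← Complex.exp_add,
    ← Complex.exp_neg]
  congr 1
  simp only [Prod.fst_add, Prod.snd_add, map_add, add_apply]
  push_cast
  ring

/-- The connection of `P^∨`, in the gauge in which the factor of automorphy is `dualFactor`: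
`∇^∨ = d - 2πi ∑ y_j dx^j`, the dual of the connection `d + 2πi ∑ y_j dx^j` of the Poincaré
bundle. It is evaluated at the point `v` and on the tangent vector `w`. -/
def dualConnection (f : V × StrongDual ℝ V → ℂ) (v w : V × StrongDual ℝ V) : ℂ :=
  fderiv ℝ f v w - 2 * Real.pi * Complex.I * (v.2 w.1 : ℝ) * f v

/-- The `T̂`-component `∇̂₂` of the connection of `P^∨`. -/
def nablaHat2 (f : V × StrongDual ℝ V → ℂ) (v : V × StrongDual ℝ V) (e : StrongDual ℝ V) : ℂ :=
  dualConnection f v (0, e)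

/-- Extension by zero of a function on an open subset. All conditions below involve only its
values and germs at points of the open subset. -/
def extendZero {U : Opens (V × StrongDual ℝ V)} (s : U → ℂ) : V × StrongDual ℝ V → ℂ :=
  Function.extend Subtype.val s 0

theorem extendZero_apply {U : Opens (V × StrongDual ℝ V)} (s : U → ℂ) (v : U) :
    extendZero s v = s v :=
  Subtype.val_injective.extend_apply s 0 v

theorem extendZero_eventuallyEq {U : Opens (V × StrongDual ℝ V)} (s : U → ℂ)
    {U' : Opens (V × StrongDual ℝ V)} (t : U' → ℂ) (h : U' ≤ U)
    (hst : ∀ v : U', t v = s ⟨v, h v.2⟩) (v : U') :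
    extendZero t =ᶠ[𝓝 (v : V × StrongDual ℝ V)] extendZero s := by
  filter_upwards [U'.isOpen.mem_nhds v.2] with w hw
  exact (extendZero_apply t ⟨w, hw⟩).trans
    ((hst ⟨w, hw⟩).trans (extendZero_apply s ⟨w, h hw⟩).symm)

theorem extendZero_add {U : Opens (V × StrongDual ℝ V)} (s t : U → ℂ) :
    extendZero (s + t) = extendZero s + extendZero t := by
  simpa [extendZero] using Function.extend_add Subtype.val s t (0 : V × StrongDual ℝ V → ℂ) 0

theorem extendZero_smul {U : Opens (V × StrongDual ℝ V)} (c : ℂ) (s : U → ℂ) :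
    extendZero (c • s) = c • extendZero s := by
  simpa [extendZero] using Function.extend_smul c Subtype.val s (0 : V × StrongDual ℝ V → ℂ)

theorem extendZero_zero {U : Opens (V × StrongDual ℝ V)} :
    extendZero (0 : U → ℂ) = 0 := by
  simpa using extendZero_smul (0 : ℂ) (0 : U → ℂ)

/-- The space of smooth sections of `P^∨` over `W`: smooth complex functions on the inverse image
of `W` in `V × V^∨` that satisfy the automorphy condition. -/
def dualPoincareSections (Λ : Submodule ℤ V) (W : Opens (TorusProd Λ)) :
    Submodule ℂ (coverOpen Λ W → ℂ) where
  carrier := {s | (∀ v : coverOpen Λ W,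
      ContDiffAt ℝ ∞ (extendZero s) (v : V × StrongDual ℝ V)) ∧
    ∀ (v : coverOpen Λ W) (l : V × StrongDual ℝ V), l.1 ∈ Λ → l.2 ∈ dualLattice Λ →
      extendZero s (v + l) = dualFactor (v : V × StrongDual ℝ V) l * extendZero s v}
  add_mem' := by
    rintro s t ⟨hs, hs'⟩ ⟨ht, ht'⟩
    simp only [Set.mem_ofPred_eq, extendZero_add]
    refine ⟨fun v => (hs v).add (ht v), fun v l h1 h2 => ?_⟩
    simp only [Pi.add_apply, hs' v l h1 h2, ht' v l h1 h2, mul_add]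
  zero_mem' := by
    simp only [Set.mem_ofPred_eq, extendZero_zero]
    exact ⟨fun v => contDiffAt_const, fun v l _ _ => by simp⟩
  smul_mem' := by
    rintro c s ⟨hs, hs'⟩
    simp only [Set.mem_ofPred_eq, extendZero_smul]
    refine ⟨fun v => contDiffAt_const.smul (hs v), fun v l h1 h2 => ?_⟩
    simp only [Pi.smul_apply, hs' v l h1 h2, smul_eq_mul]
    ring

/-- The space of sections over `W` of `ker ∇̂₂`. -/
def kerSections (Λ : Submodule ℤ V) (W : Opens (TorusProd Λ)) :
    Submodule ℂ (coverOpen Λ W → ℂ) where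
  carrier := {s | s ∈ dualPoincareSections Λ W ∧
    ∀ (v : coverOpen Λ W) (e : StrongDual ℝ V), nablaHat2 (extendZero s) v e = 0}
  add_mem' := by
    rintro s t ⟨hs, hs'⟩ ⟨ht, ht'⟩
    refine ⟨add_mem hs ht, fun v e => ?_⟩
    have h1 := (hs.1 v).differentiableAt (by simp)
    have h2 := (ht.1 v).differentiableAt (by simp)
    have h3 := hs' v e
    have h4 := ht' v e
    simp only [nablaHat2, dualConnection, extendZero_add, fderiv_add h1 h2,
      add_apply, Pi.add_apply] at h3 h4 ⊢
    linear_combination h3 + h4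
  zero_mem' := by
    refine ⟨zero_mem _, fun v e => ?_⟩
    simp [nablaHat2, dualConnection, extendZero_zero]
  smul_mem' := by
    rintro c s ⟨hs, hs'⟩
    refine ⟨Submodule.smul_mem _ c hs, fun v e => ?_⟩
    have h1 := (hs.1 v).differentiableAt (by simp)
    have h3 := hs' v e
    simp only [nablaHat2, dualConnection, extendZero_smul, fderiv_const_smul h1,
      smul_apply, Pi.smul_apply, smul_eq_mul] at h3 ⊢
    linear_combination c * h3

theorem add_mem_coverOpen (Λ : Submodule ℤ V) (W : Opens (TorusProd Λ))
    {v l : V × StrongDual ℝ V} (hv : v ∈ coverOpen Λ W) (h1 : l.1 ∈ Λ)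
    (h2 : l.2 ∈ dualLattice Λ) : v + l ∈ coverOpen Λ W := by
  have : cover Λ (v + l) = cover Λ v := by
    refine Prod.ext ?_ ?_
    · exact (Submodule.Quotient.eq Λ).2 (by simpa using h1)
    · exact (Submodule.Quotient.eq (dualLattice Λ)).2 (by simpa using h2)
  change cover Λ (v + l) ∈ W
  rw [this]
  exact hv

/-- Membership in `kerSections` is local: a function that agrees, near every point, with a section
of `ker ∇̂₂` is a section. -/
theorem mem_kerSections_of_local (Λ : Submodule ℤ V) (W : Opens (TorusProd Λ))
    (s : coverOpen Λ W → ℂ)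
    (h : ∀ x ∈ W, ∃ (W' : Opens (TorusProd Λ)) (hW : W' ≤ W), x ∈ W' ∧
      ∃ t ∈ kerSections Λ W', ∀ v : coverOpen Λ W', t v = s ⟨v, coverOpen_mono Λ hW v.2⟩) :
    s ∈ kerSections Λ W := by
  refine ⟨⟨fun v => ?_, fun v l h1 h2 => ?_⟩, fun v e => ?_⟩ <;>
  obtain ⟨W', hW, hx, t, ht, hts⟩ := h (cover Λ v) v.2
  · exact (ht.1.1 ⟨v, hx⟩).congr_of_eventuallyEq
      (extendZero_eventuallyEq s t (coverOpen_mono Λ hW) hts ⟨v, hx⟩).symm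
  · have e1 := (extendZero_eventuallyEq s t (coverOpen_mono Λ hW) hts ⟨v, hx⟩).eq_of_nhds
    have e2 := (extendZero_eventuallyEq s t (coverOpen_mono Λ hW) hts
      ⟨v + l, add_mem_coverOpen Λ W' hx h1 h2⟩).eq_of_nhds
    rw [← e1, ← e2]
    exact ht.1.2 ⟨v, hx⟩ l h1 h2
  · have e1 := extendZero_eventuallyEq s t (coverOpen_mono Λ hW) hts ⟨v, hx⟩
    have e2 := ht.2 ⟨v, hx⟩ e
    simp only [nablaHat2, dualConnection] at e2 ⊢
    rw [← e1.fderiv_eq, ← e1.eq_of_nhds]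
    exact e2

theorem restrict_mem_kerSections (Λ : Submodule ℤ V) {W W' : Opens (TorusProd Λ)} (h : W' ≤ W)
    {s : coverOpen Λ W → ℂ} (hs : s ∈ kerSections Λ W) :
    (fun v : coverOpen Λ W' => s ⟨v, coverOpen_mono Λ h v.2⟩) ∈ kerSections Λ W' := by
  have key := extendZero_eventuallyEq s
    (fun v : coverOpen Λ W' => s ⟨v, coverOpen_mono Λ h v.2⟩) (coverOpen_mono Λ h) (fun _ => rfl)
  refine ⟨⟨fun v => ?_, fun v l h1 h2 => ?_⟩, fun v e => ?_⟩
  · exact (hs.1.1 ⟨v, coverOpen_mono Λ h v.2⟩).congr_of_eventuallyEq (key v)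
  · rw [(key v).eq_of_nhds, (key ⟨v + l, add_mem_coverOpen Λ W' v.2 h1 h2⟩).eq_of_nhds]
    exact hs.1.2 ⟨v, coverOpen_mono Λ h v.2⟩ l h1 h2
  · have e2 := hs.2 ⟨v, coverOpen_mono Λ h v.2⟩ e
    simp only [nablaHat2, dualConnection] at e2 ⊢
    rw [(key v).fderiv_eq, (key v).eq_of_nhds]
    exact e2

/-- Restriction of sections of `ker ∇̂₂`. -/
def kerRestrict (Λ : Submodule ℤ V) {W W' : Opens (TorusProd Λ)} (h : W' ≤ W) :
    kerSections Λ W →ₗ[ℂ] kerSections Λ W' where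
  toFun s := ⟨fun v => s.1 ⟨v, coverOpen_mono Λ h v.2⟩, restrict_mem_kerSections Λ h s.2⟩
  map_add' _ _ := rfl
  map_smul' _ _ := rfl

/-- The presheaf `ker ∇̂₂` of complex vector spaces on `T × T̂`. -/
def kerPresheaf (Λ : Submodule ℤ V) : TopCat.Presheaf (ModuleCat.{0} ℂ) (TorusProd Λ) where
  obj W := ModuleCat.of ℂ (kerSections Λ W.unop)
  map f := ModuleCat.ofHom (kerRestrict Λ f.unop.le)
  map_id _ := rfl
  map_comp _ _ := rfl

theorem kerPresheaf_isSheaf (Λ : Submodule ℤ V) : (kerPresheaf Λ).IsSheaf := by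
  rw [TopCat.Presheaf.isSheaf_iff_isSheaf_comp (CategoryTheory.forget (ModuleCat.{0} ℂ))]
  apply TopCat.Presheaf.isSheaf_of_isSheafUniqueGluing_types
  intro ι U sf hsf
  have hc : ∀ v : coverOpen Λ (iSup U), ∃ i, cover Λ v ∈ U i := fun v => Opens.mem_iSup.1 v.2
  choose idx hidx using hc
  let sf' : ∀ i, kerSections Λ (U i) := sf
  have compat : ∀ (i j : ι) (v : V × StrongDual ℝ V) (hi : cover Λ v ∈ U i)
      (hj : cover Λ v ∈ U j), (sf' i).1 ⟨v, hi⟩ = (sf' j).1 ⟨v, hj⟩ := by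
    intro i j v hi hj
    have h := hsf i j
    have h' : kerRestrict Λ (inf_le_left : U i ⊓ U j ≤ U i) (sf' i) =
        kerRestrict Λ (inf_le_right : U i ⊓ U j ≤ U j) (sf' j) := h
    exact congrFun (congrArg Subtype.val h') ⟨v, ⟨hi, hj⟩⟩
  let s : coverOpen Λ (iSup U) → ℂ := fun v => (sf' (idx v)).1 ⟨v, hidx v⟩
  have hs : s ∈ kerSections Λ (iSup U) := by
    apply mem_kerSections_of_local
    intro x hx
    obtain ⟨i, hi⟩ := Opens.mem_iSup.1 hx
    exact ⟨U i, le_iSup U i, hi, (sf' i).1, (sf' i).2,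
      fun v => compat i _ v v.2 (hidx ⟨v, coverOpen_mono Λ (le_iSup U i) v.2⟩)⟩
  refine ⟨(⟨s, hs⟩ : kerSections Λ (iSup U)), ?_, ?_⟩
  · intro i
    refine Subtype.ext (funext fun v => ?_)
    exact compat _ i v (hidx ⟨v, coverOpen_mono Λ (le_iSup U i) v.2⟩) v.2
  · intro t ht
    refine Subtype.ext (funext fun v => ?_)
    have h1 : kerRestrict Λ (le_iSup U (idx v)) (t : kerSections Λ (iSup U)) = sf' (idx v) :=
      ht (idx v)
    exact congrFun (congrArg Subtype.val h1) ⟨v, hidx v⟩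

/-- The sheaf `ker ∇̂₂` of complex vector spaces on `T × T̂`. -/
def kerSheaf (Λ : Submodule ℤ V) : TopCat.Sheaf (ModuleCat.{0} ℂ) (TorusProd Λ) :=
  ⟨kerPresheaf Λ, kerPresheaf_isSheaf Λ⟩

/-! ### Higher direct images, cohomology and the skyscraper -/

instance pushforward_additive {X Y : TopCat.{0}} (f : X ⟶ Y) :
    (TopCat.Sheaf.pushforward (ModuleCat.{0} ℂ) f).Additive where

instance sections_additive (X : TopCat.{0}) :
    ((sheafSections (Opens.grothendieckTopology X) (ModuleCat.{0} ℂ)).obj (op ⊤)).Additive where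

/-- The higher direct image `R^j f_* F` of a sheaf of complex vector spaces. -/
def higherDirectImage {X Y : TopCat.{0}} (f : X ⟶ Y) (j : ℕ)
    (F : TopCat.Sheaf (ModuleCat.{0} ℂ) X) : TopCat.Sheaf (ModuleCat.{0} ℂ) Y :=
  ((TopCat.Sheaf.pushforward (ModuleCat.{0} ℂ) f).rightDerived j).obj F

/-- The cohomology `H^j(X, F)` of a sheaf of complex vector spaces: the right derived functors of
the functor of global sections. -/
def sheafCohomology (X : TopCat.{0}) (j : ℕ) (F : TopCat.Sheaf (ModuleCat.{0} ℂ) X) :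
    ModuleCat.{0} ℂ :=
  (Functor.rightDerived
    ((sheafSections (Opens.grothendieckTopology X) (ModuleCat.{0} ℂ)).obj (op ⊤)) j).obj F

open Classical in
/-- The one-dimensional skyscraper sheaf `ℂ(x)`. -/
def skyscraper (X : TopCat.{0}) (x : X) : TopCat.Sheaf (ModuleCat.{0} ℂ) X :=
  skyscraperSheaf x (ModuleCat.of ℂ ℂ)

end PoincareTorus

end

/-! In the coordinates given by a basis of Λ and its dual basis, T × T̂ becomes T × (ℝ/ℤ)^g, and a
section of ker ∇̂₂ is locally a smooth function of x alone. The sheaf is thus constant along each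
circle up to a monodromy, which on the k-th circle is multiplication by e_k = exp(2πi x_k). For a
projection Z × ℝ/ℤ → Z and a sheaf N on Z twisted by a monodromy e, the cohomology along the circle
is the kernel of 1 - e on N in degree 0 and its cokernel in degree 1. Here 1 - e_k is injective,
because x_k is non-integral on a dense set, and Hadamard's lemma identifies its cokernel with the
smooth functions on the locus x_k ∈ ℤ. Each circle therefore shifts the degree by one and imposes
one more integrality condition. After g circles only the point 0 ∈ T is left, carrying ℂ in degree
g. The argument is run for p_* followed by an arbitrary additive left exact functor Q on sheaves on
T (`rightDerived_proj`): the identity functor gives the direct images, global sections give the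
cohomology, and no spectral sequence is needed. One circle is `rightDerived_twist`. It feeds three
facts into the dimension shift `rightDerived_comp_succ`: the circle can be cut open to [0, 1], which
resolves the twisted sheaf by two simpler ones (`pathComplex_shortExact`); pushforward is exact on
sequences starting with a sheaf that satisfies a Mayer–Vietoris condition on segments of fibres
(`epi_pushforward_of_fiberMV`); and the cut-open sheaf as well as all quotients of injectives
satisfy this condition (`fiberMV_path`, `fiberMV_of_injective`), the latter expressing that the
fibres have dimension one. The analysis is in `LatticeFrame.isTriple`, the induction over circles in
`rightDerived_towerFun`, and the comparison with ker ∇̂₂ in `LatticeFrame.isIso_kerHom`. -/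

open CategoryTheory TopologicalSpace Opposite
open scoped ContDiff Topology

noncomputable section

namespace PoincareTorus

/-! ### Homological algebra: dimension shifting and derived functors of a composition. -/

section Homological

open Limits

universe v₁ v₂ v₃ u₁ u₂ u₃

variable {C : Type u₁} [Category.{v₁} C] [Abelian C]
  {D : Type u₂} [Category.{v₂} D] [Abelian D]
  {E : Type u₃} [Category.{v₃} E] [Abelian E]

/-- The augmentation of an injective resolution. -/
def resolutionι {Z : C} (J : InjectiveResolution Z) : Z ⟶ J.cocomplex.X 0 := J.ι.f 0

instance {Z : C} (J : InjectiveResolution Z) : Mono (resolutionι J) :=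
  inferInstanceAs (Mono (J.ι.f 0))

theorem resolutionι_comp {Z : C} (J : InjectiveResolution Z) :
    resolutionι J ≫ J.cocomplex.d 0 1 = 0 := J.ι_f_zero_comp_complex_d

/-- The augmentation of an injective resolution is a kernel of the first differential. -/
def resolutionιIsKernel {Z : C} (J : InjectiveResolution Z) :
    IsLimit (KernelFork.ofι _ (resolutionι_comp J)) := J.isLimitKernelFork

theorem splice_zero {S : ShortComplex C} (J : InjectiveResolution S.X₃) :
    (S.g ≫ resolutionι J) ≫ J.cocomplex.d 0 1 = 0 := by
  rw [Category.assoc, resolutionι_comp, comp_zero]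

/-- The complex obtained by splicing a short exact sequence and a resolution of its third term. -/
def spliceComplex {S : ShortComplex C} (J : InjectiveResolution S.X₃) : CochainComplex C ℕ :=
  J.cocomplex.augment (S.g ≫ resolutionι J) (splice_zero J)

theorem splice_f_zero {S : ShortComplex C} (J : InjectiveResolution S.X₃) :
    S.f ≫ (spliceComplex J).d 0 1 = 0 := by
  change S.f ≫ S.g ≫ resolutionι J = 0
  rw [S.zero_assoc, zero_comp]

theorem spliceComplex_exactAt {S : ShortComplex C} (hS : S.ShortExact)
    (J : InjectiveResolution S.X₃) (n : ℕ) : (spliceComplex J).ExactAt (n + 1) := by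
  rw [HomologicalComplex.exactAt_iff' _ n (n + 1) (n + 2) (by simp) (by simp)]
  match n with
  | 0 =>
    have := hS.epi_g
    -- Precomposing the augmentation with the epimorphism `S.g` does not change its image, so
    -- exactness is inherited from the resolution of `S.X₃`.
    let α : ShortComplex.mk (S.g ≫ resolutionι J) (J.cocomplex.d 0 1) (splice_zero J) ⟶
        ShortComplex.mk _ _ (resolutionι_comp J) :=
      { τ₁ := S.g, τ₂ := 𝟙 _, τ₃ := 𝟙 _, comm₁₂ := by exact (Category.comp_id _).symm }
    have : Epi α.τ₁ := hS.epi_g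
    have : IsIso α.τ₂ := inferInstanceAs (IsIso (𝟙 _))
    have : Mono α.τ₃ := inferInstanceAs (Mono (𝟙 _))
    exact (ShortComplex.exact_iff_of_epi_of_isIso_of_mono α).2 J.exact₀
  | n + 1 => exact J.exact_succ n

/-- The injective resolution obtained by splicing a short exact sequence with injective middle term
and an injective resolution of its third term. -/
def spliceResolution {S : ShortComplex C} (hS : S.ShortExact) [Injective S.X₂]
    (J : InjectiveResolution S.X₃) : InjectiveResolution S.X₁ where
  cocomplex := spliceComplex J
  injective n := by
    cases n
    · exact inferInstanceAs (Injective S.X₂)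
    · exact J.injective _
  ι := (CochainComplex.fromSingle₀Equiv _ _).symm ⟨S.f, splice_f_zero J⟩
  quasiIso := ⟨fun n => by
    cases n
    · rw [CochainComplex.quasiIsoAt₀_iff, ShortComplex.quasiIso_iff_of_zeros]
      · have := hS.mono_f
        let α : S ⟶ ShortComplex.mk S.f (S.g ≫ resolutionι J) (by simp) :=
          { τ₁ := 𝟙 _, τ₂ := 𝟙 _, τ₃ := resolutionι J }
        have h1 : Epi α.τ₁ := inferInstanceAs (Epi (𝟙 _))
        have h2 : IsIso α.τ₂ := inferInstanceAs (IsIso (𝟙 _))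
        have h3 : Mono α.τ₃ := inferInstanceAs (Mono (resolutionι J))
        have := (ShortComplex.exact_iff_of_epi_of_isIso_of_mono α).1 hS.exact
        refine (ShortComplex.exact_and_mono_f_iff_of_iso ?_).2 ⟨this, hS.mono_f⟩
        exact ShortComplex.isoMk (Iso.refl _) (Iso.refl _) (Iso.refl _)
          ((Category.id_comp _).trans (Eq.trans (CochainComplex.fromSingle₀Equiv_symm_apply_f_zero
            (C := spliceComplex J) S.f (splice_f_zero J)).symm (Category.comp_id _).symm))
          ((Category.id_comp _).trans (Category.comp_id _).symm)
      all_goals rfl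
    · rw [quasiIsoAt_iff_exactAt]
      · exact spliceComplex_exactAt hS J _
      · apply CochainComplex.exactAt_succ_single_obj⟩

/-- Dimension shifting in degrees at least two. -/
theorem rightDerived_shift [HasInjectiveResolutions C] (T : C ⥤ D) [T.Additive]
    {S : ShortComplex C} (hS : S.ShortExact) [Injective S.X₂] (n : ℕ) :
    Nonempty ((T.rightDerived (n + 2)).obj S.X₁ ≅ (T.rightDerived (n + 1)).obj S.X₃) := by
  let J := injectiveResolution S.X₃
  refine ⟨(spliceResolution hS J).isoRightDerivedObj T (n + 2) ≪≫ ?_ ≪≫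
    (J.isoRightDerivedObj T (n + 1)).symm⟩
  refine HomologicalComplex.homologyIsoSc' _ (n + 1) (n + 2) (n + 3) (by simp) (by simp) ≪≫ ?_ ≪≫
    (HomologicalComplex.homologyIsoSc' _ n (n + 1) (n + 2) (by simp) (by simp)).symm
  exact Iso.refl _

/-- Dimension shifting in degree one. -/
theorem rightDerived_one [HasInjectiveResolutions C] (T : C ⥤ D) [T.Additive]
    [PreservesFiniteLimits T] {S : ShortComplex C} (hS : S.ShortExact) [Injective S.X₂] :
    Nonempty ((T.rightDerived 1).obj S.X₁ ≅ cokernel (T.map S.g)) := by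
  let J := injectiveResolution S.X₃
  refine ⟨(spliceResolution hS J).isoRightDerivedObj T 1 ≪≫
    HomologicalComplex.homologyIsoSc' _ 0 1 2 (by simp) (by simp) ≪≫ ?_⟩
  let S' : ShortComplex D := ShortComplex.mk (T.map (S.g ≫ resolutionι J))
    (T.map (J.cocomplex.d 0 1)) (by rw [← T.map_comp, splice_zero, T.map_zero])
  change S'.homology ≅ _
  have w : T.map (resolutionι J) ≫ S'.g = 0 := by
    change T.map _ ≫ T.map _ = 0
    rw [← T.map_comp, resolutionι_comp, T.map_zero]
  have hi : IsLimit (KernelFork.ofι (T.map (resolutionι J)) w) :=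
    KernelFork.mapIsLimit _ (resolutionιIsKernel J) T
  have hm : Mono (T.map (resolutionι J)) := inferInstance
  have hl : hi.lift (KernelFork.ofι _ S'.zero) = T.map S.g := by
    exact Fork.IsLimit.hom_ext hi ((hi.fac _ WalkingParallelPair.zero).trans (T.map_comp _ _))
  -- By left exactness `T.obj S.X₃` itself is the object of 1-cycles, and by `hl` the map into it
  -- induced by the differential is `T.map S.g`.
  let L : S'.LeftHomologyData :=
    { K := T.obj S.X₃
      H := cokernel (T.map S.g)
      i := T.map (resolutionι J)
      π := cokernel.π _
      wi := w
      hi := hi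
      wπ := by rw [hl, cokernel.condition]
      hπ := CokernelCofork.IsColimit.ofπ _ _
        (fun f hf => cokernel.desc _ f (by rw [← hl]; exact hf))
        (fun f hf => cokernel.π_desc _ _ _)
        (fun f hf m hm => by rw [← cancel_epi (cokernel.π _), hm, cokernel.π_desc]) }
  exact L.homologyIso

instance rightDerived_additive [HasInjectiveResolutions C] (T : C ⥤ D) [T.Additive] (n : ℕ) :
    (T.rightDerived n).Additive where
  map_add {X Y f g} := by
    let I := injectiveResolution X
    let J := injectiveResolution Y
    rw [T.rightDerived_map_eq n f (InjectiveResolution.desc f J I) (by simp),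
      T.rightDerived_map_eq n g (InjectiveResolution.desc g J I) (by simp),
      T.rightDerived_map_eq n (f + g)
        (InjectiveResolution.desc f J I + InjectiveResolution.desc g J I) (by simp)]
    simp only [Functor.map_add, Preadditive.comp_add, Preadditive.add_comp]

theorem shortExact_map_of_epi (P : C ⥤ D) [P.Additive] [PreservesFiniteLimits P]
    {S : ShortComplex C} (hS : S.ShortExact) (h : Epi (P.map S.g)) : (S.map P).ShortExact :=
  have := hS.mono_f
  { exact := hS.exact.map_of_mono_of_preservesKernel P hS.mono_f inferInstance
    mono_f := inferInstanceAs (Mono (P.map S.f))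
    epi_g := h }

/-- The derived functors of a composition `P ⋙ Q` on objects of a class that is adapted to `P`. -/
theorem rightDerived_comp_of_adapted [EnoughInjectives C] [HasInjectiveResolutions D] (P : C ⥤ D)
    (Q : D ⥤ E) [P.Additive] [Q.Additive] [PreservesFiniteLimits P] [PreservesFiniteLimits Q]
    (hP : ∀ I : C, Injective I → Injective (P.obj I)) (Good : C → Prop)
    (hG : ∀ S : ShortComplex C, S.ShortExact → Injective S.X₂ → Good S.X₁ →
      Epi (P.map S.g) ∧ Good S.X₃) (n : ℕ) (A : C) (hA : Good A) :
    Nonempty (((P ⋙ Q).rightDerived n).obj A ≅ (Q.rightDerived n).obj (P.obj A)) := by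
  induction n generalizing A with
  | zero =>
    exact ⟨(P ⋙ Q).rightDerivedZeroIsoSelf.app A ≪≫ (Q.rightDerivedZeroIsoSelf.app _).symm⟩
  | succ n ih =>
    let S : ShortComplex C := ShortComplex.mk (Injective.ι A) (cokernel.π _) (cokernel.condition _)
    have hS : S.ShortExact :=
      { exact := ShortComplex.exact_cokernel _
        mono_f := inferInstanceAs (Mono (Injective.ι A))
        epi_g := inferInstanceAs (Epi (cokernel.π _)) }
    have hI : Injective S.X₂ := inferInstanceAs (Injective (Injective.under A))
    -- `P` keeps the sequence A → I → I/A exact and `P I` is injective, so the same sequence shifts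
    -- degrees for `P ⋙ Q` and for `Q`; the quotient I/A is again in the class.
    obtain ⟨h1, h2⟩ := hG S hS hI hA
    have hS' := shortExact_map_of_epi P hS h1
    have hI' : Injective (S.map P).X₂ := hP _ hI
    cases n with
    | zero =>
      obtain ⟨e1⟩ := rightDerived_one (P ⋙ Q) hS
      obtain ⟨e2⟩ := rightDerived_one Q hS'
      exact ⟨e1 ≪≫ e2.symm⟩
    | succ n =>
      obtain ⟨e1⟩ := rightDerived_shift (P ⋙ Q) hS n
      obtain ⟨e2⟩ := rightDerived_shift Q hS' n
      obtain ⟨e3⟩ := ih _ h2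
      exact ⟨e1 ≪≫ e3 ≪≫ e2.symm⟩

/-- For a monomorphism `N ⟶ E` with cokernel `Q₀` and a monomorphism `E ⟶ I`, the quotient
`I / N` is an extension of `I / E` by `Q₀`. -/
theorem exists_shortExact_quotient {S : ShortComplex C} (hS : S.ShortExact) {I : C} (j : S.X₂ ⟶ I)
    [Mono j] :
    ∃ (u : S.X₃ ⟶ cokernel (S.f ≫ j)) (v : cokernel (S.f ≫ j) ⟶ cokernel j) (w : u ≫ v = 0),
      S.g ≫ u = j ≫ cokernel.π _ ∧ cokernel.π _ ≫ v = cokernel.π j ∧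
        (ShortComplex.mk u v w).ShortExact := by
  have := hS.epi_g
  have := hS.mono_f
  have hu0 : S.f ≫ j ≫ cokernel.π (S.f ≫ j) = 0 := by
    rw [← Category.assoc, cokernel.condition]
  have hv0 : (S.f ≫ j) ≫ cokernel.π j = 0 := by
    rw [Category.assoc, cokernel.condition, comp_zero]
  let u := hS.exact.desc _ hu0
  have hu : S.g ≫ u = j ≫ cokernel.π _ := hS.exact.g_desc _ hu0
  let v := cokernel.desc _ _ hv0
  have hv : cokernel.π _ ≫ v = cokernel.π j := cokernel.π_desc _ _ _
  have w : u ≫ v = 0 := by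
    rw [← cancel_epi S.g, reassoc_of% hu, hv, cokernel.condition, comp_zero]
  have hj : (ShortComplex.mk j (cokernel.π j) (cokernel.condition _)).Exact :=
    ShortComplex.exact_cokernel _
  have hN : (ShortComplex.mk (S.f ≫ j) (cokernel.π _) (cokernel.condition _)).Exact :=
    ShortComplex.exact_cokernel _
  refine ⟨u, v, w, hu, hv, ?_⟩
  refine { exact := ?_, mono_f := ?_, epi_g := epi_of_epi_fac hv }
  · rw [ShortComplex.exact_iff_exact_up_to_refinements]
    intro A x hx
    obtain ⟨A₁, π₁, _, y, hy⟩ := surjective_up_to_refinements_of_epi (cokernel.π (S.f ≫ j)) x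
    have hy' : y ≫ cokernel.π j = 0 := by
      rw [← hv, ← reassoc_of% hy]
      exact (congrArg (π₁ ≫ ·) hx).trans comp_zero
    obtain ⟨A₂, π₂, _, z, hz⟩ := hj.exact_up_to_refinements y hy'
    refine ⟨A₂, π₂ ≫ π₁, inferInstance, z ≫ S.g, ?_⟩
    dsimp at hz ⊢
    rw [Category.assoc, hy, Category.assoc, hu, reassoc_of% hz]
  · dsimp
    refine Preadditive.mono_of_cancel_zero _ fun {A} x hx => ?_
    obtain ⟨A₁, π₁, _, y, hy⟩ := surjective_up_to_refinements_of_epi S.g x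
    have hy' : (y ≫ j) ≫ cokernel.π (S.f ≫ j) = 0 := by
      rw [Category.assoc, ← hu, ← reassoc_of% hy, hx, comp_zero]
    obtain ⟨A₂, π₂, _, z, hz⟩ := hN.exact_up_to_refinements _ hy'
    have : π₂ ≫ y = z ≫ S.f := by
      dsimp at hz
      rw [← cancel_mono j, Category.assoc, hz, Category.assoc]
    rw [← cancel_epi π₁, ← cancel_epi π₂, hy, reassoc_of% this, S.zero]
    simp

/-- In a morphism of short exact sequences that is the identity on third terms, the cokernels of
the first two components agree. -/
theorem shortExact_cokernel_of_id {A B C' A' B' M : C} {i : A ⟶ B} {q : B ⟶ C'} {i' : A' ⟶ B'}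
    {q' : B' ⟶ C'} {a : A ⟶ A'} {b : B ⟶ B'} {m : A' ⟶ M} {w : i ≫ q = 0} {w' : i' ≫ q' = 0}
    {wm : a ≫ m = 0} (h1 : (ShortComplex.mk i q w).ShortExact)
    (h2 : (ShortComplex.mk i' q' w').ShortExact) (h3 : (ShortComplex.mk a m wm).ShortExact)
    (hab : a ≫ i' = i ≫ b) (hb : b ≫ q' = q) :
    ∃ (m' : B' ⟶ M) (wm' : b ≫ m' = 0), (ShortComplex.mk b m' wm').ShortExact := by
  have := h1.mono_f
  have := h1.epi_g
  have := h2.mono_f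
  have := h3.mono_f
  have := h3.epi_g
  dsimp at *
  have hk : a ≫ i' ≫ cokernel.π b = 0 := by
    rw [reassoc_of% hab, cokernel.condition, comp_zero]
  let k : M ⟶ cokernel b := h3.exact.desc _ hk
  have hmk : m ≫ k = i' ≫ cokernel.π b := h3.exact.g_desc _ hk
  have hB : (ShortComplex.mk b (cokernel.π b) (cokernel.condition _)).Exact :=
    ShortComplex.exact_cokernel _
  have hbm : Mono b := by
    refine Preadditive.mono_of_cancel_zero _ fun {X} x hx => ?_
    have hx' : x ≫ q = 0 := by rw [← hb, reassoc_of% hx, zero_comp]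
    obtain ⟨X₁, π₁, _, y, hy⟩ := h1.exact.exact_up_to_refinements x hx'
    dsimp at hy
    have : y = 0 := by
      rw [← cancel_mono a, ← cancel_mono i', Category.assoc, hab, ← reassoc_of% hy, hx]
      simp
    rw [← cancel_epi π₁, hy, this]
    simp
  have hkm : Mono k := by
    refine Preadditive.mono_of_cancel_zero _ fun {X} x hx => ?_
    obtain ⟨X₁, π₁, _, y, hy⟩ := surjective_up_to_refinements_of_epi m x
    have hy' : (y ≫ i') ≫ cokernel.π b = 0 := by
      rw [Category.assoc, ← hmk, ← reassoc_of% hy, hx, comp_zero]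
    obtain ⟨X₂, π₂, _, z, hz⟩ := hB.exact_up_to_refinements _ hy'
    dsimp at hz
    have hz' : z ≫ q = 0 := by rw [← hb, ← reassoc_of% hz, w']; simp
    obtain ⟨X₃, π₃, _, t, ht⟩ := h1.exact.exact_up_to_refinements z hz'
    dsimp at ht
    have : π₃ ≫ π₂ ≫ y = t ≫ a := by
      rw [← cancel_mono i', Category.assoc, Category.assoc, hz, reassoc_of% ht, Category.assoc, hab]
    rw [← cancel_epi π₁, ← cancel_epi π₂, ← cancel_epi π₃, hy, reassoc_of% this, wm]
    simp
  have hke : Epi k := by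
    rw [epi_iff_surjective_up_to_refinements]
    intro X x
    obtain ⟨X₁, π₁, _, y, hy⟩ := surjective_up_to_refinements_of_epi (cokernel.π b) x
    obtain ⟨X₂, π₂, _, z, hz⟩ := surjective_up_to_refinements_of_epi q (y ≫ q')
    have hs : (π₂ ≫ y - z ≫ b) ≫ q' = 0 := by
      rw [Preadditive.sub_comp, Category.assoc, Category.assoc, hb, hz, sub_self]
    obtain ⟨X₃, π₃, _, t, ht⟩ := h2.exact.exact_up_to_refinements _ hs
    dsimp at ht
    refine ⟨X₃, π₃ ≫ π₂ ≫ π₁, inferInstance, t ≫ m, ?_⟩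
    rw [Category.assoc, Category.assoc, hy, Category.assoc, hmk, ← reassoc_of% ht]
    simp
  have : IsIso k := isIso_of_mono_of_epi k
  refine ⟨cokernel.π b ≫ inv k, by simp, ?_⟩
  refine { exact := ?_, mono_f := hbm, epi_g := inferInstanceAs (Epi (cokernel.π b ≫ inv k)) }
  let e : ShortComplex.mk b (cokernel.π b) (cokernel.condition _) ≅
      ShortComplex.mk b (cokernel.π b ≫ inv k) (by simp) :=
    ShortComplex.isoMk (Iso.refl _) (Iso.refl _) (asIso k).symm (by simp) (by simp)
  exact (ShortComplex.exact_iff_of_iso e).1 hB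

/-- An object is a quotient of an injective object. -/
def IsInjQuotient (A : C) : Prop := ∃ (I : C) (f : I ⟶ A), Injective I ∧ Epi f

/-- Let `0 ⟶ N ⟶ E ⟶ Q₀ ⟶ 0` be exact, where `P` is exact on sequences that start with `E`, and let
`M` be the cokernel of the monomorphism `P E ⟶ P Q₀`. If `P` is exact on sequences that start with
quotients of injectives, then the derived functors of `P ⋙ Q` at `N` are those of `Q` at `M`,
shifted by one. -/
theorem rightDerived_comp_succ [EnoughInjectives C] [HasInjectiveResolutions D] (P : C ⥤ D)
    (Q : D ⥤ E) [P.Additive] [Q.Additive] [PreservesFiniteLimits P] [PreservesFiniteLimits Q]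
    (hP : ∀ I : C, Injective I → Injective (P.obj I))
    (hG : ∀ S : ShortComplex C, S.ShortExact → IsInjQuotient S.X₁ → Epi (P.map S.g))
    {S : ShortComplex C} (hS : S.ShortExact)
    (hE : ∀ {B C' : C} (i : S.X₂ ⟶ B) (q : B ⟶ C') (w : i ≫ q = 0),
      (ShortComplex.mk i q w).ShortExact → Epi (P.map q))
    {M : D} (m : P.obj S.X₃ ⟶ M) (wm : P.map S.g ≫ m = 0)
    (hM : (ShortComplex.mk (P.map S.g) m wm).ShortExact) :
    IsZero (((P ⋙ Q).rightDerived 0).obj S.X₁) ∧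
      ∀ n, Nonempty (((P ⋙ Q).rightDerived (n + 1)).obj S.X₁ ≅ (Q.rightDerived n).obj M) := by
  have := hS.mono_f
  have := hM.mono_f
  -- `P N` is the kernel of the monomorphism `P E ⟶ P Q₀`.
  have hz : IsZero (P.obj S.X₁) := by
    have h1 : P.map S.f ≫ P.map S.g = 0 := by rw [← P.map_comp, S.zero, P.map_zero]
    have hm : Mono (P.map S.g) := hM.mono_f
    have h2 : P.map S.f = 0 := by rw [← cancel_mono (P.map S.g), h1, zero_comp]
    exact (IsZero.iff_id_eq_zero _).2 (by rw [← cancel_mono (P.map S.f), h2]; simp)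
  refine ⟨(Q.map_isZero hz).of_iso ((P ⋙ Q).rightDerivedZeroIsoSelf.app S.X₁), ?_⟩
  -- The injective object I is chosen to contain E, so that N ⊆ E ⊆ I and I/N is an extension of I/E
  -- by Q₀.
  let j := Injective.ι S.X₂
  obtain ⟨u, v, w, hu, hv, hQ⟩ := exists_shortExact_quotient hS j
  let S₁ : ShortComplex C := ShortComplex.mk j (cokernel.π j) (cokernel.condition _)
  have hS₁ : S₁.ShortExact :=
    { exact := ShortComplex.exact_cokernel _
      mono_f := inferInstanceAs (Mono j)
      epi_g := inferInstanceAs (Epi (cokernel.π _)) }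
  let S₂ : ShortComplex C := ShortComplex.mk (S.f ≫ j) (cokernel.π _) (cokernel.condition _)
  have hS₂ : S₂.ShortExact :=
    { exact := ShortComplex.exact_cokernel _
      mono_f := inferInstanceAs (Mono (S.f ≫ j))
      epi_g := inferInstanceAs (Epi (cokernel.π _)) }
  have hI : Injective S₂.X₂ := inferInstanceAs (Injective (Injective.under S.X₂))
  have e1 : Epi (P.map S₁.g) := hE _ _ _ hS₁
  have e2 : Epi (P.map v) := by
    refine epi_of_epi_fac (f := P.map (cokernel.π (S.f ≫ j))) (h := P.map S₁.g) ?_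
    rw [← P.map_comp, hv]
  -- The rows 0 → PE → PI → P(I/E) → 0 and 0 → PQ₀ → P(I/N) → P(I/E) → 0 share their last term, so
  -- PI → P(I/N) has the same cokernel M as PE → PQ₀.
  obtain ⟨m', wm', hm'⟩ := shortExact_cokernel_of_id (i := P.map j)
    (q := P.map (cokernel.π j)) (i' := P.map u) (q' := P.map v) (b := P.map S₂.g)
    (w := by rw [← P.map_comp, cokernel.condition, P.map_zero])
    (w' := by rw [← P.map_comp, w, P.map_zero])
    (shortExact_map_of_epi P hS₁ e1) (shortExact_map_of_epi P hQ e2) hM (by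
      rw [← P.map_comp, hu, P.map_comp]) (by
      rw [← P.map_comp, hv])
  have hPI : Injective (P.obj S₂.X₂) := hP _ hI
  -- Since PI is injective, 0 → PI → P(I/N) → M → 0 splits and stays exact under `Q` and its derived
  -- functors. In positive degrees PI contributes nothing, so P(I/N) and M have the same derived
  -- functors there.
  have hsplit := hm'.splittingOfInjective
  have hquot : IsInjQuotient S₂.X₃ := ⟨_, S₂.g, hI, hS₂.epi_g⟩
  -- I/N need not be injective, but it is a quotient of an injective, and this class is adapted to
  -- `P`: a quotient of an injective by any subobject is again in it.
  have key : ∀ n, Nonempty (((P ⋙ Q).rightDerived n).obj S₂.X₃ ≅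
      (Q.rightDerived n).obj (P.obj S₂.X₃)) := fun n =>
    rightDerived_comp_of_adapted P Q hP IsInjQuotient (fun S hS hI hA =>
      ⟨hG S hS hA, ⟨_, S.g, hI, hS.epi_g⟩⟩) n _ hquot
  intro n
  cases n with
  | zero =>
    obtain ⟨e⟩ := rightDerived_one (P ⋙ Q) hS₂
    have hs := (hsplit.map Q)
    refine ⟨e ≪≫ ?_ ≪≫ (Q.rightDerivedZeroIsoSelf.app M).symm⟩
    exact (cokernelIsCokernel _).coconePointUniqueUpToIso hs.shortExact.gIsCokernel
  | succ n =>
    obtain ⟨e⟩ := rightDerived_shift (P ⋙ Q) hS₂ n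
    obtain ⟨e'⟩ := key (n + 1)
    refine ⟨e ≪≫ e' ≪≫ ?_⟩
    have hs := (hsplit.map (Q.rightDerived (n + 1))).shortExact
    have hz : IsZero ((Q.rightDerived (n + 1)).obj (P.obj S₂.X₂)) :=
      Q.isZero_rightDerived_obj_injective_succ n _
    have h1 := hs.mono_f
    have h2 := hs.epi_g
    have : Mono ((Q.rightDerived (n + 1)).map m') :=
      (ShortComplex.exact_iff_mono _ (hz.eq_of_src _ _)).1 hs.exact
    have : Epi ((Q.rightDerived (n + 1)).map m') := h2
    have : IsIso ((Q.rightDerived (n + 1)).map m') := isIso_of_mono_of_epi _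
    exact asIso ((Q.rightDerived (n + 1)).map m')

end Homological


/-! ### Sections of sheaves; injective sheaves are flasque. -/

section Sections

open Limits

/-- Sheaves of complex vector spaces. -/
abbrev Sh (X : TopCat.{0}) := TopCat.Sheaf (ModuleCat.{0} ℂ) X

variable {X : TopCat.{0}}

/-- Sections of a sheaf over an open set. -/
abbrev Sec (F : Sh X) (U : Opens X) : ModuleCat.{0} ℂ := F.obj.obj (op U)

/-- Restriction of sections. -/
def res (F : Sh X) {U V : Opens X} (h : V ≤ U) : Sec F U →ₗ[ℂ] Sec F V :=
  (F.obj.map (homOfLE h).op).hom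

/-- The action of a morphism of sheaves on sections. -/
def secMap {F G : Sh X} (φ : F ⟶ G) (U : Opens X) : Sec F U →ₗ[ℂ] Sec G U :=
  (φ.hom.app (op U)).hom

theorem res_res (F : Sh X) {U V W : Opens X} (h : V ≤ U) (h' : W ≤ V) (s : Sec F U) :
    res F h' (res F h s) = res F (h'.trans h) s := by
  change (F.obj.map (homOfLE h).op ≫ F.obj.map (homOfLE h').op).hom s = _
  rw [← F.obj.map_comp]
  rfl

theorem res_self (F : Sh X) {U : Opens X} (h : U ≤ U) (s : Sec F U) : res F h s = s := by
  change (F.obj.map (𝟙 _)).hom s = _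
  rw [F.obj.map_id]
  rfl

theorem secMap_res {F G : Sh X} (φ : F ⟶ G) {U V : Opens X} (h : V ≤ U) (s : Sec F U) :
    secMap φ V (res F h s) = res G h (secMap φ U s) :=
  congrArg (fun f => f.hom s) (φ.hom.naturality (homOfLE h).op)

theorem secMap_comp {F G H : Sh X} (φ : F ⟶ G) (ψ : G ⟶ H) (U : Opens X) (s : Sec F U) :
    secMap (φ ≫ ψ) U s = secMap ψ U (secMap φ U s) := rfl

theorem hom_ext_sec {F G : Sh X} {φ ψ : F ⟶ G} (h : ∀ U s, secMap φ U s = secMap ψ U s) :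
    φ = ψ := by
  apply ObjectProperty.hom_ext
  ext U s
  exact h U.unop s

theorem epi_iff_sec {F G : Sh X} (φ : F ⟶ G) : Epi φ ↔ ∀ (U : Opens X) (t : Sec G U), ∀ x ∈ U,
    ∃ (V : Opens X) (h : V ≤ U), x ∈ V ∧ ∃ s : Sec F V, secMap φ V s = res G h t := by
  rw [← TopCat.Sheaf.isLocallySurjective_iff_epi, TopCat.Presheaf.isLocallySurjective_iff]
  constructor
  · intro h U t x hx
    obtain ⟨V, hV, ⟨s, hs⟩, hxV⟩ := h U t x hx
    exact ⟨V, hV, hxV, s, hs⟩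
  · intro h U t x hx
    obtain ⟨V, hV, hxV, s, hs⟩ := h U t x hx
    exact ⟨V, hV, ⟨s, hs⟩, hxV⟩

instance secFunctor_preservesFiniteLimits (U : Opens X) : PreservesFiniteLimits
    (TopCat.Sheaf.forget (ModuleCat.{0} ℂ) X ⋙ (evaluation _ _).obj (op U)) :=
  have : PreservesFiniteLimits (TopCat.Sheaf.forget (ModuleCat.{0} ℂ) X) := inferInstance
  have : PreservesFiniteLimits ((evaluation (Opens X)ᵒᵖ (ModuleCat.{0} ℂ)).obj (op U)) :=
    inferInstance
  comp_preservesFiniteLimits _ _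

theorem secMap_injective {F G : Sh X} (φ : F ⟶ G) [Mono φ] (U : Opens X) :
    Function.Injective (secMap φ U) := by
  have : Mono ((TopCat.Sheaf.forget (ModuleCat.{0} ℂ) X ⋙ (evaluation _ _).obj (op U)).map φ) :=
    inferInstance
  exact (ModuleCat.mono_iff_injective _).1 this

theorem mono_of_secMap_injective {F G : Sh X} (φ : F ⟶ G)
    (h : ∀ U, Function.Injective (secMap φ U)) : Mono φ := by
  constructor
  intro H a b hab
  refine hom_ext_sec fun U s => h U ?_
  rw [← secMap_comp, ← secMap_comp, hab]

theorem exists_secMap_eq_of_exact {S : ShortComplex (Sh X)} (hS : S.Exact) (hf : Mono S.f)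
    {U : Opens X} (b : Sec S.X₂ U) (hb : secMap S.g U b = 0) : ∃ a, secMap S.f U a = b := by
  let Φ := TopCat.Sheaf.forget (ModuleCat.{0} ℂ) X ⋙ (evaluation _ _).obj (op U)
  have : Φ.Additive := ⟨by intros; rfl⟩
  have := hS.map_of_mono_of_preservesKernel Φ hf inferInstance
  exact (ShortComplex.moduleCat_exact_iff _).1 this b hb

theorem exact_of_sec (S : ShortComplex (Sh X))
    (h : ∀ (U : Opens X) (b : Sec S.X₂ U), secMap S.g U b = 0 → ∀ x ∈ U,
      ∃ (V : Opens X) (hV : V ≤ U), x ∈ V ∧ ∃ a, secMap S.f V a = res S.X₂ hV b) : S.Exact := by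
  rw [S.exact_iff_epi_toCycles, epi_iff_sec]
  intro U t x hx
  obtain ⟨V, hV, hxV, a, ha⟩ := h U (secMap S.iCycles U t) (by
    rw [← secMap_comp, S.iCycles_g]; rfl) x hx
  refine ⟨V, hV, hxV, a, secMap_injective S.iCycles V ?_⟩
  rw [← secMap_comp, S.toCycles_i, ha, secMap_res]

theorem exists_glue (F : Sh X) {U V : Opens X} (s : Sec F U) (t : Sec F V)
    (h : res F (inf_le_left : U ⊓ V ≤ U) s = res F inf_le_right t) :
    ∃ r : Sec F (U ⊔ V), res F le_sup_left r = s ∧ res F le_sup_right r = t := by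
  let W : Bool → Opens X := fun b => bif b then U else V
  let sf : ∀ b, Sec F (W b) := fun b => match b with
    | true => s
    | false => t
  obtain ⟨r, hr, -⟩ := F.existsUnique_gluing' W (U ⊔ V)
    (fun b => homOfLE (by cases b; exacts [le_sup_right, le_sup_left]))
    (sup_le (le_iSup W true) (le_iSup W false)) sf (by
      intro i j
      cases i <;> cases j
      · rfl
      · have := congrArg (res F (le_of_eq (inf_comm V U))) h
        rw [res_res, res_res] at this
        exact this.symm
      · exact h
      · rfl)
  exact ⟨r, hr true, hr false⟩

instance (F : Sh X) : Subsingleton (Sec F ⊥) := by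
  refine ⟨fun s t => ?_⟩
  refine F.eq_of_locally_eq' (ι := PEmpty.{1}) (fun i => i.elim) ⊥ (fun i => i.elim) bot_le s t
    (fun i => i.elim)

/-- The presheaf freely generated by an open set. -/
def freePresheaf (U : Opens X) : (Opens X)ᵒᵖ ⥤ ModuleCat.{0} ℂ where
  obj W := ModuleCat.of ℂ (PLift (W.unop ≤ U) →₀ ℂ)
  map f := ModuleCat.ofHom (Finsupp.lmapDomain ℂ ℂ (fun h => ⟨f.unop.le.trans h.down⟩))
  map_id W := by
    ext : 1
    exact Finsupp.lmapDomain_id ℂ ℂ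
  map_comp f g := by
    ext : 1
    refine Finsupp.lhom_ext fun h c => ?_
    change Finsupp.mapDomain _ _ = Finsupp.mapDomain _ (Finsupp.mapDomain _ _)
    rw [Finsupp.mapDomain_single, Finsupp.mapDomain_single, Finsupp.mapDomain_single]

/-- The inclusion of free presheaves attached to an inclusion of open sets. -/
def freePresheafMap {U V : Opens X} (h : V ≤ U) : freePresheaf V ⟶ freePresheaf U where
  app W := ModuleCat.ofHom (Finsupp.lmapDomain ℂ ℂ (fun h' => ⟨h'.down.trans h⟩))
  naturality W W' f := by
    ext : 1
    refine Finsupp.lhom_ext fun h c => ?_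
    change Finsupp.mapDomain _ (Finsupp.mapDomain _ _) = Finsupp.mapDomain _ (Finsupp.mapDomain _ _)
    rw [Finsupp.mapDomain_single, Finsupp.mapDomain_single, Finsupp.mapDomain_single,
      Finsupp.mapDomain_single]

instance {U V : Opens X} (h : V ≤ U) : Mono (freePresheafMap h) := by
  rw [NatTrans.mono_iff_mono_app]
  intro W
  rw [ModuleCat.mono_iff_injective]
  exact Finsupp.mapDomain_injective fun a b _ => Subsingleton.elim a b

/-- The morphism from a free presheaf determined by a section. -/
def freePresheafDesc (I : Sh X) {V : Opens X} (s : Sec I V) : freePresheaf V ⟶ I.obj where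
  app W := ModuleCat.ofHom (Finsupp.lift (Sec I W.unop) ℂ _
    (fun h : PLift (W.unop ≤ V) => res I h.down s))
  naturality W W' f := by
    ext : 1
    refine Finsupp.lhom_ext fun h c => ?_
    change Finsupp.lift _ ℂ _ _ (Finsupp.mapDomain _ (Finsupp.single h c)) =
      res I f.unop.le (Finsupp.lift _ ℂ _ _ (Finsupp.single h c))
    rw [Finsupp.mapDomain_single]
    simp [Finsupp.lift_apply, res_res]

/-- Sections over an open set are morphisms from the sheafified free presheaf on it. Sheafification
is exact, so an inclusion of open sets gives a monomorphism, along which maps to an injective sheaf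
extend. -/
theorem injective_extend (I : Sh X) [Injective I] {U V : Opens X} (h : V ≤ U) (s : Sec I V) :
    ∃ t : Sec I U, res I h t = s := by
  let J := Opens.grothendieckTopology X
  let i := freePresheafMap h
  let A : Sh X := (presheafToSheaf J _).obj (freePresheaf V)
  let B : Sh X := (presheafToSheaf J _).obj (freePresheaf U)
  let j : A ⟶ B := (presheafToSheaf J _).map i
  let φ : A ⟶ I := ⟨sheafifyLift J (freePresheafDesc I s) I.property⟩
  have hm : Mono j := inferInstanceAs (Mono ((presheafToSheaf J _).map i))
  obtain ⟨ψ, hψ⟩ := Injective.factors φ j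
  let β : freePresheaf U ⟶ I.obj := toSheafify J _ ≫ ψ.hom
  have hβ : i ≫ β = freePresheafDesc I s := by
    rw [← toSheafify_sheafifyLift J (freePresheafDesc I s) I.property]
    change i ≫ toSheafify J _ ≫ ψ.hom = toSheafify J _ ≫ φ.hom
    rw [← hψ, ← Category.assoc, toSheafify_naturality]
    rfl
  refine ⟨(β.app (op U)).hom (Finsupp.single ⟨le_rfl⟩ 1), ?_⟩
  have h1 := congrArg (fun f => f.hom (Finsupp.single ⟨le_rfl⟩ 1)) (β.naturality (homOfLE h).op)
  have h2 := congrArg (fun f => (f.app (op V)).hom (Finsupp.single ⟨le_rfl⟩ 1)) hβ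
  refine h1.symm.trans (Eq.trans ?_ (h2.trans ?_))
  · change (β.app (op V)).hom (Finsupp.mapDomain _ _) = (β.app (op V)).hom (Finsupp.mapDomain _ _)
    rw [Finsupp.mapDomain_single, Finsupp.mapDomain_single]
  · change Finsupp.lift _ ℂ _ _ (Finsupp.single _ 1) = s
    simp [Finsupp.lift_apply, res_self]

end Sections


/-! ### Lifting sections along the fibres of Z × ℝ/ℤ → Z. -/

section Lifting

variable {X : TopCat.{0}}

/-- A section `c` of `C` lifts to `B` on a neighbourhood of `K`. -/
def LiftsNear {B C : Sh X} (q : B ⟶ C) {W : Opens X} (c : Sec C W) (K : Set X) : Prop :=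
  ∃ (W' : Opens X) (h : W' ≤ W), K ⊆ W' ∧ ∃ b : Sec B W', secMap q W' b = res C h c

/-- Sections near `K₁ ∩ K₂` are differences of sections near `K₁` and `K₂`. -/
def MayerVietoris (A : Sh X) (K₁ K₂ : Set X) : Prop :=
  ∀ W : Opens X, K₁ ∩ K₂ ⊆ W → ∀ a : Sec A W, ∃ (W₁ W₂ : Opens X) (h : W₁ ⊓ W₂ ≤ W),
    K₁ ⊆ W₁ ∧ K₂ ⊆ W₂ ∧ ∃ (a₁ : Sec A W₁) (a₂ : Sec A W₂),
      res A inf_le_left a₁ - res A inf_le_right a₂ = res A h a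

/-- Two lifts differ near K₁ ∩ K₂ by a section of the first term. Writing this as a difference of
sections near K₁ and K₂ and correcting each lift makes the two agree on the overlap, so that they
glue. -/
theorem liftsNear_union {S : ShortComplex (Sh X)} (hS : S.ShortExact) {K₁ K₂ : Set X}
    (hA : MayerVietoris S.X₁ K₁ K₂) {W : Opens X} {c : Sec S.X₃ W}
    (h₁ : LiftsNear S.g c K₁) (h₂ : LiftsNear S.g c K₂) : LiftsNear S.g c (K₁ ∪ K₂) := by
  obtain ⟨W₁, hW₁, hK₁, b₁, hb₁⟩ := h₁
  obtain ⟨W₂, hW₂, hK₂, b₂, hb₂⟩ := h₂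
  obtain ⟨a, ha⟩ := exists_secMap_eq_of_exact hS.exact hS.mono_f
    (res S.X₂ (inf_le_left : W₁ ⊓ W₂ ≤ W₁) b₁ - res S.X₂ (inf_le_right : W₁ ⊓ W₂ ≤ W₂) b₂) (by
      rw [map_sub, secMap_res, secMap_res, hb₁, hb₂, res_res, res_res, sub_self])
  obtain ⟨V₁, V₂, hV, hKV₁, hKV₂, a₁, a₂, haa⟩ := hA (W₁ ⊓ W₂)
    (fun x hx => ⟨hK₁ hx.1, hK₂ hx.2⟩) a
  have hfg : ∀ (U : Opens X) (s : Sec S.X₁ U), secMap S.g U (secMap S.f U s) = 0 := by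
    intro U s
    rw [← secMap_comp, S.zero]
    rfl
  let U₁ := W₁ ⊓ V₁
  let U₂ := W₂ ⊓ V₂
  let s : Sec S.X₂ U₁ := res S.X₂ inf_le_left b₁ - secMap S.f U₁ (res S.X₁ inf_le_right a₁)
  let t : Sec S.X₂ U₂ := res S.X₂ inf_le_left b₂ - secMap S.f U₂ (res S.X₁ inf_le_right a₂)
  have hle : U₁ ⊓ U₂ ≤ V₁ ⊓ V₂ := inf_le_inf inf_le_right inf_le_right
  have hst : res S.X₂ (inf_le_left : U₁ ⊓ U₂ ≤ U₁) s = res S.X₂ inf_le_right t := by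
    have e1 := congrArg (fun z => secMap S.f _ (res S.X₁ hle z)) haa
    simp only [map_sub, res_res, secMap_res] at e1
    have e2 := congrArg (res S.X₂ (hle.trans hV)) ha
    simp only [map_sub, res_res] at e2
    rw [e2] at e1
    simp only [s, t, map_sub, res_res, secMap_res]
    rw [sub_eq_sub_iff_sub_eq_sub]
    exact e1.symm
  obtain ⟨r, hr₁, hr₂⟩ := exists_glue S.X₂ s t hst
  have hUW : U₁ ⊔ U₂ ≤ W := sup_le (inf_le_left.trans hW₁) (inf_le_left.trans hW₂)
  refine ⟨U₁ ⊔ U₂, hUW, ?_, r, ?_⟩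
  · rintro x (hx | hx)
    · exact Or.inl ⟨hK₁ hx, hKV₁ hx⟩
    · exact Or.inr ⟨hK₂ hx, hKV₂ hx⟩
  · refine S.X₃.eq_of_locally_eq₂ (homOfLE le_sup_left) (homOfLE le_sup_right) le_rfl _ _ ?_ ?_
    · change res S.X₃ _ _ = res S.X₃ _ _
      rw [← secMap_res, hr₁, res_res]
      simp only [s, map_sub, secMap_res, hb₁, hfg, res_res, map_zero, sub_zero]
    · change res S.X₃ _ _ = res S.X₃ _ _
      rw [← secMap_res, hr₂, res_res]
      simp only [t, map_sub, secMap_res, hb₂, hfg, res_res, map_zero, sub_zero]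

theorem mayerVietoris_of_separated (A : Sh X) {K₁ K₂ : Set X} (h : SeparatedNhds K₁ K₂) :
    MayerVietoris A K₁ K₂ := by
  intro W _ a
  obtain ⟨U, V, hU, hV, hKU, hKV, hd⟩ := h
  have hb : (⟨U, hU⟩ ⊓ ⟨V, hV⟩ : Opens X) = ⊥ := Opens.ext hd.inter_eq
  refine ⟨⟨U, hU⟩, ⟨V, hV⟩, by rw [hb]; exact bot_le, hKU, hKV, 0, 0, ?_⟩
  have : Subsingleton (Sec A (⟨U, hU⟩ ⊓ ⟨V, hV⟩ : Opens X)) := by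
    rw [hb]; infer_instance
  exact Subsingleton.elim _ _

theorem liftsNear_singleton {S : ShortComplex (Sh X)} (hS : S.ShortExact) {W : Opens X}
    (c : Sec S.X₃ W) {x : X} (hx : x ∈ W) : LiftsNear S.g c {x} := by
  obtain ⟨V, hV, hxV, s, hs⟩ := (epi_iff_sec S.g).1 hS.epi_g W c x hx
  exact ⟨V, hV, by simpa using hxV, s, hs⟩

/-- Finitely many points have disjoint neighbourhoods, so local lifts at the points need no
correction. -/
theorem liftsNear_finite [T2Space X] {S : ShortComplex (Sh X)} (hS : S.ShortExact) {W : Opens X}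
    (c : Sec S.X₃ W) {K : Set X} (hK : K.Finite) (hKW : K ⊆ W) : LiftsNear S.g c K := by
  induction K, hK using Set.Finite.induction_on with
  | empty => exact ⟨⊥, bot_le, by simp, 0, Subsingleton.elim _ _⟩
  | @insert x K hx hK ih =>
    rw [Set.insert_subset_iff] at hKW
    rw [← Set.singleton_union]
    refine liftsNear_union hS ?_ (liftsNear_singleton hS c hKW.1) (ih hKW.2)
    refine mayerVietoris_of_separated _ (SeparatedNhds.of_isCompact_isCompact
      isCompact_singleton hK.isCompact ?_)
    simpa using hx

/-- Quotients of injective sheaves have the Mayer–Vietoris property for compact sets with finite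
intersection. -/
theorem mayerVietoris_of_injective [T2Space X] {S : ShortComplex (Sh X)} (hS : S.ShortExact)
    (hI : Injective S.X₂) {K₁ K₂ : Set X} (h₁ : IsCompact K₁) (h₂ : IsCompact K₂)
    (hf : (K₁ ∩ K₂).Finite) : MayerVietoris S.X₃ K₁ K₂ := by
  intro W hW a
  -- Near the finite set K₁ ∩ K₂ the section comes from the injective sheaf, where it extends to the
  -- whole space. The image of that extension serves as the section near K₁, and 0 as the section
  -- near K₂.
  obtain ⟨V, hV, hKV, b, hb⟩ := liftsNear_finite hS a hf hW
  obtain ⟨t, ht⟩ := injective_extend S.X₂ (le_top : V ≤ ⊤) b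
  -- Outside V the two compact sets are disjoint; separating them there yields neighbourhoods of K₁
  -- and K₂ that meet only inside V.
  obtain ⟨O₁, O₂, hO₁, hO₂, hK₁, hK₂, hd⟩ := SeparatedNhds.of_isCompact_isCompact
    (h₁.diff V.isOpen) (h₂.diff V.isOpen) (by
      rw [Set.disjoint_left]
      exact fun x hx hx' => hx.2 (hKV ⟨hx.1, hx'.1⟩))
  let W₁ : Opens X := ⟨O₁, hO₁⟩ ⊔ V
  let W₂ : Opens X := ⟨O₂, hO₂⟩ ⊔ V
  have hWV : W₁ ⊓ W₂ ≤ V := by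
    rintro x ⟨hx | hx, hx' | hx'⟩
    · exact absurd hx' (Set.disjoint_left.1 hd hx)
    all_goals assumption
  refine ⟨W₁, W₂, hWV.trans hV, ?_, ?_, res S.X₃ le_top (secMap S.g ⊤ t), 0, ?_⟩
  · intro x hx
    by_cases hxV : x ∈ V
    · exact Or.inr hxV
    · exact Or.inl (hK₁ ⟨hx, hxV⟩)
  · intro x hx
    by_cases hxV : x ∈ V
    · exact Or.inr hxV
    · exact Or.inl (hK₂ ⟨hx, hxV⟩)
  · rw [map_zero, sub_zero, res_res, ← res_res S.X₃ hV hWV, ← hb, ← ht, secMap_res, res_res]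

/-- The circle `ℝ / ℤ`. -/
abbrev Circ := AddCircle (1 : ℝ)

/-- The product of a space and the circle. -/
abbrev prodCirc (Z : TopCat.{0}) : TopCat.{0} := TopCat.of (Z × Circ)

/-- The projection of `Z × ℝ / ℤ` to `Z`. -/
def prodFst (Z : TopCat.{0}) : prodCirc Z ⟶ Z := TopCat.ofHom ⟨Prod.fst, continuous_fst⟩

/-- The image of `{z} × [a, b]` in `Z × ℝ / ℤ`. -/
def seg {Z : TopCat.{0}} (z : Z) (a b : ℝ) : Set (prodCirc Z) :=
  (fun y : ℝ => ((z, (y : Circ)) : Z × Circ)) '' Set.Icc a b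

/-- The Mayer–Vietoris property for consecutive segments in the fibres of `Z × ℝ / ℤ`. -/
def FiberMV {Z : TopCat.{0}} (A : Sh (prodCirc Z)) : Prop :=
  ∀ (z : Z) (b c : ℝ), 0 ≤ b → b ≤ c → c ≤ 1 → MayerVietoris A (seg z 0 b) (seg z b c)

theorem continuous_mk_circ {Z : TopCat.{0}} (z : Z) :
    Continuous (fun y : ℝ => ((z, (y : Circ)) : Z × Circ)) :=
  continuous_const.prodMk (AddCircle.continuous_mk' 1)

theorem isCompact_seg {Z : TopCat.{0}} (z : Z) (a b : ℝ) : IsCompact (seg z a b) :=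
  isCompact_Icc.image (continuous_mk_circ z)

theorem circ_eq_iff {a b : ℝ} : (a : Circ) = b ↔ ∃ n : ℤ, b = a + n := by
  refine (QuotientAddGroup.eq (s := AddSubgroup.zmultiples (1 : ℝ))).trans ?_
  rw [AddSubgroup.mem_zmultiples_iff]
  refine exists_congr fun n => ?_
  rw [zsmul_eq_mul, mul_one]
  constructor <;> intro h <;> linarith

theorem seg_inter_finite {Z : TopCat.{0}} (z : Z) {b c : ℝ} (hc : c ≤ 1) :
    (seg z 0 b ∩ seg z b c).Finite := by
  refine ((Set.finite_singleton (z, ((0 : ℝ) : Circ))).insert (z, (b : Circ))).subset ?_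
  rintro _ ⟨⟨y, hy, rfl⟩, ⟨y', hy', h⟩⟩
  have h' : (y' : Circ) = y := congrArg Prod.snd h
  obtain ⟨n, hn⟩ := circ_eq_iff.1 h'
  have h1 : (-1 : ℝ) ≤ n := by linarith [hy.1, hy'.2]
  have h2 : (n : ℝ) ≤ 0 := by linarith [hy.2, hy'.1]
  have h1' : -1 ≤ n := by exact_mod_cast h1
  have h2' : n ≤ 0 := by exact_mod_cast h2
  -- The case n = -1 is the wrap-around, where the end 1 of the second segment meets the start 0 of
  -- the first; n = 0 is the common endpoint b.
  obtain rfl | rfl : n = -1 ∨ n = 0 := by omega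
  · right
    have : y = 0 := by push_cast at hn; linarith [hy.1, hy'.2]
    simp [this]
  · left
    have : y = b := by push_cast at hn; linarith [hy.2, hy'.1]
    simp [this]

/-- This replaces the vanishing of second cohomology along the circle: consecutive segments meet in
finitely many points, so any quotient of an injective sheaf satisfies the condition. -/
theorem fiberMV_of_injective {Z : TopCat.{0}} [T2Space Z] {S : ShortComplex (Sh (prodCirc Z))}
    (hS : S.ShortExact) (hI : Injective S.X₂) : FiberMV S.X₃ := fun z _ _ _ _ hc =>
  mayerVietoris_of_injective hS hI (isCompact_seg z _ _) (isCompact_seg z _ _)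
    (seg_inter_finite z hc)

/-- A subdivision of [0, 1] fine enough for local lifts to exist on each piece allows the lift to be
prolonged one segment at a time, the correction at each junction coming from `FiberMV`. -/
theorem liftsNear_fiber {Z : TopCat.{0}} {S : ShortComplex (Sh (prodCirc Z))} (hS : S.ShortExact)
    (hA : FiberMV S.X₁) {W : Opens (prodCirc Z)} (c : Sec S.X₃ W) (z : Z)
    (hz : ∀ θ : Circ, (z, θ) ∈ W) : LiftsNear S.g c (seg z 0 1) := by
  choose V hV hxV s hs using fun y : ℝ => (epi_iff_sec S.g).1 hS.epi_g W c (z, (y : Circ)) (hz _)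
  obtain ⟨t, ht0, htm, ⟨n, hn⟩, ht⟩ := exists_monotone_Icc_subset_open_cover_unitInterval
    (c := fun y : ℝ => {x : unitInterval | ((z, ((x : ℝ) : Circ)) : Z × Circ) ∈ V y})
    (fun y => (V y).isOpen.preimage ((continuous_mk_circ z).comp continuous_subtype_val))
    (fun x _ => Set.mem_iUnion.2 ⟨x, hxV x⟩)
  have key : ∀ n, LiftsNear S.g c (seg z 0 (t n)) := by
    intro n
    induction n with
    | zero =>
      refine ⟨V 0, hV 0, ?_, s 0, hs 0⟩
      rintro _ ⟨y, hy, rfl⟩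
      rw [ht0] at hy
      have : y = 0 := le_antisymm hy.2 hy.1
      rw [this]
      exact hxV 0
    | succ n ih =>
      have h2 : LiftsNear S.g c (seg z (t n) (t (n + 1))) := by
        obtain ⟨y, hy⟩ := ht n
        refine ⟨V y, hV y, ?_, s y, hs y⟩
        rintro _ ⟨x, hx, rfl⟩
        exact hy (a := ⟨x, (t n).2.1.trans hx.1, hx.2.trans (t (n + 1)).2.2⟩) hx
      have := liftsNear_union hS (hA z _ _ (t n).2.1 (htm (Nat.le_succ n)) (t (n + 1)).2.2) ih h2
      rwa [seg, seg, ← Set.image_union,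
        Set.Icc_union_Icc_eq_Icc (t n).2.1 (htm (Nat.le_succ n))] at this
  have := key n
  rwa [hn n le_rfl] at this

theorem mem_seg_zero_one {Z : TopCat.{0}} (z : Z) (θ : Circ) :
    ((z, θ) : Z × Circ) ∈ seg z 0 1 := by
  have h : θ ∈ ((↑) : ℝ → Circ) '' Set.Icc (0 : ℝ) (0 + 1) := by
    rw [AddCircle.coe_image_Icc_eq]; trivial
  rw [zero_add] at h
  obtain ⟨y, hy, rfl⟩ := h
  exact ⟨y, hy, rfl⟩

/-- If the first term of a short exact sequence has the fibrewise Mayer–Vietoris property, its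
pushforward along `Z × ℝ / ℤ → Z` is exact. -/
theorem epi_pushforward_of_fiberMV {Z : TopCat.{0}} {S : ShortComplex (Sh (prodCirc Z))}
    (hS : S.ShortExact) (hA : FiberMV S.X₁) :
    Epi ((TopCat.Sheaf.pushforward (ModuleCat.{0} ℂ) (prodFst Z)).map S.g) := by
  rw [epi_iff_sec]
  intro U c z hz
  obtain ⟨W, hW, hzW, b, hb⟩ := liftsNear_fiber hS hA
    (W := (Opens.map (prodFst Z)).obj U) c z (fun θ => hz)
  -- The circle is compact, so a neighbourhood of a whole fibre contains the full preimage of a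
  -- neighbourhood of the base point.
  obtain ⟨u, v, hu, hv, hzu, hvu, huv⟩ := generalized_tube_lemma
    (isCompact_singleton (x := z)) (isCompact_univ (X := Circ)) W.isOpen (by
      rintro ⟨z', θ⟩ ⟨rfl, -⟩
      exact hzW (mem_seg_zero_one z' θ))
  let U' : Opens Z := ⟨u, hu⟩ ⊓ U
  have hU' : (Opens.map (prodFst Z)).obj U' ≤ W := fun x hx => huv ⟨hx.1, hvu trivial⟩
  refine ⟨U', inf_le_right, ⟨hzu rfl, hz⟩, res S.X₂ hU' b, ?_⟩
  change secMap S.g _ _ = res S.X₃ ((Opens.map (prodFst Z)).monotone inf_le_right) c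
  exact (secMap_res _ _ _).trans ((congrArg _ hb).trans (res_res S.X₃ hW hU' c))

end Lifting


/-! ### Sheaves of functions cut out by a condition on germs. -/

section FunctionSheaves

open Limits

variable {X : TopCat.{0}} {Y Y' Y'' : Type} {π : Y → X} {π' : Y' → X} {π'' : Y'' → X}

/-- A local condition on complex functions on a set `Y` over the space `X`. -/
structure FunPred (X : TopCat.{0}) {Y : Type} (π : Y → X) where
  /-- the functions that satisfy the condition at a point -/
  S : X → Submodule ℂ (Y → ℂ)
  local' : ∀ {x : X} {f f' : Y → ℂ}, (∀ᶠ x' in 𝓝 x, ∀ y, π y = x' → f y = f' y) →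
    f ∈ S x → f' ∈ S x
  open' : ∀ {x : X} {f : Y → ℂ}, f ∈ S x → ∀ᶠ x' in 𝓝 x, f ∈ S x'

namespace FunPred

open Classical in
/-- Extension by zero of the restriction of a function to the part over `W`. -/
def cut (π : Y → X) (W : Opens X) : (Y → ℂ) →ₗ[ℂ] (Y → ℂ) where
  toFun f y := if π y ∈ W then f y else 0
  map_add' f g := by ext y; by_cases h : π y ∈ W <;> simp [h]
  map_smul' c f := by ext y; by_cases h : π y ∈ W <;> simp [h]

theorem cut_of_mem {W : Opens X} {y : Y} (h : π y ∈ W) (f : Y → ℂ) : cut π W f y = f y := if_pos h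

theorem cut_of_notMem {W : Opens X} {y : Y} (h : π y ∉ W) (f : Y → ℂ) : cut π W f y = 0 := if_neg h

theorem cut_mem (P : FunPred X π) {W : Opens X} {x : X} (hx : x ∈ W) {f : Y → ℂ} (hf : f ∈ P.S x) :
    cut π W f ∈ P.S x := by
  refine P.local' ?_ hf
  filter_upwards [W.isOpen.mem_nhds hx] with x' hx' y hy
  rw [cut_of_mem (by rw [hy]; exact hx')]

/-- The functions over `W` that satisfy the condition, extended by zero. -/
def sections (P : FunPred X π) (W : Opens X) : Submodule ℂ (Y → ℂ) where
  carrier := {f | (∀ y, π y ∉ W → f y = 0) ∧ ∀ x ∈ W, f ∈ P.S x}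
  add_mem' := fun ha hb => ⟨fun y hy => by simp [ha.1 y hy, hb.1 y hy],
    fun x hx => add_mem (ha.2 x hx) (hb.2 x hx)⟩
  zero_mem' := ⟨fun _ _ => rfl, fun _ _ => zero_mem _⟩
  smul_mem' := fun c _ ha => ⟨fun y hy => by simp [ha.1 y hy],
    fun x hx => Submodule.smul_mem _ c (ha.2 x hx)⟩

theorem cut_eq_self (P : FunPred X π) {W : Opens X} {f : Y → ℂ} (hf : f ∈ P.sections W) :
    cut π W f = f := by
  ext y
  by_cases h : π y ∈ W
  · exact cut_of_mem h f
  · rw [cut_of_notMem h, hf.1 y h]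

theorem cut_mem_sections (P : FunPred X π) {W : Opens X} {f : Y → ℂ} (hf : ∀ x ∈ W, f ∈ P.S x) :
    cut π W f ∈ P.sections W :=
  ⟨fun _ hy => cut_of_notMem hy f, fun x hx => P.cut_mem hx (hf x hx)⟩

/-- Restriction of sections. -/
def restrict (P : FunPred X π) {W W' : Opens X} (h : W' ≤ W) :
    P.sections W →ₗ[ℂ] P.sections W' :=
  ((cut π W').comp (P.sections W).subtype).codRestrict _
    fun f => P.cut_mem_sections fun x hx => f.2.2 x (h hx)

/-- The presheaf of functions that satisfy a local condition. -/
def presheaf (P : FunPred X π) : TopCat.Presheaf (ModuleCat.{0} ℂ) X where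
  obj W := ModuleCat.of ℂ (P.sections W.unop)
  map f := ModuleCat.ofHom (P.restrict f.unop.le)
  map_id W := by
    ext1
    refine LinearMap.ext fun f => Subtype.ext ?_
    exact P.cut_eq_self f.2
  map_comp {W W' W''} a b := by
    ext1
    refine LinearMap.ext fun f => Subtype.ext (funext fun y => ?_)
    change cut π W''.unop f.1 y = cut π W''.unop (cut π W'.unop f.1) y
    by_cases h : π y ∈ W''.unop
    · rw [cut_of_mem h, cut_of_mem h, cut_of_mem (b.unop.le h)]
    · rw [cut_of_notMem h, cut_of_notMem h]

open Classical in
theorem presheaf_isSheaf (P : FunPred X π) : P.presheaf.IsSheaf := by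
  rw [TopCat.Presheaf.isSheaf_iff_isSheaf_comp (CategoryTheory.forget (ModuleCat.{0} ℂ))]
  apply TopCat.Presheaf.isSheaf_of_isSheafUniqueGluing_types
  intro ι U sf hsf
  let sf' : ∀ i, P.sections (U i) := sf
  have compat : ∀ (i j : ι) (y : Y) (hi : π y ∈ U i) (hj : π y ∈ U j),
      (sf' i).1 y = (sf' j).1 y := by
    intro i j y hi hj
    have h' : P.restrict (inf_le_left : U i ⊓ U j ≤ U i) (sf' i) =
        P.restrict (inf_le_right : U i ⊓ U j ≤ U j) (sf' j) := hsf i j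
    have := congrFun (congrArg Subtype.val h') y
    change cut π _ (sf' i).1 y = cut π _ (sf' j).1 y at this
    have hij : π y ∈ U i ⊓ U j := ⟨hi, hj⟩
    rwa [cut_of_mem hij, cut_of_mem hij] at this
  let s : Y → ℂ := fun y => if h : ∃ i, π y ∈ U i then (sf' h.choose).1 y else 0
  have hs : ∀ i y, π y ∈ U i → s y = (sf' i).1 y := by
    intro i y hy
    have h : ∃ i, π y ∈ U i := ⟨i, hy⟩
    rw [show s y = (sf' h.choose).1 y from dif_pos h]
    exact compat _ _ y h.choose_spec hy
  have hmem : s ∈ P.sections (iSup U) := by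
    refine ⟨fun y hy => dif_neg fun h => hy (Opens.mem_iSup.2 h), fun x hx => ?_⟩
    obtain ⟨i, hi⟩ := Opens.mem_iSup.1 hx
    refine P.local' ?_ ((sf' i).2.2 x hi)
    filter_upwards [(U i).isOpen.mem_nhds hi] with x' hx' y hy
    rw [hs i y (by rw [hy]; exact hx')]
  refine ⟨(⟨s, hmem⟩ : P.sections (iSup U)), fun i => ?_, fun t ht => ?_⟩
  · refine Subtype.ext (funext fun y => ?_)
    change cut π (U i) s y = (sf' i).1 y
    by_cases h : π y ∈ U i
    · rw [cut_of_mem h, hs i y h]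
    · rw [cut_of_notMem h, (sf' i).2.1 y h]
  · refine Subtype.ext (funext fun y => ?_)
    have ht' : ∀ i, P.restrict (le_iSup U i) (t : P.sections (iSup U)) = sf' i := ht
    change (t : P.sections (iSup U)).1 y = s y
    by_cases h : π y ∈ iSup U
    · obtain ⟨i, hi⟩ := Opens.mem_iSup.1 h
      rw [hs i y hi, ← ht' i]
      exact (cut_of_mem hi _).symm
    · rw [(t : P.sections (iSup U)).2.1 y h, hmem.1 y h]

/-- The sheaf of functions that satisfy a local condition. -/
def sheaf (P : FunPred X π) : Sh X := ⟨P.presheaf, P.presheaf_isSheaf⟩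

/-- The section given by a function. -/
def sec (P : FunPred X π) (W : Opens X) (f : Y → ℂ) (hf : ∀ x ∈ W, f ∈ P.S x) : Sec P.sheaf W :=
  (⟨cut π W f, P.cut_mem_sections hf⟩ : P.sections W)

/-- The function underlying a section. -/
def val (P : FunPred X π) {W : Opens X} (s : Sec P.sheaf W) : Y → ℂ := (s : P.sections W).1

theorem val_mem (P : FunPred X π) {W : Opens X} (s : Sec P.sheaf W) {x : X} (hx : x ∈ W) :
    P.val s ∈ P.S x := (s : P.sections W).2.2 x hx

theorem val_eq_zero (P : FunPred X π) {W : Opens X} (s : Sec P.sheaf W) {y : Y} (hy : π y ∉ W) :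
    P.val s y = 0 := (s : P.sections W).2.1 y hy

theorem sec_ext (P : FunPred X π) {W : Opens X} {s t : Sec P.sheaf W}
    (h : ∀ y, π y ∈ W → P.val s y = P.val t y) : s = t := by
  refine Subtype.ext (funext fun y => ?_)
  by_cases hy : π y ∈ W
  · exact h y hy
  · exact (P.val_eq_zero s hy).trans (P.val_eq_zero t hy).symm

theorem val_sec (P : FunPred X π) {W : Opens X} {f : Y → ℂ} {hf : ∀ x ∈ W, f ∈ P.S x} {y : Y}
    (hy : π y ∈ W) : P.val (P.sec W f hf) y = f y := cut_of_mem hy f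

theorem val_res (P : FunPred X π) {W W' : Opens X} (h : W' ≤ W) (s : Sec P.sheaf W) {y : Y}
    (hy : π y ∈ W') : P.val (res P.sheaf h s) y = P.val s y := cut_of_mem hy _

theorem val_sub (P : FunPred X π) {W : Opens X} (s t : Sec P.sheaf W) (y : Y) :
    P.val (s - t) y = P.val s y - P.val t y := rfl

/-- A linear map between spaces of functions over `X` that is local over `X`. -/
def IsFiberwise (π : Y → X) (π' : Y' → X) (Φ : (Y → ℂ) →ₗ[ℂ] (Y' → ℂ)) : Prop :=
  ∀ (f : Y → ℂ) (x : X), (∀ y, π y = x → f y = 0) → ∀ y', π' y' = x → Φ f y' = 0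

theorem IsFiberwise.congr {Φ : (Y → ℂ) →ₗ[ℂ] (Y' → ℂ)} (h : IsFiberwise π π' Φ) {f g : Y → ℂ}
    {x : X} (hfg : ∀ y, π y = x → f y = g y) {y' : Y'} (hy' : π' y' = x) : Φ f y' = Φ g y' := by
  have := h (f - g) x (fun y hy => by simp [hfg y hy]) y' hy'
  rw [map_sub] at this
  exact sub_eq_zero.1 this

theorem IsFiberwise.cut {Φ : (Y → ℂ) →ₗ[ℂ] (Y' → ℂ)} (h : IsFiberwise π π' Φ) (W : Opens X)
    (f : Y → ℂ) : Φ (cut π W f) = FunPred.cut π' W (Φ f) := by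
  ext y'
  by_cases hy' : π' y' ∈ W
  · rw [cut_of_mem hy']
    exact h.congr (fun y hy => cut_of_mem (by rw [hy]; exact hy') f) rfl
  · rw [cut_of_notMem hy']
    exact h _ _ (fun y hy => cut_of_notMem (by rw [hy]; exact hy') f) _ rfl

/-- The morphism of sheaves given by a fibrewise linear map. -/
def hom (P : FunPred X π) (P' : FunPred X π') (Φ : (Y → ℂ) →ₗ[ℂ] (Y' → ℂ))
    (hΦ : IsFiberwise π π' Φ) (h : ∀ x f, f ∈ P.S x → Φ f ∈ P'.S x) : P.sheaf ⟶ P'.sheaf :=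
  ⟨{ app W := ModuleCat.ofHom ((Φ.comp (P.sections W.unop).subtype).codRestrict
      (P'.sections W.unop) fun f => ⟨fun y' hy' => hΦ _ _
        (fun y hy => f.2.1 y (by rw [hy]; exact hy')) y' rfl, fun x hx => h x _ (f.2.2 x hx)⟩)
     naturality W W' a := by
      ext f
      exact Subtype.ext (hΦ.cut _ _) }⟩

variable {P : FunPred X π} {P' : FunPred X π'} {P'' : FunPred X π''}
  {Φ : (Y → ℂ) →ₗ[ℂ] (Y' → ℂ)} {hΦ : IsFiberwise π π' Φ} {h : ∀ x f, f ∈ P.S x → Φ f ∈ P'.S x}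
  {Ψ : (Y' → ℂ) →ₗ[ℂ] (Y'' → ℂ)} {hΨ : IsFiberwise π' π'' Ψ}
  {h' : ∀ x f, f ∈ P'.S x → Ψ f ∈ P''.S x}

theorem val_secMap_hom {W : Opens X} (s : Sec P.sheaf W) :
    P'.val (secMap (hom P P' Φ hΦ h) W s) = Φ (P.val s) := rfl

theorem val_secMap_hom_sec {W : Opens X} {f : Y → ℂ} {hf : ∀ x ∈ W, f ∈ P.S x} {y' : Y'}
    (hy' : π' y' ∈ W) : P'.val (secMap (hom P P' Φ hΦ h) W (P.sec W f hf)) y' = Φ f y' :=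
  (congrFun (hΦ.cut W f) y').trans (cut_of_mem hy' _)

theorem hom_comp_hom_eq_zero (hz : ∀ f, Ψ (Φ f) = 0) :
    hom P P' Φ hΦ h ≫ hom P' P'' Ψ hΨ h' = 0 :=
  hom_ext_sec fun _ _ => Subtype.ext (hz _)

theorem exists_opens {p : X → Prop} {x : X} (hp : ∀ᶠ x' in 𝓝 x, p x') {U : Opens X} (hx : x ∈ U) :
    ∃ V : Opens X, V ≤ U ∧ x ∈ V ∧ ∀ x' ∈ V, p x' := by
  obtain ⟨t, ht, ht', hxt⟩ := eventually_nhds_iff.1 hp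
  exact ⟨⟨t, ht'⟩ ⊓ U, inf_le_right, ⟨hxt, hx⟩, fun x' hx' => ht x' hx'.1⟩

/-- A sequence of sheaves of functions is short exact if it is so on germs. -/
theorem shortExact (hz : ∀ f, Ψ (Φ f) = 0)
    (hm : ∀ x f, f ∈ P.S x → (∀ᶠ x' in 𝓝 x, ∀ y', π' y' = x' → Φ f y' = 0) →
      ∀ y, π y = x → f y = 0)
    (he : ∀ x f, f ∈ P'.S x → (∀ᶠ x' in 𝓝 x, ∀ y'', π'' y'' = x' → Ψ f y'' = 0) →
      ∃ g ∈ P.S x, ∀ᶠ x' in 𝓝 x, ∀ y', π' y' = x' → Φ g y' = f y')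
    (hs : ∀ x f, f ∈ P''.S x →
      ∃ g ∈ P'.S x, ∀ᶠ x' in 𝓝 x, ∀ y'', π'' y'' = x' → Ψ g y'' = f y'') :
    (ShortComplex.mk (hom P P' Φ hΦ h) (hom P' P'' Ψ hΨ h')
      (hom_comp_hom_eq_zero hz)).ShortExact where
  mono_f := by
    refine mono_of_secMap_injective _ fun U => (injective_iff_map_eq_zero _).2 fun s hs => ?_
    refine P.sec_ext fun y hy => hm (π y) _ (P.val_mem s hy) ?_ y rfl
    refine Filter.Eventually.of_forall fun x' y' _ => ?_
    rw [← val_secMap_hom (P' := P') (hΦ := hΦ) (h := h), hs]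
    rfl
  exact := by
    refine exact_of_sec _ fun U b hb x hx => ?_
    obtain ⟨g, hg, hgb⟩ := he x (P'.val b) (P'.val_mem b hx)
      (Filter.Eventually.of_forall fun x' y'' _ => congrFun (congrArg P''.val hb) y'')
    obtain ⟨V, hVU, hxV, hV⟩ := exists_opens ((P.open' hg).and hgb) hx
    refine ⟨V, hVU, hxV, P.sec V g fun x' hx' => (hV x' hx').1, P'.sec_ext fun y' hy' => ?_⟩
    refine Eq.trans ?_ ((hV _ hy').2 y' rfl) |>.trans (P'.val_res hVU b hy').symm
    exact val_secMap_hom_sec (hΦ := hΦ) (h := h) hy'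
  epi_g := by
    refine (epi_iff_sec _).2 fun U t x hx => ?_
    obtain ⟨g, hg, hgb⟩ := hs x (P''.val t) (P''.val_mem t hx)
    obtain ⟨V, hVU, hxV, hV⟩ := exists_opens ((P'.open' hg).and hgb) hx
    refine ⟨V, hVU, hxV, P'.sec V g fun x' hx' => (hV x' hx').1, P''.sec_ext fun y' hy' => ?_⟩
    refine Eq.trans ?_ ((hV _ hy').2 y' rfl) |>.trans (P''.val_res hVU t hy').symm
    exact val_secMap_hom_sec (hΦ := hΨ) (h := h') hy'

/-- The decomposition can be given by plain functions satisfying the condition at the points of the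
compact sets: openness of the condition spreads it to neighbourhoods, and separating K₁ and K₂ away
from their intersection keeps the overlap inside the region where the identity holds. -/
theorem mayerVietoris [T2Space X] (P : FunPred X π) {K₁ K₂ : Set X} (h₁ : IsCompact K₁)
    (h₂ : IsCompact K₂)
    (H : ∀ a : Y → ℂ, (∀ x ∈ K₁ ∩ K₂, a ∈ P.S x) → ∃ a₁ a₂ : Y → ℂ, (∀ x ∈ K₁, a₁ ∈ P.S x) ∧
      (∀ x ∈ K₂, a₂ ∈ P.S x) ∧
      ∀ x ∈ K₁ ∩ K₂, ∀ᶠ x' in 𝓝 x, ∀ y, π y = x' → a₁ y - a₂ y = a y) :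
    MayerVietoris P.sheaf K₁ K₂ := by
  intro W hW a
  obtain ⟨a₁, a₂, ha₁, ha₂, haa⟩ := H (P.val a) fun x hx => P.val_mem a (hW hx)
  choose! V hVW hxV hV using fun x (hx : x ∈ K₁ ∩ K₂) => exists_opens (haa x hx) (hW hx)
  choose! D₁ _ hxD₁ hD₁ using fun x (hx : x ∈ K₁) =>
    exists_opens (P.open' (ha₁ x hx)) (Opens.mem_top x)
  choose! D₂ _ hxD₂ hD₂ using fun x (hx : x ∈ K₂) =>
    exists_opens (P.open' (ha₂ x hx)) (Opens.mem_top x)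
  let V' : Opens X := ⨆ x : (K₁ ∩ K₂ : Set X), V x
  have hV'W : V' ≤ W := iSup_le fun x => hVW x x.2
  have hKV : K₁ ∩ K₂ ⊆ V' := fun x hx => Opens.mem_iSup.2 ⟨⟨x, hx⟩, hxV x hx⟩
  obtain ⟨O₁, O₂, hO₁, hO₂, hK₁, hK₂, hd⟩ := SeparatedNhds.of_isCompact_isCompact
    (h₁.diff V'.isOpen) (h₂.diff V'.isOpen) (by
      rw [Set.disjoint_left]
      exact fun x hx hx' => hx.2 (hKV ⟨hx.1, hx'.1⟩))
  let W₁ : Opens X := (⟨O₁, hO₁⟩ ⊔ V') ⊓ ⨆ x : K₁, D₁ x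
  let W₂ : Opens X := (⟨O₂, hO₂⟩ ⊔ V') ⊓ ⨆ x : K₂, D₂ x
  have hWV : W₁ ⊓ W₂ ≤ V' := by
    rintro x ⟨⟨hx | hx, -⟩, ⟨hx' | hx', -⟩⟩
    · exact absurd hx' (Set.disjoint_left.1 hd hx)
    all_goals assumption
  refine ⟨W₁, W₂, hWV.trans hV'W, ?_, ?_, P.sec W₁ a₁ ?_, P.sec W₂ a₂ ?_, ?_⟩
  · intro x hx
    refine ⟨?_, Opens.mem_iSup.2 ⟨⟨x, hx⟩, hxD₁ x hx⟩⟩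
    by_cases hxV : x ∈ V'
    · exact Or.inr hxV
    · exact Or.inl (hK₁ ⟨hx, hxV⟩)
  · intro x hx
    refine ⟨?_, Opens.mem_iSup.2 ⟨⟨x, hx⟩, hxD₂ x hx⟩⟩
    by_cases hxV : x ∈ V'
    · exact Or.inr hxV
    · exact Or.inl (hK₂ ⟨hx, hxV⟩)
  · rintro x ⟨-, hx⟩
    obtain ⟨i, hi⟩ := Opens.mem_iSup.1 hx
    exact hD₁ i i.2 x hi
  · rintro x ⟨-, hx⟩
    obtain ⟨i, hi⟩ := Opens.mem_iSup.1 hx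
    exact hD₂ i i.2 x hi
  · refine P.sec_ext fun y hy => ?_
    rw [P.val_sub, P.val_res _ _ hy, P.val_res _ _ hy, P.val_res _ _ hy, P.val_sec hy.1,
      P.val_sec hy.2]
    obtain ⟨i, hi⟩ := Opens.mem_iSup.1 (hWV hy)
    exact hV i i.2 _ hi y rfl

end FunPred

end FunctionSheaves


/-! ### Twisting a sheaf on Z by a monodromy along a circle. -/

section Twist

variable {Z : TopCat.{0}}

/-- The covering `Z × ℝ → Z × ℝ / ℤ`. -/
def covCirc (Z : TopCat.{0}) (p : Z × ℝ) : prodCirc Z := (p.1, (p.2 : Circ))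

theorem continuous_covCirc : Continuous (covCirc Z) :=
  continuous_fst.prodMk ((AddCircle.continuous_mk' 1).comp continuous_snd)

theorem isOpenMap_covCirc : IsOpenMap (covCirc Z) :=
  IsOpenMap.id.prodMap (QuotientAddGroup.isOpenMap_coe (N := AddSubgroup.zmultiples (1 : ℝ)))

theorem eventually_covCirc {p : Z × ℝ} {R : prodCirc Z → Prop} :
    (∀ᶠ q in 𝓝 (covCirc Z p), R q) ↔ ∀ᶠ p' in 𝓝 p, R (covCirc Z p') :=
  ⟨fun h => (continuous_covCirc.tendsto p).eventually h,
    fun h => isOpenMap_covCirc.nhds_le p h⟩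

theorem exists_covCirc (q : prodCirc Z) : ∃ p, covCirc Z p = q := by
  obtain ⟨z, θ⟩ := q
  obtain ⟨y, rfl⟩ := QuotientAddGroup.mk_surjective θ
  exact ⟨(z, y), rfl⟩

/-- The functions `f` near `(z, y)` for which `e ^ ⌊y⌋ * f` is pulled back from a function on `Z`
satisfying `N`. -/
def TwistAt (N : FunPred Z (id : Z → Z)) (e : Z → ℂ) (f : prodCirc Z → ℂ) (p : Z × ℝ) : Prop :=
  ∃ h ∈ N.S p.1, ∀ᶠ p' in 𝓝 p, e p'.1 ^ ⌊p'.2⌋ * f (covCirc Z p') = h p'.1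

theorem FunPred.congr (N : FunPred Z (id : Z → Z)) {z : Z} {f g : Z → ℂ}
    (h : ∀ᶠ z' in 𝓝 z, f z' = g z') (hf : f ∈ N.S z) : g ∈ N.S z :=
  N.local' (h.mono fun _ h' _ hy => by subst hy; exact h') hf

/-- The function `e` is invertible and multiplication by `e` and `e⁻¹` preserves `N`. -/
structure IsMultiplier (N : FunPred Z (id : Z → Z)) (e : Z → ℂ) : Prop where
  ne_zero : ∀ z, e z ≠ 0
  mul_mem : ∀ {z f}, f ∈ N.S z → (fun z => e z * f z) ∈ N.S z
  inv_mul_mem : ∀ {z f}, f ∈ N.S z → (fun z => (e z)⁻¹ * f z) ∈ N.S z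

theorem IsMultiplier.zpow_mul_mem {N : FunPred Z (id : Z → Z)} {e : Z → ℂ} (he : IsMultiplier N e)
    (n : ℤ) {z : Z} {f : Z → ℂ} (hf : f ∈ N.S z) : (fun z => e z ^ n * f z) ∈ N.S z := by
  induction n with
  | zero => simpa using hf
  | succ n ih =>
    convert he.mul_mem ih using 2 with w
    rw [zpow_add_one₀ (he.ne_zero w)]
    ring
  | pred n ih =>
    convert he.inv_mul_mem ih using 2 with w
    rw [zpow_sub_one₀ (he.ne_zero w)]
    ring

theorem covCirc_add_int (p : Z × ℝ) (n : ℤ) : covCirc Z (p.1, p.2 + n) = covCirc Z p := by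
  refine Prod.ext rfl ?_
  exact (circ_eq_iff.2 ⟨n, rfl⟩).symm

/-- Translating y by n multiplies e^⌊y⌋ by eⁿ, and `N` is stable under powers of e. The condition
therefore depends only on the point of the circle. -/
theorem twistAt_add_int {N : FunPred Z (id : Z → Z)} {e : Z → ℂ} (he : IsMultiplier N e)
    {f : prodCirc Z → ℂ} {p : Z × ℝ} (hf : TwistAt N e f p) (n : ℤ) :
    TwistAt N e f (p.1, p.2 + n) := by
  obtain ⟨h, hh, hf⟩ := hf
  refine ⟨fun z => e z ^ n * h z, he.zpow_mul_mem n hh, ?_⟩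
  have hc : Continuous fun p : Z × ℝ => ((p.1, p.2 + (-n : ℤ)) : Z × ℝ) := by fun_prop
  have ht := hc.tendsto ((p.1, p.2 + n) : Z × ℝ)
  rw [show ((p.1, p.2 + n + (-n : ℤ)) : Z × ℝ) = p by simp] at ht
  filter_upwards [ht.eventually hf] with p' hp'
  rw [covCirc_add_int, Int.floor_add_intCast] at hp'
  rw [← hp', ← mul_assoc, ← zpow_add₀ (he.ne_zero _)]
  congr 2
  ring

theorem twistAt_of_covCirc_eq {N : FunPred Z (id : Z → Z)} {e : Z → ℂ} (he : IsMultiplier N e)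
    {f : prodCirc Z → ℂ} {p p' : Z × ℝ} (hf : TwistAt N e f p) (h : covCirc Z p = covCirc Z p') :
    TwistAt N e f p' := by
  obtain ⟨z, y⟩ := p
  obtain ⟨z', y'⟩ := p'
  obtain rfl : z = z' := congrArg Prod.fst h
  obtain ⟨n, rfl⟩ := circ_eq_iff.1 (congrArg Prod.snd h)
  exact twistAt_add_int he hf n

theorem eventually_twistAt {N : FunPred Z (id : Z → Z)} {e : Z → ℂ} {f : prodCirc Z → ℂ}
    {p : Z × ℝ} (hf : TwistAt N e f p) : ∀ᶠ p' in 𝓝 p, TwistAt N e f p' := by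
  obtain ⟨h, hh, hf⟩ := hf
  filter_upwards [hf.eventually_nhds, (continuous_fst.tendsto p).eventually (N.open' hh)]
    with p' h1 h2
  exact ⟨h, h2, h1⟩

/-- The local condition on `Z × ℝ / ℤ` obtained from `N` by twisting with the multiplier `e`. -/
def twist (N : FunPred Z (id : Z → Z)) {e : Z → ℂ} (he : IsMultiplier N e) :
    FunPred (prodCirc Z) (id : prodCirc Z → prodCirc Z) where
  S q :=
    { carrier := {f | ∀ p, covCirc Z p = q → TwistAt N e f p}
      add_mem' := by
        intro f g hf hg p hp
        obtain ⟨h, hh, hf⟩ := hf p hp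
        obtain ⟨h', hh', hg⟩ := hg p hp
        refine ⟨h + h', add_mem hh hh', ?_⟩
        filter_upwards [hf, hg] with p' h1 h2
        simp [mul_add, h1, h2]
      zero_mem' := fun p _ => ⟨0, zero_mem _, by simp⟩
      smul_mem' := by
        intro c f hf p hp
        obtain ⟨h, hh, hf⟩ := hf p hp
        refine ⟨c • h, Submodule.smul_mem _ c hh, ?_⟩
        filter_upwards [hf] with p' h1
        simp only [Pi.smul_apply, smul_eq_mul, ← h1]
        ring }
  local' := by
    rintro q f f' hff hf p rfl
    obtain ⟨h, hh, hf⟩ := hf p rfl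
    refine ⟨h, hh, ?_⟩
    filter_upwards [hf, eventually_covCirc.1 hff] with p' h1 h2
    rw [← h1, show f (covCirc Z p') = f' (covCirc Z p') from h2 _ rfl]
  open' := by
    intro q f hf
    obtain ⟨p, rfl⟩ := exists_covCirc q
    rw [eventually_covCirc]
    filter_upwards [eventually_twistAt (hf p rfl)] with p' h' p'' hp
    exact twistAt_of_covCirc_eq he h' hp.symm

theorem mem_twist {N : FunPred Z (id : Z → Z)} {e : Z → ℂ} (he : IsMultiplier N e)
    {f : prodCirc Z → ℂ} {p : Z × ℝ} :
    f ∈ (twist N he).S (covCirc Z p) ↔ TwistAt N e f p :=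
  ⟨fun h => h p rfl, fun h _ hp => twistAt_of_covCirc_eq he h hp.symm⟩

/-- Every germ of `N` occurs: twisted sections are locally the same as sections of `N`. -/
theorem exists_mem_twist {N : FunPred Z (id : Z → Z)} {e : Z → ℂ} (he : IsMultiplier N e)
    {h : Z → ℂ} {p : Z × ℝ} (hh : h ∈ N.S p.1) : ∃ f ∈ (twist N he).S (covCirc Z p),
      ∀ᶠ p' in 𝓝 p, e p'.1 ^ ⌊p'.2⌋ * f (covCirc Z p') = h p'.1 := by
  -- Representatives are taken in the unit interval centred at `p.2`, so that the chosen branch is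
  -- the identity near `p`, even when `p.2` is an integer and ⌊y⌋ jumps there.
  let ρ : Circ → ℝ := fun θ => AddCircle.equivIco 1 (p.2 - 1 / 2) θ
  let f : prodCirc Z → ℂ := fun q => (e q.1 ^ ⌊ρ q.2⌋)⁻¹ * h q.1
  have hf : ∀ᶠ p' in 𝓝 p, e p'.1 ^ ⌊p'.2⌋ * f (covCirc Z p') = h p'.1 := by
    have : ∀ᶠ y in 𝓝 p.2, y ∈ Set.Ico (p.2 - 1 / 2) (p.2 - 1 / 2 + 1) :=
      Ico_mem_nhds (by linarith) (by linarith)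
    filter_upwards [(continuous_snd.tendsto p).eventually this] with p' hp'
    have h1 : ρ (p'.2 : Circ) = p'.2 := by
      simp only [ρ]
      rw [AddCircle.equivIco_coe_eq hp']
    simp only [f, covCirc, h1]
    rw [mul_inv_cancel_left₀ (zpow_ne_zero _ (he.ne_zero _))]
  exact ⟨f, (mem_twist he).2 ⟨h, hh, hf⟩, hf⟩

/-- Multiplication by `a` on `N` is injective, with cokernel `M` via multiplication by `σ`. -/
structure IsTriple (N M : FunPred Z (id : Z → Z)) (a σ : Z → ℂ) : Prop where
  mul_mem : ∀ {z f}, f ∈ N.S z → (fun z => a z * f z) ∈ N.S z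
  res_mem : ∀ {z f}, f ∈ N.S z → (fun z => σ z * f z) ∈ M.S z
  res_mul : ∀ z, σ z * a z = 0
  inj : ∀ {z f}, f ∈ N.S z → (∀ᶠ z' in 𝓝 z, a z' * f z' = 0) → f z = 0
  exact : ∀ {z f}, f ∈ N.S z → (∀ᶠ z' in 𝓝 z, σ z' * f z' = 0) →
    ∃ g ∈ N.S z, ∀ᶠ z' in 𝓝 z, a z' * g z' = f z'
  surj : ∀ {z f}, f ∈ M.S z → ∃ g ∈ N.S z, ∀ᶠ z' in 𝓝 z, σ z' * g z' = f z'

theorem mul_fst_mem_twist {N M : FunPred Z (id : Z → Z)} {e : Z → ℂ} {he : IsMultiplier N e}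
    {he' : IsMultiplier M e} {a : Z → ℂ}
    (ha : ∀ {z f}, f ∈ N.S z → (fun z => a z * f z) ∈ M.S z) {q : prodCirc Z}
    {f : prodCirc Z → ℂ} (hf : f ∈ (twist N he).S q) :
    (fun q => a q.1 * f q) ∈ (twist M he').S q := by
  intro p hp
  obtain ⟨h, hh, hf⟩ := hf p hp
  refine ⟨_, ha hh, ?_⟩
  filter_upwards [hf] with p' hp'
  simp only [← hp', covCirc]
  ring

theorem IsMultiplier.twist {N : FunPred Z (id : Z → Z)} {e : Z → ℂ} (he : IsMultiplier N e)
    {e' : Z → ℂ} (he' : IsMultiplier N e') :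
    IsMultiplier (twist N he) (fun q : prodCirc Z => e' q.1) where
  ne_zero q := he'.ne_zero q.1
  mul_mem hf := mul_fst_mem_twist he'.mul_mem hf
  inv_mul_mem hf := mul_fst_mem_twist (a := fun z => (e' z)⁻¹) he'.inv_mul_mem hf

theorem eventually_of_eventually_covCirc {p : Z × ℝ} {R : Z → Prop}
    (h : ∀ᶠ p' in 𝓝 p, R p'.1) : ∀ᶠ z in 𝓝 p.1, R z := by
  have hc : Continuous fun z : Z => ((z, p.2) : Z × ℝ) := by fun_prop
  exact (hc.tendsto p.1).eventually h

/-- All conditions of `IsTriple` are local, and locally a twisted section is a pulled-back section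
of `N` up to the invertible factor e^⌊y⌋, which commutes with multiplication by a and σ. -/
theorem IsTriple.twist {N M : FunPred Z (id : Z → Z)} {a σ : Z → ℂ} (h : IsTriple N M a σ)
    {e : Z → ℂ} (he : IsMultiplier N e) (he' : IsMultiplier M e) :
    IsTriple (PoincareTorus.twist N he) (PoincareTorus.twist M he')
      (fun q : prodCirc Z => a q.1) (fun q => σ q.1) where
  mul_mem hf := mul_fst_mem_twist h.mul_mem hf
  res_mem hf := mul_fst_mem_twist h.res_mem hf
  res_mul q := h.res_mul q.1
  inj := by
    intro q f hf h0
    obtain ⟨p, rfl⟩ := exists_covCirc q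
    obtain ⟨k, hk, hf⟩ := hf p rfl
    have h1 : k p.1 = 0 := by
      refine h.inj hk (eventually_of_eventually_covCirc ?_)
      filter_upwards [hf, eventually_covCirc.1 h0] with p' h1 h2
      rw [← h1, mul_left_comm, show a p'.1 * f (covCirc Z p') = 0 from h2, mul_zero]
    have h2 := hf.self_of_nhds
    rw [h1] at h2
    exact (mul_eq_zero.1 h2).resolve_left (zpow_ne_zero _ (he.ne_zero _))
  exact := by
    intro q f hf h0
    obtain ⟨p, rfl⟩ := exists_covCirc q
    obtain ⟨k, hk, hf⟩ := hf p rfl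
    obtain ⟨g, hg, hgk⟩ := h.exact hk (eventually_of_eventually_covCirc (p := p) (by
      filter_upwards [hf, eventually_covCirc.1 h0] with p' h1 h2
      rw [← h1, mul_left_comm, show σ p'.1 * f (covCirc Z p') = 0 from h2, mul_zero]))
    obtain ⟨g', hg', hgg⟩ := exists_mem_twist he hg
    refine ⟨g', hg', ?_⟩
    rw [eventually_covCirc]
    filter_upwards [hgg, hf, (continuous_fst.tendsto p).eventually hgk] with p' h1 h2 h3
    apply mul_left_cancel₀ (zpow_ne_zero ⌊p'.2⌋ (he.ne_zero p'.1))
    rw [h2, ← h3, ← h1, mul_left_comm]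
    rfl
  surj := by
    intro q f hf
    obtain ⟨p, rfl⟩ := exists_covCirc q
    obtain ⟨k, hk, hf⟩ := hf p rfl
    obtain ⟨g, hg, hgk⟩ := h.surj hk
    obtain ⟨g', hg', hgg⟩ := exists_mem_twist he hg
    refine ⟨g', hg', ?_⟩
    rw [eventually_covCirc]
    filter_upwards [hgg, hf, (continuous_fst.tendsto p).eventually hgk] with p' h1 h2 h3
    apply mul_left_cancel₀ (zpow_ne_zero ⌊p'.2⌋ (he.ne_zero p'.1))
    rw [h2, ← h3, ← h1, mul_left_comm]
    rfl

end Twist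


/-! ### Cutting the circle open: the resolution of a twist by functions on Z × [0, 1]. -/

section PathSheaf

open scoped unitInterval

variable {Z : TopCat.{0}}

/-- The map `Z × [0, 1] → Z × ℝ / ℤ`. -/
def pathCov (Z : TopCat.{0}) (q : Z × I) : prodCirc Z := covCirc Z (q.1, q.2)

theorem isClosedMap_pathCov : IsClosedMap (pathCov Z) := by
  have h : Continuous fun y : I => ((y : ℝ) : Circ) :=
    (AddCircle.continuous_mk' 1).comp continuous_subtype_val
  exact (isProperMap_id.prodMap h.isProperMap).isClosedMap

/-- The functions on `Z × [0, 1]` that near `q` are pulled back from a function satisfying `N`. -/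
def PathAt (N : FunPred Z (id : Z → Z)) (f : Z × I → ℂ) (q : Z × I) : Prop :=
  ∃ h ∈ N.S q.1, ∀ᶠ q' in 𝓝 q, f q' = h q'.1

theorem eventually_pathAt {N : FunPred Z (id : Z → Z)} {f : Z × I → ℂ} {q : Z × I}
    (hf : PathAt N f q) : ∀ᶠ q' in 𝓝 q, PathAt N f q' := by
  obtain ⟨h, hh, hf⟩ := hf
  filter_upwards [hf.eventually_nhds, (continuous_fst.tendsto q).eventually (N.open' hh)]
    with p' h1 h2
  exact ⟨h, h2, h1⟩

theorem eventually_pathCov {q : Z × I} {R : prodCirc Z → Prop}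
    (h : ∀ᶠ x in 𝓝 (pathCov Z q), R x) : ∀ᶠ q' in 𝓝 q, R (pathCov Z q') := by
  have hc : Continuous fun q : Z × I => ((q.1, (q.2 : ℝ)) : Z × ℝ) := by fun_prop
  exact ((continuous_covCirc.comp hc).tendsto q).eventually h

/-- The functions on `Z × [0, 1]` locally pulled back from functions on `Z` satisfying `N`, as a
local condition over `Z × ℝ / ℤ`. -/
def path (N : FunPred Z (id : Z → Z)) : FunPred (prodCirc Z) (pathCov Z) where
  S x :=
    { carrier := {f | ∀ q, pathCov Z q = x → PathAt N f q}
      add_mem' := by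
        intro f g hf hg q hq
        obtain ⟨h, hh, hf⟩ := hf q hq
        obtain ⟨h', hh', hg⟩ := hg q hq
        refine ⟨h + h', add_mem hh hh', ?_⟩
        filter_upwards [hf, hg] with p' h1 h2
        simp [h1, h2]
      zero_mem' := fun p _ => ⟨0, zero_mem _, by simp⟩
      smul_mem' := by
        intro c f hf q hq
        obtain ⟨h, hh, hf⟩ := hf q hq
        refine ⟨c • h, Submodule.smul_mem _ c hh, ?_⟩
        filter_upwards [hf] with p' h1
        simp [h1] }
  local' := by
    rintro x f f' hff hf q rfl
    obtain ⟨h, hh, hf⟩ := hf q rfl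
    refine ⟨h, hh, ?_⟩
    filter_upwards [hf, eventually_pathCov hff] with p' h1 h2
    rw [← h1, h2 _ rfl]
  open' {x f} hf := isClosedMap_pathCov.eventually_nhds_fiber x
    fun q hq => eventually_pathAt (hf q hq)

/-- The inclusion of the base point section `z ↦ (z, 0)`. -/
def zeroSec (Z : TopCat.{0}) (z : Z) : prodCirc Z := covCirc Z (z, 0)

theorem isOpen_ne_zero : IsOpen {x : prodCirc Z | x.2 ≠ ((0 : ℝ) : Circ)} :=
  isOpen_ne.preimage continuous_snd

/-- The condition `N` on the base point section. -/
def atZero (N : FunPred Z (id : Z → Z)) : FunPred (prodCirc Z) (zeroSec Z) where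
  S x :=
    { carrier := {f | x.2 = ((0 : ℝ) : Circ) → f ∈ N.S x.1}
      add_mem' := fun hf hg hx => add_mem (hf hx) (hg hx)
      zero_mem' := fun _ => zero_mem _
      smul_mem' := fun c _ hf hx => Submodule.smul_mem _ c (hf hx) }
  local' := by
    intro x f f' hff hf hx
    obtain ⟨z, θ⟩ := x
    obtain rfl : θ = ((0 : ℝ) : Circ) := hx
    refine N.congr ?_ (hf rfl)
    have hc : Continuous fun z : Z => ((z, 0) : Z × ℝ) := by fun_prop
    filter_upwards [((continuous_covCirc.comp hc).tendsto z).eventually hff] with z' hz'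
    exact hz' z' rfl
  open' := by
    intro x f hf
    by_cases hx : x.2 = ((0 : ℝ) : Circ)
    · filter_upwards [(continuous_fst.tendsto x).eventually (N.open' (hf hx))] with x' hx' _
      exact hx'
    · filter_upwards [isOpen_ne_zero.mem_nhds hx] with x' hx' h
      exact absurd h hx'

/-- The map from twisted functions to functions on `Z × [0, 1]`. -/
def toPath (e : Z → ℂ) : (prodCirc Z → ℂ) →ₗ[ℂ] (Z × I → ℂ) where
  toFun f q := e q.1 ^ ⌊(q.2 : ℝ)⌋ * f (pathCov Z q)
  map_add' f g := by ext q; simp [mul_add]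
  map_smul' c f := by ext q; simp only [Pi.smul_apply, smul_eq_mul, RingHom.id_apply]; ring

/-- The difference of the boundary values, twisted by `e`. -/
def bdry (e : Z → ℂ) : (Z × I → ℂ) →ₗ[ℂ] (Z → ℂ) where
  toFun f z := f (z, 1) - e z * f (z, 0)
  map_add' f g := by ext z; simp only [Pi.add_apply]; ring
  map_smul' c f := by ext z; simp only [Pi.smul_apply, smul_eq_mul, RingHom.id_apply]; ring

theorem pathCov_zero (z : Z) : pathCov Z (z, 0) = zeroSec Z z := by simp [pathCov, zeroSec]

theorem pathCov_one (z : Z) : pathCov Z (z, 1) = zeroSec Z z :=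
  Prod.ext rfl (circ_eq_iff.2 ⟨-1, by simp⟩)

theorem isFiberwise_toPath (e : Z → ℂ) :
    FunPred.IsFiberwise (id : prodCirc Z → prodCirc Z) (pathCov Z) (toPath e) := by
  rintro f x hf q rfl
  change _ * f (pathCov Z q) = 0
  rw [hf (pathCov Z q) rfl, mul_zero]

theorem isFiberwise_bdry (e : Z → ℂ) :
    FunPred.IsFiberwise (pathCov Z) (zeroSec Z) (bdry e) := by
  rintro f x hf z rfl
  simp [bdry, hf _ (pathCov_zero z), hf _ (pathCov_one z)]

theorem toPath_mem {N : FunPred Z (id : Z → Z)} {e : Z → ℂ} (he : IsMultiplier N e)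
    (x : prodCirc Z) (f) (hf : f ∈ (twist N he).S x) : toPath e f ∈ (path N).S x := by
  rintro q rfl
  obtain ⟨h, hh, hf⟩ := hf (q.1, q.2) rfl
  have hc : Continuous fun q : Z × I => ((q.1, (q.2 : ℝ)) : Z × ℝ) := by fun_prop
  exact ⟨h, hh, (hc.tendsto q).eventually hf⟩

theorem slice_mem {N : FunPred Z (id : Z → Z)} {f : Z × I → ℂ} {z : Z} {y : I}
    (hf : PathAt N f (z, y)) : (fun z => f (z, y)) ∈ N.S z := by
  obtain ⟨h, hh, hf⟩ := hf
  have hc : Continuous fun z : Z => ((z, y) : Z × I) := by fun_prop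
  exact N.congr (((hc.tendsto z).eventually hf).mono fun _ h => h.symm) hh

theorem bdry_mem {N : FunPred Z (id : Z → Z)} {e : Z → ℂ} (he : IsMultiplier N e)
    (x : prodCirc Z) (f) (hf : f ∈ (path N).S x) : bdry e f ∈ (atZero N).S x := by
  intro hx
  have hx' : zeroSec Z x.1 = x := Prod.ext rfl hx.symm
  have h0 := slice_mem (hf (x.1, 0) ((pathCov_zero _).trans hx'))
  have h1 := slice_mem (hf (x.1, 1) ((pathCov_one _).trans hx'))
  exact sub_mem h1 (he.mul_mem h0)

theorem bdry_toPath (e : Z → ℂ) (f : prodCirc Z → ℂ) : bdry e (toPath e f) = 0 := by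
  ext z
  simp [bdry, toPath, pathCov_zero, pathCov_one]

/-- The representative in `[0, 1)` of a point of the circle. -/
def circRep (θ : Circ) : I :=
  ⟨AddCircle.equivIco 1 0 θ, by
    have := (AddCircle.equivIco (1 : ℝ) 0 θ).2
    exact ⟨this.1, (this.2.trans_eq (zero_add 1)).le⟩⟩

theorem coe_circRep (θ : Circ) : ((circRep θ : ℝ) : Circ) = θ := AddCircle.coe_equivIco

theorem circRep_coe {y : I} (hy : (y : ℝ) < 1) : circRep ((y : ℝ) : Circ) = y := by
  apply Subtype.ext
  change ((AddCircle.equivIco (1 : ℝ) 0 ((y : ℝ) : Circ)) : ℝ) = y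
  rw [AddCircle.equivIco_coe_eq (by simpa using ⟨y.2.1, hy⟩)]

theorem circRep_lt (θ : Circ) : (circRep θ : ℝ) < 1 := by
  have := (AddCircle.equivIco (1 : ℝ) 0 θ).2
  exact this.2.trans_eq (zero_add 1)

/-- The function on `Z × ℝ / ℤ` with given values on `Z × [0, 1)`. -/
def ofPath (f : Z × I → ℂ) (x : prodCirc Z) : ℂ := f (x.1, circRep x.2)

/-- On [0, 1) the factor e^⌊y⌋ is 1, so only the end 1 imposes anything: there f must equal e times
its value at 0, which is the vanishing of `bdry`. -/
theorem toPath_ofPath {e : Z → ℂ} {f : Z × I → ℂ} {q : Z × I}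
    (h : zeroSec Z q.1 = pathCov Z q → bdry e f q.1 = 0) : toPath e (ofPath f) q = f q := by
  obtain ⟨z, y⟩ := q
  by_cases hy : (y : ℝ) < 1
  · have : ⌊(y : ℝ)⌋ = 0 := Int.floor_eq_zero_iff.2 ⟨y.2.1, hy⟩
    change e z ^ ⌊(y : ℝ)⌋ * f (z, circRep ((y : ℝ) : Circ)) = _
    rw [this, circRep_coe hy]
    simp
  · obtain rfl : y = 1 := Subtype.ext (le_antisymm y.2.2 (not_lt.1 hy))
    have h' := h (pathCov_one z).symm
    have h0 : circRep (((1 : I) : ℝ) : Circ) = 0 := by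
      have h1 : (((1 : I) : ℝ) : Circ) = (((0 : I) : ℝ) : Circ) := circ_eq_iff.2 ⟨-1, by simp⟩
      rw [h1, circRep_coe (by simp)]
    change e z ^ ⌊((1 : I) : ℝ)⌋ * f (z, circRep (((1 : I) : ℝ) : Circ)) = _
    rw [h0]
    have h2 : f (z, 1) - e z * f (z, 0) = 0 := h'
    simp only [Set.Icc.coe_one, Int.floor_one, zpow_one]
    exact (sub_eq_zero.1 h2).symm

theorem eventually_comap_proj {p : Z × ℝ} {y : I} (hy : (y : ℝ) = p.2) {R : Z × I → Prop}
    (h : ∀ᶠ q in 𝓝 (p.1, y), R q) :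
    ∀ᶠ p' in 𝓝 p, R (p'.1, Set.projIcc (0 : ℝ) 1 zero_le_one p'.2) := by
  have hc : Continuous fun p' : Z × ℝ => ((p'.1, Set.projIcc (0 : ℝ) 1 zero_le_one p'.2) : Z × I) :=
    continuous_fst.prodMk (continuous_projIcc.comp continuous_snd)
  have ht := hc.tendsto p
  rw [← hy, Set.projIcc_val] at ht
  exact ht.eventually h

/-- Only points over the base point of the circle need an argument: the function to their left is
read off near the end 1 of the path, and the vanishing of the boundary term is exactly the twisted
matching condition. -/
theorem ofPath_mem {N : FunPred Z (id : Z → Z)} {e : Z → ℂ} (he : IsMultiplier N e)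
    {x : prodCirc Z} {f : Z × I → ℂ} (hf : f ∈ (path N).S x)
    (h0 : ∀ᶠ x' in 𝓝 x, ∀ z, zeroSec Z z = x' → bdry e f z = 0) :
    ofPath f ∈ (twist N he).S x := by
  obtain ⟨z, θ⟩ := x
  have hθ := coe_circRep θ
  generalize hy : circRep θ = y at hθ
  have hy1 : (y : ℝ) < 1 := by rw [← hy]; exact circRep_lt θ
  subst hθ
  obtain ⟨h, hh, hfh⟩ := hf (z, y) rfl
  refine (mem_twist (p := (z, (y : ℝ))) he).2 ⟨h, hh, ?_⟩
  have e1 := eventually_comap_proj (p := (z, (y : ℝ))) rfl hfh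
  have hlt : ∀ᶠ p' : Z × ℝ in 𝓝 (z, (y : ℝ)), p'.2 < 1 :=
    (continuous_snd.tendsto (z, (y : ℝ))).eventually (Iio_mem_nhds hy1)
  have key : ∀ p' : Z × ℝ, 0 ≤ p'.2 → p'.2 < 1 →
      f (p'.1, Set.projIcc (0 : ℝ) 1 zero_le_one p'.2) = h p'.1 →
      e p'.1 ^ ⌊p'.2⌋ * ofPath f (covCirc Z p') = h p'.1 := by
    intro p' h1 h2 h3
    rw [Int.floor_eq_zero_iff.2 ⟨h1, h2⟩, zpow_zero, one_mul, ← h3,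
      Set.projIcc_of_mem _ ⟨h1, h2.le⟩]
    change f (p'.1, circRep (p'.2 : Circ)) = _
    rw [← circRep_coe (y := ⟨p'.2, h1, h2.le⟩) h2]
  rcases y.2.1.lt_or_eq with hy0 | hy0
  · have hgt : ∀ᶠ p' : Z × ℝ in 𝓝 (z, (y : ℝ)), 0 < p'.2 :=
      (continuous_snd.tendsto (z, (y : ℝ))).eventually (Ioi_mem_nhds hy0)
    filter_upwards [e1, hlt, hgt] with p' h1 h2 h3
    exact key p' h3.le h2 h1
  · obtain rfl : y = 0 := Subtype.ext hy0.symm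
    -- The germ at the end 1 describes the function for y slightly negative, where ⌊y⌋ = -1; the
    -- boundary condition reads k = e · h, so multiplying by e⁻¹ gives h on that side too.
    obtain ⟨k, hk, hfk⟩ := hf (z, 1) (by rw [pathCov_one]; simp [zeroSec, covCirc])
    have hsh : Continuous fun p' : Z × ℝ => ((p'.1, p'.2 + 1) : Z × ℝ) := by fun_prop
    have hst := hsh.tendsto (z, ((0 : I) : ℝ))
    have e2 := hst.eventually (eventually_comap_proj
      (p := (z, ((0 : I) : ℝ) + 1)) (y := 1) (by simp) hfk)
    have hc0 : Continuous fun p' : Z × ℝ => ((p'.1, 0) : Z × I) := by fun_prop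
    have e3 := (hc0.tendsto (z, ((0 : I) : ℝ))).eventually hfh
    have hc1 : Continuous fun p' : Z × ℝ => ((p'.1, 1) : Z × I) := by fun_prop
    have e4 := (hc1.tendsto (z, ((0 : I) : ℝ))).eventually hfk
    have hc2 : Continuous fun p' : Z × ℝ => zeroSec Z p'.1 :=
      continuous_covCirc.comp (by fun_prop)
    have e5 := (hc2.tendsto (z, ((0 : I) : ℝ))).eventually (p := fun x' =>
      ∀ z, zeroSec Z z = x' → bdry e f z = 0) (by simpa [zeroSec, covCirc] using h0)
    have hgt : ∀ᶠ p' : Z × ℝ in 𝓝 (z, ((0 : I) : ℝ)), -1 < p'.2 :=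
      (continuous_snd.tendsto (z, ((0 : I) : ℝ))).eventually (Ioi_mem_nhds (by simp))
    filter_upwards [e1, e2, e3, e4, e5, hlt, hgt] with p' h1 h2 h3 h4 h5 h6 h7
    by_cases hp : 0 ≤ p'.2
    · exact key p' hp h6 h1
    · have hp := not_le.1 hp
      have hb : f (p'.1, 1) - e p'.1 * f (p'.1, 0) = 0 := h5 p'.1 rfl
      have hfl : ⌊p'.2⌋ = -1 := Int.floor_eq_iff.2 ⟨by push_cast; linarith, by push_cast; linarith⟩
      have hm : p'.2 + 1 ∈ Set.Icc (0 : ℝ) 1 := ⟨by linarith, by linarith⟩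
      have hof : ofPath f (covCirc Z p') = k p'.1 := by
        rw [← h2, Set.projIcc_of_mem _ hm]
        have hl : ((⟨p'.2 + 1, hm⟩ : I) : ℝ) < 1 := by change p'.2 + 1 < 1; linarith
        rw [← circRep_coe hl]
        change f (p'.1, circRep (p'.2 : Circ)) = f (p'.1, circRep ((p'.2 + 1 : ℝ) : Circ))
        rw [show ((p'.2 + 1 : ℝ) : Circ) = (p'.2 : Circ) from circ_eq_iff.2 ⟨-1, by simp⟩]
      rw [hof, ← h4, hfl, ← h3, sub_eq_zero.1 hb, zpow_neg_one,
        inv_mul_cancel_left₀ (he.ne_zero _)]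

/-- The short complex `0 → twist → path → atZero → 0`. -/
def pathComplex (N : FunPred Z (id : Z → Z)) {e : Z → ℂ} (he : IsMultiplier N e) :
    ShortComplex (Sh (prodCirc Z)) :=
  ShortComplex.mk
    (FunPred.hom (twist N he) (path N) (toPath e) (isFiberwise_toPath e) (toPath_mem he))
    (FunPred.hom (path N) (atZero N) (bdry e) (isFiberwise_bdry e) (bdry_mem he))
    (FunPred.hom_comp_hom_eq_zero (bdry_toPath e))

theorem pathComplex_shortExact (N : FunPred Z (id : Z → Z)) {e : Z → ℂ} (he : IsMultiplier N e) :
    (pathComplex N he).ShortExact := by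
  refine FunPred.shortExact (bdry_toPath e) ?_ ?_ ?_
  · rintro x f - h0 y rfl
    have h1 := h0.self_of_nhds (y.1, circRep y.2) (Prod.ext rfl (coe_circRep _))
    have h2 : pathCov Z (y.1, circRep y.2) = y := Prod.ext rfl (coe_circRep _)
    change e y.1 ^ ⌊(circRep y.2 : ℝ)⌋ * f (pathCov Z (y.1, circRep y.2)) = 0 at h1
    rw [h2] at h1
    exact (mul_eq_zero.1 h1).resolve_left (zpow_ne_zero _ (he.ne_zero _))
  · intro x f hf h0
    refine ⟨ofPath f, ofPath_mem he hf h0, ?_⟩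
    filter_upwards [h0] with x' hx' q hq
    exact toPath_ofPath fun h => hx' _ (h.trans hq)
  · intro x g hg
    by_cases hx : x.2 = ((0 : ℝ) : Circ)
    · classical
      -- This has boundary values 0 at 0 and g at 1, hence boundary term g. Its jump at 1/2 does no
      -- harm, since germs are taken only at points lying over the base point of the circle.
      let f : Z × I → ℂ := fun q => if (1 / 2 : ℝ) < q.2 then g q.1 else 0
      refine ⟨f, ?_, Filter.Eventually.of_forall fun x' z _ => ?_⟩
      · rintro q rfl
        have hq : q.2 ≠ (1 / 2 : ℝ) := by
          intro h
          obtain ⟨n, hn⟩ := circ_eq_iff.1 hx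
          dsimp only at hn
          rw [h] at hn
          have h1 : (2 * n : ℝ) = -1 := by linarith
          have h2 : 2 * n = -1 := by exact_mod_cast h1
          omega
        have hc : Continuous fun q : Z × I => (q.2 : ℝ) := by fun_prop
        rcases lt_or_gt_of_ne hq with h | h
        · refine ⟨0, zero_mem _, ?_⟩
          filter_upwards [(hc.tendsto q).eventually (Iio_mem_nhds h)] with q' hq'
          exact if_neg (not_lt.2 (le_of_lt hq'))
        · refine ⟨g, hg hx, ?_⟩
          filter_upwards [(hc.tendsto q).eventually (Ioi_mem_nhds h)] with q' hq'
          exact if_pos hq'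
      · simp only [bdry, f, LinearMap.coe_mk, AddHom.coe_mk, Set.Icc.coe_one, Set.Icc.coe_zero]
        norm_num
    · refine ⟨0, zero_mem _, ?_⟩
      filter_upwards [isOpen_ne_zero.mem_nhds hx] with x' hx' z hz
      subst hz
      exact absurd rfl hx'

end PathSheaf


/-! ### The cut-open sheaf satisfies Mayer–Vietoris on segments of fibres. -/

section PathSheaf

open scoped unitInterval

variable {Z : TopCat.{0}}

/-- Besides the segment itself, the preimage in [0, 1] may contain the opposite end, because 0 and 1
have the same image; the last two alternatives record this. -/
theorem lift_seg {z : Z} {s t : ℝ} (hs : 0 ≤ s) (ht : t ≤ 1) {q : Z × I}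
    (hq : pathCov Z q ∈ seg z s t) : q.1 = z ∧ ((s ≤ (q.2 : ℝ) ∧ (q.2 : ℝ) ≤ t) ∨
      (s ≤ 0 ∧ (q.2 : ℝ) = 1) ∨ (1 ≤ t ∧ (q.2 : ℝ) = 0)) := by
  obtain ⟨y, hy, h⟩ := hq
  obtain ⟨n, hn⟩ := circ_eq_iff.1 (congrArg Prod.snd h)
  refine ⟨(congrArg Prod.fst h).symm, ?_⟩
  dsimp only at hn
  have h0 := q.2.2.1
  have h1 := q.2.2.2
  have hl : (-1 : ℝ) ≤ n := by linarith [hy.2]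
  have hu : (n : ℝ) ≤ 1 := by linarith [hy.1]
  have hl' : -1 ≤ n := by exact_mod_cast hl
  have hu' : n ≤ 1 := by exact_mod_cast hu
  obtain rfl | rfl | rfl : n = -1 ∨ n = 0 ∨ n = 1 := by omega
  · push_cast at hn
    exact Or.inr (Or.inr ⟨by linarith [hy.2], by linarith [hy.2]⟩)
  · push_cast at hn
    exact Or.inl ⟨by linarith [hy.1], by linarith [hy.2]⟩
  · push_cast at hn
    exact Or.inr (Or.inl ⟨by linarith [hy.1], by linarith [hy.1]⟩)

theorem eventually_eq_slice {N : FunPred Z (id : Z → Z)} {f : Z × I → ℂ} {z : Z} {y : I}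
    (hf : PathAt N f (z, y)) : ∀ᶠ q in 𝓝 (z, y), f q = f (q.1, y) := by
  obtain ⟨h, hh, hf⟩ := hf
  have hc : Continuous fun q : Z × I => ((q.1, y) : Z × I) := by fun_prop
  filter_upwards [hf, (hc.tendsto (z, y)).eventually hf] with q h1 h2
  rw [h1, h2]

/-- On Z × [0, 1] the two segments meet at b and, if c = 1, also at the isolated end 1 of the
preimage of the first and the isolated end 0 of the preimage of the second. The value at b can be
continued along the first segment, and the isolated ends can be adjusted independently. -/
theorem fiberMV_path [T2Space Z] (N : FunPred Z (id : Z → Z)) : FiberMV (path N).sheaf := by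
  classical
  intro z b c hb hbc hc
  refine (path N).mayerVietoris (isCompact_seg z _ _) (isCompact_seg z _ _) fun a ha => ?_
  rcases hb.eq_or_lt with rfl | hb'
  · have hsub : seg z 0 0 ⊆ seg z 0 c := Set.image_mono (Set.Icc_subset_Icc le_rfl hbc)
    exact ⟨a, 0, fun x hx => ha x ⟨hx, hsub hx⟩, fun x _ => zero_mem _,
      fun x _ => Filter.Eventually.of_forall fun x' y _ => by simp⟩
  rcases hbc.eq_or_lt with rfl | hbc'
  · have hsub : seg z b b ⊆ seg z 0 b := Set.image_mono (Set.Icc_subset_Icc hb le_rfl)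
    exact ⟨0, -a, fun x _ => zero_mem _, fun x hx => neg_mem (ha x ⟨hsub hx, hx⟩),
      fun x _ => Filter.Eventually.of_forall fun x' y _ => by simp⟩
  let b' : I := ⟨b, hb, hbc.trans hc⟩
  have hab : PathAt N a (z, b') := ha (pathCov Z (z, b'))
    ⟨⟨b, ⟨hb, le_rfl⟩, rfl⟩, ⟨b, ⟨le_rfl, hbc⟩, rfl⟩⟩ _ rfl
  -- The germs of `a` at the two ends matter only when the second segment reaches 1; otherwise 0 is
  -- a harmless choice.
  obtain ⟨u₀, u₁, hu₀, hu₁, hu⟩ : ∃ u₀ u₁ : Z → ℂ, u₀ ∈ N.S z ∧ u₁ ∈ N.S z ∧ (1 ≤ c →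
      (∀ᶠ q in 𝓝 ((z, 0) : Z × I), a q = u₀ q.1) ∧
      (∀ᶠ q in 𝓝 ((z, 1) : Z × I), a q = u₁ q.1)) := by
    by_cases h1 : 1 ≤ c
    · obtain rfl : c = 1 := le_antisymm hc h1
      have hm : zeroSec Z z ∈ seg z 0 b ∩ seg z b 1 :=
        ⟨⟨0, ⟨le_rfl, hb⟩, rfl⟩, ⟨1, ⟨hbc, le_rfl⟩, by
          rw [← pathCov_one]; simp [pathCov, covCirc]⟩⟩
      obtain ⟨u₀, hu₀, h₀⟩ := ha _ hm (z, 0) (pathCov_zero z)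
      obtain ⟨u₁, hu₁, h₁⟩ := ha _ hm (z, 1) (pathCov_one z)
      exact ⟨u₀, u₁, hu₀, hu₁, fun _ => ⟨h₀, h₁⟩⟩
    · exact ⟨0, 0, zero_mem _, zero_mem _, fun h => absurd h h1⟩
  -- The difference a₁ - a₂ is a(·, b) - 0 near b, a(·, b) - (a(·, b) - u₀) = u₀ near 0, and u₁ - 0
  -- near 1. The jumps sit at the midpoints of [b, 1] and [0, b], away from the preimages of the
  -- first and the second segment respectively.
  let a₁ : Z × I → ℂ := fun q => if (q.2 : ℝ) < (b + 1) / 2 then a (q.1, b') else u₁ q.1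
  let a₂ : Z × I → ℂ := fun q => if b / 2 < (q.2 : ℝ) then 0 else a (q.1, b') - u₀ q.1
  have hcont : Continuous fun q : Z × I => (q.2 : ℝ) := by fun_prop
  have ha₁lt : ∀ q : Z × I, (q.2 : ℝ) < (b + 1) / 2 → ∀ᶠ q' in 𝓝 q, a₁ q' = a (q'.1, b') := by
    intro q hq
    filter_upwards [(hcont.tendsto q).eventually (Iio_mem_nhds hq)] with q' hq'
    exact if_pos hq'
  have ha₁gt : ∀ q : Z × I, (b + 1) / 2 < (q.2 : ℝ) → ∀ᶠ q' in 𝓝 q, a₁ q' = u₁ q'.1 := by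
    intro q hq
    filter_upwards [(hcont.tendsto q).eventually (Ioi_mem_nhds hq)] with q' hq'
    exact if_neg (not_lt.2 (le_of_lt hq'))
  have ha₂gt : ∀ q : Z × I, b / 2 < (q.2 : ℝ) → ∀ᶠ q' in 𝓝 q, a₂ q' = 0 := by
    intro q hq
    filter_upwards [(hcont.tendsto q).eventually (Ioi_mem_nhds hq)] with q' hq'
    exact if_pos hq'
  have ha₂lt : ∀ q : Z × I, (q.2 : ℝ) < b / 2 →
      ∀ᶠ q' in 𝓝 q, a₂ q' = a (q'.1, b') - u₀ q'.1 := by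
    intro q hq
    filter_upwards [(hcont.tendsto q).eventually (Iio_mem_nhds hq)] with q' hq'
    exact if_neg (not_lt.2 (le_of_lt hq'))
  have hsl := slice_mem hab
  refine ⟨a₁, a₂, ?_, ?_, ?_⟩
  · rintro x hx q rfl
    obtain ⟨hz, h⟩ := lift_seg le_rfl (hbc.trans hc) hx
    by_cases hq : (q.2 : ℝ) < (b + 1) / 2
    · exact ⟨_, by rw [hz]; exact hsl, ha₁lt q hq⟩
    · refine ⟨u₁, by rw [hz]; exact hu₁, ha₁gt q ?_⟩
      rcases h with h | h | h <;> linarith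
  · rintro x hx q rfl
    obtain ⟨hz, h⟩ := lift_seg hb hc hx
    by_cases hq : b / 2 < (q.2 : ℝ)
    · exact ⟨0, zero_mem _, ha₂gt q hq⟩
    · refine ⟨(fun w => a (w, b')) - u₀, by rw [hz]; exact sub_mem hsl hu₀, ha₂lt q ?_⟩
      rcases h with h | h | h <;> linarith
  · rintro x ⟨hx₁, hx₂⟩
    refine isClosedMap_pathCov.eventually_nhds_fiber x ?_
    rintro ⟨z', y⟩ rfl
    obtain ⟨hz, h₁⟩ := lift_seg le_rfl (hbc.trans hc) hx₁
    obtain ⟨-, h₂⟩ := lift_seg hb hc hx₂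
    obtain rfl : z' = z := hz
    dsimp only at h₁ h₂
    have h3 : (y : ℝ) = b ∨ (1 ≤ c ∧ (y : ℝ) = 0) ∨ (1 ≤ c ∧ (y : ℝ) = 1) := by
      rcases h₁ with h | h | h
      · rcases h₂ with h' | h' | h'
        · exact Or.inl (le_antisymm h.2 h'.1)
        · linarith
        · exact Or.inr (Or.inl h')
      · rcases h₂ with h' | h' | h'
        · exact Or.inr (Or.inr ⟨h.2 ▸ h'.2, h.2⟩)
        · linarith
        · exact Or.inr (Or.inl h')
      · linarith
    rcases h3 with h | ⟨h, h'⟩ | ⟨h, h'⟩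
    · obtain rfl : y = b' := Subtype.ext h
      filter_upwards [ha₁lt (z', b') (by dsimp only [b']; linarith),
        ha₂gt (z', b') (by dsimp only [b']; linarith), eventually_eq_slice hab] with q h1 h2 h3
      rw [h1, h2, h3, sub_zero]
    · obtain rfl : y = 0 := Subtype.ext h'
      filter_upwards [ha₁lt (z', 0) (by dsimp only; linarith),
        ha₂lt (z', 0) (by dsimp only; linarith), (hu h).1] with q h1 h2 h3
      rw [h1, h2, h3, sub_sub_cancel]
    · obtain rfl : y = 1 := Subtype.ext h'
      filter_upwards [ha₁gt (z', 1) (by dsimp only; linarith),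
        ha₂gt (z', 1) (by dsimp only; linarith), (hu h).2] with q h1 h2 h3
      rw [h1, h2, h3, sub_zero]

/-- A section of `path N` along a whole fibre is pulled back from `Z` near the fibre. -/
theorem eventually_path_eq {N : FunPred Z (id : Z → Z)} {f : Z × I → ℂ} {z : Z}
    (hf : ∀ y, PathAt N f (z, y)) : ∀ᶠ z' in 𝓝 z, ∀ y, f (z', y) = f (z', 0) := by
  -- `A` is open by definition and closed because f is locally independent of y, so connectedness of
  -- [0, 1] makes it everything. Compactness then gives one neighbourhood of z valid for all y.
  let A : Set I := {y | ∀ᶠ q in 𝓝 ((z, y) : Z × I), f q = f (q.1, 0)}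
  have hcy : Continuous fun y : I => ((z, y) : Z × I) := by fun_prop
  have hA : IsClopen A := by
    constructor
    · rw [← isOpen_compl_iff, isOpen_iff_mem_nhds]
      intro y hy
      have h1 := (hcy.tendsto y).eventually (eventually_eq_slice (hf y)).eventually_nhds
      filter_upwards [h1] with y' hy' hmem
      apply hy
      have hcq : Continuous fun q : Z × I => ((q.1, y') : Z × I) := by fun_prop
      have h2 := (hcq.tendsto (z, y)).eventually hy'
      have h3 := (hcq.tendsto (z, y)).eventually hmem
      filter_upwards [eventually_eq_slice (hf y), h2, h3] with q e1 e2 e3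
      rw [e1, ← e3, e2]
    · rw [isOpen_iff_mem_nhds]
      intro y hy
      exact (hcy.tendsto y).eventually hy.eventually_nhds
  have huniv := hA.eq_univ ⟨0, eventually_eq_slice (hf 0)⟩
  have := isCompact_univ.eventually_forall_of_forall_eventually (x₀ := z)
    (P := fun z' y => f (z', y) = f (z', 0)) (K := (Set.univ : Set I))
    (fun y _ => by
      have : y ∈ A := by rw [huniv]; trivial
      exact this)
  exact this.mono fun z' h y => h y trivial

end PathSheaf

/-! ### One circle: the pushforward of the resolution and its derived functors. -/

section Step

open Limits

variable {Z : TopCat.{0}}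

/-- The cokernel map from the pushforward of `atZero N` to `M`. -/
def cokerHom {N M : FunPred Z (id : Z → Z)} {a σ : Z → ℂ} (ht : IsTriple N M a σ) :
    (TopCat.Sheaf.pushforward (ModuleCat.{0} ℂ) (prodFst Z)).obj (atZero N).sheaf ⟶ M.sheaf :=
  ⟨{ app U := ModuleCat.ofHom
      { toFun := fun s => (⟨fun z => σ z * (atZero N).val s z,
          fun z hz => (congrArg (σ z * ·)
            ((atZero N).val_eq_zero s (y := z) (fun h => hz h))).trans (mul_zero _),
          fun z hz => ht.res_mem ((atZero N).val_mem s (x := zeroSec Z z) hz rfl)⟩ :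
            M.sections U.unop)
        map_add' := fun s t => Subtype.ext (funext fun z => mul_add _ _ _)
        map_smul' := fun c s => Subtype.ext (funext fun z => mul_left_comm _ _ _) }
     naturality U U' i := by
      ext1
      refine LinearMap.ext fun s => Subtype.ext (funext fun z => ?_)
      by_cases hz : z ∈ U'.unop
      · exact (congrArg (σ z * ·) (FunPred.cut_of_mem (π := zeroSec Z) (y := z)
          (W := (Opens.map (prodFst Z)).obj U'.unop) hz _)).trans
          (FunPred.cut_of_mem (π := (id : Z → Z)) (y := z) hz
            (fun z => σ z * (atZero N).val s z)).symm
      · refine Eq.trans ?_ (FunPred.cut_of_notMem (π := (id : Z → Z)) (y := z) hz _).symm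
        exact (congrArg (σ z * ·) (FunPred.cut_of_notMem (π := zeroSec Z) (y := z)
          (W := (Opens.map (prodFst Z)).obj U'.unop) hz _)).trans (mul_zero _) }⟩

theorem fiber_const {N : FunPred Z (id : Z → Z)} {U : Opens Z}
    (s : Sec (path N).sheaf ((Opens.map (prodFst Z)).obj U)) {z : Z} (hz : z ∈ U) :
    (fun z => (path N).val s (z, 0)) ∈ N.S z ∧
      ∀ᶠ z' in 𝓝 z, ∀ y, (path N).val s (z', y) = (path N).val s (z', 0) := by
  have h : ∀ y, PathAt N ((path N).val s) (z, y) := fun y =>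
    (path N).val_mem s (x := pathCov Z (z, y)) hz _ rfl
  exact ⟨slice_mem (h 0), eventually_path_eq h⟩

theorem pushforward_pathComplex_cokerHom {N M : FunPred Z (id : Z → Z)} {e σ : Z → ℂ}
    (he : IsMultiplier N e) (ht : IsTriple N M (fun z => 1 - e z) σ) :
    (TopCat.Sheaf.pushforward (ModuleCat.{0} ℂ) (prodFst Z)).map (pathComplex N he).g ≫
      cokerHom ht = 0 := by
  refine hom_ext_sec fun U s => M.sec_ext fun z hz => ?_
  obtain ⟨-, h⟩ := fiber_const (N := N) (U := U) s hz
  change σ z * ((path N).val s (z, 1) - e z * (path N).val s (z, 0)) = 0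
  have h1 := ht.res_mul z
  have h2 : (path N).val s (z, 1) = (path N).val s (z, 0) := h.self_of_nhds 1
  linear_combination (path N).val s (z, 0) * h1 + σ z * h2

/-- After pushforward both sheaves of the resolution become copies of `N`: sections over a full
fibre are constant along it, and the base point section is a copy of Z. The boundary map turns into
multiplication by 1 - e, so `IsTriple` supplies exactness. -/
theorem pushforward_shortExact {N M : FunPred Z (id : Z → Z)} {e σ : Z → ℂ}
    (he : IsMultiplier N e) (ht : IsTriple N M (fun z => 1 - e z) σ) :
    (ShortComplex.mk _ _ (pushforward_pathComplex_cokerHom he ht)).ShortExact where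
  mono_f := by
    refine mono_of_secMap_injective _ fun U => (injective_iff_map_eq_zero _).2 fun s hs => ?_
    refine (path N).sec_ext fun q hq => ?_
    obtain ⟨z, y⟩ := q
    have hz : z ∈ U := hq
    obtain ⟨h1, h2⟩ := fiber_const (N := N) (U := U) s hz
    have h3 : (path N).val s (z, 0) = 0 := by
      refine ht.inj h1 (h2.mono fun z' h => ?_)
      have h4 : (path N).val s (z', 1) - e z' * (path N).val s (z', 0) = 0 :=
        congrFun (congrArg (atZero N).val hs) z'
      rw [h 1] at h4
      linear_combination h4
    exact (h2.self_of_nhds y).trans h3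
  exact := by
    refine exact_of_sec _ fun U s hs z hz => ?_
    obtain ⟨g, hg, hgs⟩ := ht.exact ((atZero N).val_mem s (x := zeroSec Z z) hz rfl)
      (Filter.Eventually.of_forall fun z' => congrFun (congrArg M.val hs) z')
    obtain ⟨V, hVU, hzV, hV⟩ := FunPred.exists_opens ((N.open' hg).and hgs) hz
    let W := (Opens.map (prodFst Z)).obj V
    refine ⟨V, hVU, hzV, (path N).sec W (fun q => g q.1) ?_, (atZero N).sec_ext fun z' hz' => ?_⟩
    · rintro x hx q rfl
      exact ⟨g, (hV _ hx).1, Filter.Eventually.of_forall fun _ => rfl⟩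
    · refine (FunPred.val_secMap_hom_sec (W := W) (hΦ := isFiberwise_bdry e)
        (h := bdry_mem he) (P := path N) (P' := atZero N) hz').trans ?_
      refine Eq.trans ?_ ((atZero N).val_res
        ((Opens.map (prodFst Z)).monotone hVU) s (y := z') hz').symm
      rw [← (hV z' hz').2]
      simp only [bdry, LinearMap.coe_mk, AddHom.coe_mk]
      ring
  epi_g := by
    refine (epi_iff_sec _).2 fun U t z hz => ?_
    obtain ⟨g, hg, hgs⟩ := ht.surj (M.val_mem t hz)
    obtain ⟨V, hVU, hzV, hV⟩ := FunPred.exists_opens ((N.open' hg).and hgs) hz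
    let W := (Opens.map (prodFst Z)).obj V
    refine ⟨V, hVU, hzV, (atZero N).sec W g fun x hx _ => (hV _ hx).1, M.sec_ext fun z' hz' => ?_⟩
    refine Eq.trans ?_ (M.val_res hVU t hz').symm
    refine Eq.trans ?_ ((hV z' hz').2)
    exact congrArg (σ z' * ·) ((atZero N).val_sec (W := W) (y := z') hz')

/-- Pushforward is right adjoint to pullback, which is exact. -/
theorem injective_pushforward {X Y : TopCat.{0}} (f : X ⟶ Y) (F : Sh X) (hF : Injective F) :
    Injective ((TopCat.Sheaf.pushforward (ModuleCat.{0} ℂ) f).obj F) :=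
  have : PreservesFiniteLimits ((Opens.map f).op.lan : _ ⥤ (_ ⥤ ModuleCat.{0} ℂ)) :=
    lan_preservesFiniteLimits_of_flat _ _
  have : PreservesFiniteLimits (TopCat.Sheaf.pullback (ModuleCat.{0} ℂ) f) :=
    Functor.sheafPullbackConstruction.preservesFiniteLimits (Opens.map f) (ModuleCat.{0} ℂ)
      (Opens.grothendieckTopology Y) (Opens.grothendieckTopology X)
  (TopCat.Sheaf.pullbackPushforwardAdjunction (ModuleCat.{0} ℂ) f).map_injective F hF

theorem epi_pushforward_of_isInjQuotient [T2Space Z] (S : ShortComplex (Sh (prodCirc Z)))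
    (hS : S.ShortExact) (hA : IsInjQuotient S.X₁) :
    Epi ((TopCat.Sheaf.pushforward (ModuleCat.{0} ℂ) (prodFst Z)).map S.g) := by
  obtain ⟨J, f, hJ, hf⟩ := hA
  refine epi_pushforward_of_fiberMV hS ?_
  exact fiberMV_of_injective (S := ShortComplex.mk (kernel.ι f) f (kernel.condition f))
    { exact := ShortComplex.exact_kernel f
      mono_f := inferInstanceAs (Mono (kernel.ι f))
      epi_g := hf } hJ

/-- The derived functors of the pushforward of a twist along the circle. -/
theorem rightDerived_twist [T2Space Z] {E : Type*} [Category E] [Abelian E] (Q : Sh Z ⥤ E)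
    [Q.Additive] [PreservesFiniteLimits Q] {N M : FunPred Z (id : Z → Z)} {e σ : Z → ℂ}
    (he : IsMultiplier N e) (ht : IsTriple N M (fun z => 1 - e z) σ) :
    IsZero (((TopCat.Sheaf.pushforward (ModuleCat.{0} ℂ) (prodFst Z) ⋙ Q).rightDerived 0).obj
        (twist N he).sheaf) ∧
      ∀ n, Nonempty
        (((TopCat.Sheaf.pushforward (ModuleCat.{0} ℂ) (prodFst Z) ⋙ Q).rightDerived (n + 1)).obj
          (twist N he).sheaf ≅ (Q.rightDerived n).obj M.sheaf) :=
  rightDerived_comp_succ _ Q (fun I hI => injective_pushforward _ I hI)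
    epi_pushforward_of_isInjQuotient (pathComplex_shortExact N he)
    (fun _ _ _ h => epi_pushforward_of_fiberMV h (fiberMV_path N))
    (cokerHom ht) (pushforward_pathComplex_cokerHom he ht) (pushforward_shortExact he ht)

end Step


/-! ### Smooth functions: Hadamard division and the factor 1 - exp(2πi u). -/

section Analysis

variable {V : Type} [NormedAddCommGroup V] [NormedSpace ℝ V]

open MeasureTheory in
/-- Integrals over `[0, 1]` depend smoothly on parameters. -/
theorem contDiff_integral {ψ : V × ℝ → ℂ} (hψ : ContDiff ℝ ∞ ψ) :
    ContDiff ℝ ∞ (fun x => ∫ θ in (0 : ℝ)..1, ψ (x, θ)) := by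
  -- The integral is the value at 0 of the convolution of the indicator of (0, 1] with t ↦ ψ(x, -t).
  -- The bump function supplies compact support and equals 1 on [-2, 2], which contains all the
  -- points -t with t in (0, 1].
  let χ : ContDiffBump (0 : ℝ) := ⟨2, 3, by norm_num, by norm_num⟩
  let f : ℝ → ℝ := Set.indicator (Set.Ioc 0 1) 1
  let g : V → ℝ → ℂ := fun p t => χ t • ψ (p, -t)
  have hf : LocallyIntegrable f volume := by
    refine (IntegrableOn.integrable_indicator ?_ measurableSet_Ioc).locallyIntegrable
    exact integrableOn_const (by simp) (by simp)
  have hg : ContDiffOn ℝ ∞ ↿g (Set.univ ×ˢ Set.univ) := by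
    have h1 : ContDiff ℝ ∞ fun q : V × ℝ => χ q.2 := χ.contDiff.comp contDiff_snd
    have h2 : ContDiff ℝ ∞ fun q : V × ℝ => ψ (q.1, -q.2) :=
      hψ.comp (contDiff_fst.prodMk contDiff_snd.neg)
    exact (h1.smul h2).contDiffOn
  have key := contDiffOn_convolution_right_with_param_comp (μ := volume) (n := ⊤)
    (ContinuousLinearMap.lsmul ℝ ℝ : ℝ →L[ℝ] ℂ →L[ℝ] ℂ) (s := (Set.univ : Set V))
    (v := fun _ => (0 : ℝ)) contDiffOn_const isOpen_univ (isCompact_closedBall (0 : ℝ) 3)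
    (f := f) (g := g) (fun p x _ hx => by
      have : χ x = 0 := χ.zero_of_le_dist (by
        rw [Metric.mem_closedBall, not_le] at hx
        exact hx.le)
      simp [g, this]) hf hg
  rw [contDiffOn_univ] at key
  convert key using 2 with x
  rw [intervalIntegral.integral_of_le zero_le_one, ← integral_indicator measurableSet_Ioc]
  refine integral_congr_ae (Filter.Eventually.of_forall fun t => Eq.symm ?_)
  by_cases ht : t ∈ Set.Ioc (0 : ℝ) 1
  · have h1 : χ (-t) = 1 := χ.one_of_mem_closedBall (by
      simp only [Metric.mem_closedBall, dist_zero_right, norm_neg, Real.norm_eq_abs, χ]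
      rw [abs_of_pos ht.1]
      linarith [ht.2])
    simp [f, g, ht, h1]
  · simp [f, ht]

/-- The germ of a smooth function extends to a smooth function. -/
theorem exists_contDiff_eventuallyEq [FiniteDimensional ℝ V] {h : V → ℂ} {x : V}
    (hh : ∀ᶠ x' in 𝓝 x, ContDiffAt ℝ ∞ h x') :
    ∃ H : V → ℂ, ContDiff ℝ ∞ H ∧ ∀ᶠ x' in 𝓝 x, h x' = H x' := by
  obtain ⟨r, hr, hball⟩ := Metric.eventually_nhds_iff_ball.1 hh
  let χ : ContDiffBump x := ⟨r / 4, r / 2, by positivity, by linarith⟩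
  refine ⟨fun y => χ y • h y, ?_, ?_⟩
  · rw [contDiff_iff_contDiffAt]
    intro y
    by_cases hy : dist y x < r
    · exact χ.contDiff.contDiffAt.smul (hball y hy)
    · have : ∀ᶠ y' in 𝓝 y, χ y' • h y' = 0 := by
        have hy' : r / 2 < dist y x := by linarith
        have hc : Continuous fun y' => dist y' x := by fun_prop
        filter_upwards [(hc.tendsto y).eventually (Ioi_mem_nhds hy')] with y' hy'
        rw [χ.zero_of_le_dist (le_of_lt hy'), zero_smul]
      exact contDiffAt_const.congr_of_eventuallyEq this
  · filter_upwards [Metric.ball_mem_nhds x (show 0 < r / 4 by positivity)] with y hy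
    rw [χ.one_of_mem_closedBall (Metric.ball_subset_closedBall hy), one_smul]

/-- Hadamard's lemma in one direction. -/
theorem exists_hadamard_quotient [FiniteDimensional ℝ V] {h : V → ℂ} {x : V}
    (hh : ∀ᶠ x' in 𝓝 x, ContDiffAt ℝ ∞ h x') (u : StrongDual ℝ V) (b : V) (c : ℝ) (hc : u x = c) :
    ∃ k : V → ℂ, ContDiff ℝ ∞ k ∧
      ∀ᶠ x' in 𝓝 x, h x' - h (x' - (u x' - c) • b) = (u x' - c : ℝ) * k x' := by
  obtain ⟨H, hH, hhH⟩ := exists_contDiff_eventuallyEq hh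
  -- The path runs in direction b from x' - (u x' - c) b to x'. Its velocity carries the factor u x'
  -- - c, so integrating the derivative of H along it produces the quotient.
  let γ : V × ℝ → V := fun p => p.1 - (u p.1 - c) • b + p.2 • (u p.1 - c) • b
  have hγ : ContDiff ℝ ∞ γ := by
    have h1 : ContDiff ℝ ∞ fun p : V × ℝ => u p.1 - c :=
      (u.contDiff.comp contDiff_fst).sub contDiff_const
    exact (contDiff_fst.sub (h1.smul contDiff_const)).add
      (contDiff_snd.smul (h1.smul contDiff_const))
  let ψ : V × ℝ → ℂ := fun p => fderiv ℝ H (γ p) b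
  have hψ : ContDiff ℝ ∞ ψ :=
    ((hH.fderiv_right (m := ∞) (by simp)).comp hγ).clm_apply contDiff_const
  refine ⟨fun x => ∫ θ in (0 : ℝ)..1, ψ (x, θ), contDiff_integral hψ, ?_⟩
  have hr : Continuous fun x' : V => x' - (u x' - c) • b := by fun_prop
  have hrt := hr.tendsto x
  rw [hc, sub_self, zero_smul, sub_zero] at hrt
  filter_upwards [hhH, hrt.eventually hhH] with x' h1 h2
  have hd : ∀ θ ∈ Set.uIcc (0 : ℝ) 1,
      HasDerivAt (fun θ => H (γ (x', θ))) ((u x' - c : ℝ) * ψ (x', θ)) θ := by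
    intro θ _
    have hγ' : HasDerivAt (fun θ : ℝ => γ (x', θ)) ((u x' - c) • b) θ := by
      have := ((hasDerivAt_id θ).smul_const ((u x' - c) • b)).const_add (x' - (u x' - c) • b)
      rw [one_smul] at this
      exact this
    have hHd := (hH.differentiable (by simp)).differentiableAt (x := γ (x', θ))
    have h3 := hHd.hasFDerivAt.comp_hasDerivAt θ hγ'
    rw [map_smul, Complex.real_smul] at h3
    exact h3
  have hcont : Continuous fun θ => ((u x' - c : ℝ) : ℂ) * ψ (x', θ) :=
    continuous_const.mul (hψ.continuous.comp (by fun_prop))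
  have := intervalIntegral.integral_eq_sub_of_hasDerivAt hd (hcont.intervalIntegrable 0 1)
  rw [intervalIntegral.integral_const_mul] at this
  rw [h1, h2, this]
  simp [γ]

/-- The function `(1 - exp (2πi(u - c))) / (u - c)` is smooth and invertible near `u = c`. -/
theorem exists_one_sub_exp_eq {x : V} (u : StrongDual ℝ V) (n : ℤ) (hc : u x = n) :
    ∃ w : V → ℂ, (∀ᶠ x' in 𝓝 x, ContDiffAt ℝ ∞ w x') ∧ ∀ᶠ x' in 𝓝 x,
      (u x' - n : ℝ) = (1 - Complex.exp (2 * Real.pi * Complex.I * (u x' : ℝ))) * w x' := by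
  -- F has a simple zero at 0, so `dslope F 0`, which is F(z)/z continued across 0, is analytic and
  -- non-zero near 0. Periodicity of exp moves the zero at u = n to 0.
  let F : ℂ → ℂ := fun z => 1 - Complex.exp (2 * Real.pi * Complex.I * z)
  have hF : AnalyticAt ℂ F 0 := by fun_prop
  have hF0 : F 0 = 0 := by simp [F]
  have hd : deriv F 0 = -(2 * Real.pi * Complex.I) := by
    have : HasDerivAt F (-(Complex.exp (2 * Real.pi * Complex.I * 0) *
        (2 * Real.pi * Complex.I * 1))) 0 :=
      (((hasDerivAt_id (0 : ℂ)).const_mul (2 * Real.pi * Complex.I)).cexp).const_sub 1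
    rw [this.deriv]
    simp
  obtain ⟨p, hp⟩ := hF
  have hG : AnalyticAt ℂ (dslope F 0) 0 := hp.has_fpower_series_dslope_fslope.analyticAt
  have hG0 : dslope F 0 0 ≠ 0 := by
    rw [dslope_same, hd]
    simp [Real.pi_ne_zero]
  let ι : V → ℂ := fun x' => ((u x' - n : ℝ) : ℂ)
  have hι : ContDiff ℝ ∞ ι := by
    exact Complex.ofRealCLM.contDiff.comp (u.contDiff.sub contDiff_const)
  have hι0 : ι x = 0 := by simp [ι, hc]
  have hιt : Filter.Tendsto ι (𝓝 x) (𝓝 0) := by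
    rw [← hι0]; exact hι.continuous.tendsto x
  refine ⟨fun x' => (dslope F 0 (ι x'))⁻¹, ?_, ?_⟩
  · filter_upwards [hιt.eventually hG.eventually_analyticAt,
      hιt.eventually (hG.continuousAt.eventually_ne hG0)] with x' h1 h2
    exact ((h1.contDiffAt.restrict_scalars ℝ).comp x' hι.contDiffAt).inv h2
  · filter_upwards [hιt.eventually (hG.continuousAt.eventually_ne hG0)] with x' h2
    have h3 : F (ι x') = ι x' * dslope F 0 (ι x') := by
      have := sub_smul_dslope F 0 (ι x')
      rw [hF0, sub_zero, sub_zero, smul_eq_mul] at this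
      exact this.symm
    have h4 : 1 - Complex.exp (2 * Real.pi * Complex.I * (u x' : ℝ)) = F (ι x') := by
      simp only [F, ι]
      congr 1
      rw [Complex.exp_eq_exp_iff_exists_int]
      exact ⟨n, by push_cast; ring⟩
    rw [h4, h3, mul_inv_cancel_right₀ h2]

end Analysis


/-! ### The torus: smooth functions along the loci of integral coordinates. -/

section Base

variable {V : Type} [NormedAddCommGroup V] [NormedSpace ℝ V] {Λ : Submodule ℤ V}

/-- A basis of the lattice `Λ` and the dual basis, extended by zero to all indices. -/
structure LatticeFrame (Λ : Submodule ℤ V) (g : ℕ) where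
  u : ℕ → StrongDual ℝ V
  b : ℕ → V
  integral : ∀ k, ∀ l ∈ Λ, ∃ n : ℤ, u k l = n
  u_b : ∀ k < g, ∀ j, u j (b k) = if j = k then 1 else 0
  b_mem : ∀ k, b k ∈ Λ
  expand : ∀ x, x = ∑ k ∈ Finset.range g, u k x • b k

theorem exists_latticeFrame [FiniteDimensional ℝ V] (Λ : Submodule ℤ V) [DiscreteTopology Λ]
    [IsZLattice ℝ Λ] : Nonempty (LatticeFrame Λ (Module.finrank ℝ V)) := by
  classical
  have : Module.Finite ℤ Λ := ZLattice.module_finite ℝ Λ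
  have : Module.Free ℤ Λ := ZLattice.module_free ℝ Λ
  let β := Module.finBasisOfFinrankEq ℤ Λ (ZLattice.rank ℝ Λ)
  let B := β.ofZLatticeBasis ℝ Λ
  let g := Module.finrank ℝ V
  have hB : ∀ i, B i = β i := fun i => β.ofZLatticeBasis_apply ℝ Λ i
  refine ⟨⟨fun k => if h : k < g then LinearMap.toContinuousLinearMap (B.coord ⟨k, h⟩) else 0,
    fun k => if h : k < g then B ⟨k, h⟩ else 0, ?_, ?_, ?_, ?_⟩⟩
  · intro k l hl
    by_cases h : k < g
    · refine ⟨β.repr ⟨l, hl⟩ ⟨k, h⟩, ?_⟩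
      simp only [h, dite_true]
      exact β.ofZLatticeBasis_repr_apply ℝ Λ ⟨l, hl⟩ ⟨k, h⟩
    · exact ⟨0, by simp [h]⟩
  · intro k hk j
    have hk' : k < g := hk
    by_cases h : j < g
    · simp only [h, hk', dite_true]
      change B.repr (B ⟨k, hk⟩) ⟨j, h⟩ = _
      rw [B.repr_self, Finsupp.single_apply]
      simp [Fin.ext_iff, eq_comm]
    · have : j ≠ k := by rintro rfl; exact h hk
      simp [h, this]
  · intro k
    by_cases h : k < g
    · simp only [h, dite_true, hB]
      exact (β ⟨k, h⟩).2
    · simp [h]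
  · intro x
    rw [← Fin.sum_univ_eq_sum_range (fun k => (if h : k < g then
      LinearMap.toContinuousLinearMap (B.coord ⟨k, h⟩) else 0 : StrongDual ℝ V) x •
        (if h : k < g then B ⟨k, h⟩ else 0))]
    conv_lhs => rw [← B.sum_repr x]
    refine Finset.sum_congr rfl fun i _ => ?_
    simp [g]

/-- The covering `V → V / Λ`. -/
def torusMk (Λ : Submodule ℤ V) (x : V) : Torus Λ := Submodule.Quotient.mk x

theorem continuous_torusMk : Continuous (torusMk Λ) := continuous_quot_mk

theorem isOpenMap_torusMk : IsOpenMap (torusMk Λ) :=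
  QuotientAddGroup.isOpenMap_coe (N := Λ.toAddSubgroup)

theorem torusMk_surjective : Function.Surjective (torusMk Λ) := Submodule.Quotient.mk_surjective Λ

theorem torusMk_eq_iff {x y : V} : torusMk Λ x = torusMk Λ y ↔ x - y ∈ Λ :=
  Submodule.Quotient.eq Λ

theorem eventually_torusMk {x : V} {R : Torus Λ → Prop} :
    (∀ᶠ t in 𝓝 (torusMk Λ x), R t) ↔ ∀ᶠ x' in 𝓝 x, R (torusMk Λ x') :=
  ⟨fun h => (continuous_torusMk.tendsto x).eventually h, fun h => isOpenMap_torusMk.nhds_le x h⟩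

/-- The functions on the torus that near `x` are a smooth function restricted to `A` and extended
by zero. -/
def SmoothAt (A : Set (Torus Λ)) (f : Torus Λ → ℂ) (x : V) : Prop :=
  ∃ h : V → ℂ, (∀ᶠ x' in 𝓝 x, ContDiffAt ℝ ∞ h x') ∧
    ∀ᶠ x' in 𝓝 x, f (torusMk Λ x') = A.indicator 1 (torusMk Λ x') * h x'

theorem SmoothAt.of_torusMk_eq {A : Set (Torus Λ)} {f : Torus Λ → ℂ} {x y : V}
    (hf : SmoothAt A f x) (hxy : torusMk Λ x = torusMk Λ y) : SmoothAt A f y := by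
  obtain ⟨h, hh, hf⟩ := hf
  have hc : ContDiff ℝ ∞ fun v : V => v + (x - y) := contDiff_id.add contDiff_const
  have ht := hc.continuous.tendsto y
  rw [add_sub_cancel] at ht
  refine ⟨fun v => h (v + (x - y)), ?_, ?_⟩
  · filter_upwards [ht.eventually hh] with v hv
    exact ContDiffAt.comp v hv hc.contDiffAt
  · filter_upwards [ht.eventually hf] with v hv
    have : torusMk Λ (v + (x - y)) = torusMk Λ v :=
      torusMk_eq_iff.2 (by simpa using torusMk_eq_iff.1 hxy)
    rwa [this] at hv

/-- The local condition of being smooth along `A` and zero elsewhere. -/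
def smoothOn (A : Set (Torus Λ)) : FunPred (Torus Λ) (id : Torus Λ → Torus Λ) where
  S t :=
    { carrier := {f | ∀ x, torusMk Λ x = t → SmoothAt A f x}
      add_mem' := by
        intro f g hf hg x hx
        obtain ⟨h, hh, hf⟩ := hf x hx
        obtain ⟨h', hh', hg⟩ := hg x hx
        refine ⟨h + h', ?_, ?_⟩
        · filter_upwards [hh, hh'] with x' h1 h2
          exact h1.add h2
        · filter_upwards [hf, hg] with p' h1 h2
          simp [mul_add, h1, h2]
      zero_mem' := fun p _ => ⟨0, Filter.Eventually.of_forall fun _ => contDiffAt_const, by simp⟩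
      smul_mem' := by
        intro c f hf x hx
        obtain ⟨h, hh, hf⟩ := hf x hx
        refine ⟨c • h, ?_, ?_⟩
        · filter_upwards [hh] with x' h1
          exact contDiffAt_const.smul h1
        filter_upwards [hf] with p' h1
        simp only [Pi.smul_apply, smul_eq_mul, h1]
        ring }
  local' := by
    rintro t f f' hff hf x rfl
    obtain ⟨h, hh, hf⟩ := hf x rfl
    refine ⟨h, hh, ?_⟩
    filter_upwards [hf, eventually_torusMk.1 hff] with x' h1 h2
    rw [← h1, show f (torusMk Λ x') = f' (torusMk Λ x') from h2 _ rfl]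
  open' := by
    intro t f hf
    obtain ⟨x, rfl⟩ := torusMk_surjective t
    rw [eventually_torusMk]
    obtain ⟨h, hh, hf⟩ := hf x rfl
    filter_upwards [hh.eventually_nhds, hf.eventually_nhds] with x' h1 h2 x'' hx
    exact SmoothAt.of_torusMk_eq ⟨h, h1, h2⟩ hx.symm

theorem mem_smoothOn {A : Set (Torus Λ)} {f : Torus Λ → ℂ} {x : V} :
    f ∈ (smoothOn A).S (torusMk Λ x) ↔ SmoothAt A f x :=
  ⟨fun h => h x rfl, fun h _ hx => h.of_torusMk_eq hx.symm⟩

/-- V → V/Λ is injective on a ball smaller than half the shortest non-zero lattice vector. The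
section need only invert it near x; its values elsewhere are irrelevant. -/
theorem exists_local_section [DiscreteTopology Λ] (x : V) :
    ∃ s : Torus Λ → V, ∀ᶠ x' in 𝓝 x, s (torusMk Λ x') = x' := by
  classical
  have hd : ∃ r > 0, ∀ l ∈ Λ, ‖l‖ < r → l = 0 := by
    obtain ⟨r, hr, h⟩ := Metric.exists_ball_inter_eq_singleton_of_mem_discrete
      (s := (Λ : Set V)) (isDiscrete_iff_discreteTopology.2 ‹_›) (zero_mem Λ)
    refine ⟨r, hr, fun l hl hlr => ?_⟩
    have : l ∈ Metric.ball (0 : V) r ∩ Λ := ⟨by simpa using hlr, hl⟩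
    rwa [h] at this
  obtain ⟨r, hr, h⟩ := hd
  let s : Torus Λ → V := fun t =>
    if ht : ∃ y ∈ Metric.ball x (r / 2), torusMk Λ y = t then ht.choose else x
  refine ⟨s, ?_⟩
  filter_upwards [Metric.ball_mem_nhds x (half_pos hr)] with x' hx'
  have ht : ∃ y ∈ Metric.ball x (r / 2), torusMk Λ y = torusMk Λ x' := ⟨x', hx', rfl⟩
  have hs : s (torusMk Λ x') = ht.choose := dif_pos ht
  rw [hs, ← sub_eq_zero]
  refine h _ (torusMk_eq_iff.1 ht.choose_spec.2) ?_
  rw [← dist_eq_norm]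
  have h1 := ht.choose_spec.1
  rw [Metric.mem_ball] at h1 hx'
  linarith [dist_triangle_right ht.choose x' x]

theorem exists_mem_smoothOn [DiscreteTopology Λ] (A : Set (Torus Λ)) {h : V → ℂ} {x : V}
    (hh : ∀ᶠ x' in 𝓝 x, ContDiffAt ℝ ∞ h x') : ∃ f ∈ (smoothOn A).S (torusMk Λ x),
      ∀ᶠ x' in 𝓝 x, f (torusMk Λ x') = A.indicator 1 (torusMk Λ x') * h x' := by
  obtain ⟨s, hs⟩ := exists_local_section (Λ := Λ) x
  have : ∀ᶠ x' in 𝓝 x, (fun t => A.indicator 1 t * h (s t)) (torusMk Λ x') =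
      A.indicator 1 (torusMk Λ x') * h x' := by
    filter_upwards [hs] with x' hx'
    simp only [hx']
  exact ⟨fun t => A.indicator 1 t * h (s t), mem_smoothOn.2 ⟨h, hh, this⟩, this⟩

variable {g : ℕ} (B : LatticeFrame Λ g)

namespace LatticeFrame

/-- The character `exp (2πi x_k)` of the torus. -/
def e (k : ℕ) (t : Torus Λ) : ℂ :=
  Complex.exp (2 * Real.pi * Complex.I * (B.u k (Function.surjInv torusMk_surjective t) : ℝ))

theorem e_torusMk (k : ℕ) (x : V) :
    B.e k (torusMk Λ x) = Complex.exp (2 * Real.pi * Complex.I * (B.u k x : ℝ)) := by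
  have h := Function.surjInv_eq (torusMk_surjective (Λ := Λ)) (torusMk Λ x)
  obtain ⟨n, hn⟩ := B.integral k _ (torusMk_eq_iff.1 h)
  rw [e, Complex.exp_eq_exp_iff_exists_int]
  refine ⟨n, ?_⟩
  rw [map_sub, sub_eq_iff_eq_add] at hn
  rw [hn]
  push_cast
  ring

theorem e_eq_one_iff (k : ℕ) (x : V) : B.e k (torusMk Λ x) = 1 ↔ ∃ n : ℤ, B.u k x = n := by
  rw [e_torusMk, Complex.exp_eq_one_iff]
  refine exists_congr fun n => ?_
  have h : (2 * Real.pi * Complex.I : ℂ) ≠ 0 := Complex.two_pi_I_ne_zero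
  rw [mul_comm (n : ℂ), mul_right_inj' h]
  exact_mod_cast Iff.rfl

theorem contDiff_exp (k : ℕ) :
    ContDiff ℝ ∞ fun x => Complex.exp (2 * Real.pi * Complex.I * (B.u k x : ℝ)) :=
  (contDiff_const.mul (Complex.ofRealCLM.contDiff.comp (B.u k).contDiff)).cexp

theorem mul_mem_smoothOn {A : Set (Torus Λ)} {a : Torus Λ → ℂ}
    (ha : ContDiff ℝ ∞ fun x => a (torusMk Λ x)) {t : Torus Λ} {f : Torus Λ → ℂ}
    (hf : f ∈ (smoothOn A).S t) : (fun t => a t * f t) ∈ (smoothOn A).S t := by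
  rintro x rfl
  obtain ⟨h, hh, hf⟩ := hf x rfl
  refine ⟨fun x => a (torusMk Λ x) * h x, ?_, ?_⟩
  · filter_upwards [hh] with x' h1
    exact ha.contDiffAt.mul h1
  · filter_upwards [hf] with x' h1
    simp only [h1]
    ring

theorem contDiff_e (k : ℕ) : ContDiff ℝ ∞ fun x => B.e k (torusMk Λ x) := by
  simp only [e_torusMk]
  exact B.contDiff_exp k

theorem e_ne_zero (k : ℕ) (t : Torus Λ) : B.e k t ≠ 0 := Complex.exp_ne_zero _

theorem isMultiplier (A : Set (Torus Λ)) (k : ℕ) : IsMultiplier (smoothOn A) (B.e k) where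
  ne_zero := B.e_ne_zero k
  mul_mem hf := mul_mem_smoothOn (B.contDiff_e k) hf
  inv_mul_mem hf := mul_mem_smoothOn (a := fun t => (B.e k t)⁻¹)
    ((B.contDiff_e k).inv fun _ => B.e_ne_zero k _) hf

open Classical in
/-- Multiplication by `1 - e_k` on functions smooth along `A` has the functions smooth along
`A ∩ {e_k = 1}` as cokernel. -/
theorem isTriple [FiniteDimensional ℝ V] [DiscreteTopology Λ] {k : ℕ} (hk : k < g)
    {A A' : Set (Torus Λ)} (hA : ∀ (x : V) (r : ℝ), torusMk Λ x ∈ A → torusMk Λ (x + r • B.b k) ∈ A)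
    (hA' : A' = A ∩ {t | B.e k t = 1}) :
    IsTriple (smoothOn A) (smoothOn A') (fun t => 1 - B.e k t)
      ({t | B.e k t = 1}.indicator 1) where
  mul_mem hf := mul_mem_smoothOn (contDiff_const.sub (B.contDiff_e k)) hf
  res_mem := by
    rintro t f hf x rfl
    obtain ⟨h, hh, hf⟩ := hf x rfl
    refine ⟨h, hh, ?_⟩
    filter_upwards [hf] with x' h1
    rw [h1, hA', ← mul_assoc, Set.inter_comm, Set.inter_indicator_one]
    rfl
  res_mul t := by
    by_cases h : B.e k t = 1
    · simp [h]
    · rw [Set.indicator_of_notMem (by exact h), zero_mul]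
  inj := by
    intro t f hf h0
    obtain ⟨x, rfl⟩ := torusMk_surjective t
    obtain ⟨h, hh, hf⟩ := hf x rfl
    rw [eventually_torusMk] at h0
    by_cases hx : torusMk Λ x ∈ A
    · have hc : Continuous fun r : ℝ => x + r • B.b k := by fun_prop
      have ht := hc.tendsto 0
      rw [zero_smul, add_zero] at ht
      -- Moving a little from x in the direction of `B.b k` stays in A and makes the k-th coordinate
      -- non-integral, so 1 - e_k is invertible there. The smooth representative vanishes at these
      -- points, hence at x by continuity.
      have hu : ∀ᶠ r in 𝓝[>] (0 : ℝ), ∀ n : ℤ, B.u k x + r ≠ n := by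
        have h1 : (B.u k x : ℝ) < ⌊B.u k x⌋ + 1 := Int.lt_floor_add_one _
        filter_upwards [Ioo_mem_nhdsGT (show (0 : ℝ) < ⌊B.u k x⌋ + 1 - B.u k x by linarith)]
          with r hr n hn
        have h2 := Int.floor_le (B.u k x)
        have h3 : ((⌊B.u k x⌋ : ℤ) : ℝ) < n := by linarith [hr.1]
        have h4 : (n : ℝ) < (⌊B.u k x⌋ + 1 : ℤ) := by push_cast; linarith [hr.2]
        have h3' : ⌊B.u k x⌋ < n := by exact_mod_cast h3
        have h4' : n < ⌊B.u k x⌋ + 1 := by exact_mod_cast h4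
        omega
      have hz : ∀ᶠ r in 𝓝[>] (0 : ℝ), h (x + r • B.b k) = 0 := by
        filter_upwards [hu, (ht.mono_left nhdsWithin_le_nhds).eventually h0,
          (ht.mono_left nhdsWithin_le_nhds).eventually hf] with r h1 h2 h3
        rw [Set.indicator_of_mem (hA x r hx), Pi.one_apply, one_mul] at h3
        rw [← h3]
        refine (mul_eq_zero.1 h2).resolve_left fun h4 => ?_
        obtain ⟨n, hn⟩ := (B.e_eq_one_iff k _).1 (sub_eq_zero.1 h4).symm
        rw [map_add, map_smul, B.u_b k hk, if_pos rfl, smul_eq_mul, mul_one] at hn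
        exact h1 n hn
      have hlim : Filter.Tendsto (fun r => h (x + r • B.b k)) (𝓝[>] (0 : ℝ)) (𝓝 (h x)) :=
        hh.self_of_nhds.continuousAt.tendsto.comp (ht.mono_left nhdsWithin_le_nhds)
      have h5 : h x = 0 := tendsto_nhds_unique hlim
        ((Filter.tendsto_congr' hz).2 tendsto_const_nhds)
      rw [hf.self_of_nhds, h5, mul_zero]
    · rw [hf.self_of_nhds, Set.indicator_of_notMem hx, zero_mul]
  exact := by
    intro t f hf h0
    obtain ⟨x, rfl⟩ := torusMk_surjective t
    obtain ⟨h, hh, hf⟩ := hf x rfl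
    rw [eventually_torusMk] at h0
    by_cases hx : B.e k (torusMk Λ x) = 1
    · obtain ⟨n, hn⟩ := (B.e_eq_one_iff k x).1 hx
      -- On A the projection along `B.b k` to x_k = n lands in A ∩ {e_k = 1}, where h vanishes.
      -- Hence h = (x_k - n) q = (1 - e_k) w q, and w q is the required quotient.
      obtain ⟨q, hq, hqe⟩ := exists_hadamard_quotient hh (B.u k) (B.b k) n hn
      obtain ⟨w, hw, hwe⟩ := exists_one_sub_exp_eq (B.u k) n hn
      obtain ⟨f', hf', hfe⟩ := exists_mem_smoothOn A (h := fun x => w x * q x)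
        (hw.mono fun x' h1 => h1.mul hq.contDiffAt)
      refine ⟨f', hf', ?_⟩
      rw [eventually_torusMk]
      have hr : Continuous fun x' : V => x' - (B.u k x' - n) • B.b k := by fun_prop
      have hrt := hr.tendsto x
      rw [hn, sub_self, zero_smul, sub_zero] at hrt
      filter_upwards [hf, hqe, hwe, hfe, hrt.eventually h0, hrt.eventually hf]
        with x' h1 h2 h3 h4 h5 h6
      rw [h1, h4]
      by_cases hxA : torusMk Λ x' ∈ A
      · have hrA := hA x' (-(B.u k x' - n)) hxA
        rw [neg_smul, ← sub_eq_add_neg] at hrA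
        have hr1 : B.e k (torusMk Λ (x' - (B.u k x' - n) • B.b k)) = 1 := by
          rw [e_eq_one_iff]
          refine ⟨n, ?_⟩
          rw [map_sub, map_smul, B.u_b k hk, if_pos rfl]
          simp
        rw [Set.indicator_of_mem (by exact hr1), Pi.one_apply, one_mul, h6,
          Set.indicator_of_mem hrA, Pi.one_apply, one_mul] at h5
        rw [h5, sub_zero, h3] at h2
        rw [Set.indicator_of_mem hxA, Pi.one_apply, one_mul, one_mul, e_torusMk, h2]
        ring
      · simp [Set.indicator_of_notMem hxA]
    · have hne : ∀ᶠ x' in 𝓝 x, 1 - B.e k (torusMk Λ x') ≠ 0 := by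
        have hc := contDiff_const (c := (1 : ℂ)) |>.sub (B.contDiff_e k)
        refine hc.continuous.continuousAt.eventually_ne ?_
        exact fun h => hx (sub_eq_zero.1 h).symm
      obtain ⟨f', hf', hfe⟩ := exists_mem_smoothOn A
        (h := fun x => (1 - B.e k (torusMk Λ x))⁻¹ * h x) (x := x) (by
        filter_upwards [hh, hne] with x' h1 h2
        exact (((contDiff_const.sub (B.contDiff_e k)).contDiffAt).inv h2).mul h1)
      refine ⟨f', hf', ?_⟩
      rw [eventually_torusMk]
      filter_upwards [hf, hfe, hne] with x' h1 h2 h3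
      rw [h1, h2, mul_left_comm, mul_inv_cancel_left₀ h3]
  surj := by
    intro t f hf
    obtain ⟨x, rfl⟩ := torusMk_surjective t
    obtain ⟨h, hh, hf⟩ := hf x rfl
    -- The smooth function representing the germ on the smaller set also defines a germ on A.
    obtain ⟨f', hf', hfe⟩ := exists_mem_smoothOn A hh
    refine ⟨f', hf', ?_⟩
    rw [eventually_torusMk]
    filter_upwards [hf, hfe] with x' h1 h2
    rw [h1, h2, hA', ← mul_assoc, Set.inter_comm, Set.inter_indicator_one]
    rfl

/-- The points of the torus whose coordinates `x_j`, `k ≤ j < g`, are integral. -/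
def stratum (k : ℕ) : Set (Torus Λ) := {t | ∀ j, k ≤ j → j < g → B.e j t = 1}

theorem stratum_eq_inter {k : ℕ} (hk : k < g) :
    B.stratum k = B.stratum (k + 1) ∩ {t | B.e k t = 1} := by
  ext t
  constructor
  · exact fun h => ⟨fun j hj hj' => h j (by omega) hj', h k le_rfl hk⟩
  · rintro ⟨h, h'⟩ j hj hj'
    rcases hj.eq_or_lt with rfl | hlt
    · exact h'
    · exact h j hlt hj'

theorem add_mem_stratum {k : ℕ} (hk : k < g) (x : V) (r : ℝ)
    (hx : torusMk Λ x ∈ B.stratum (k + 1)) : torusMk Λ (x + r • B.b k) ∈ B.stratum (k + 1) := by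
  intro j hj hj'
  have h := hx j hj hj'
  rw [e_torusMk] at h ⊢
  rwa [map_add, map_smul, B.u_b k hk, if_neg (by omega), smul_zero, add_zero]

theorem stratum_self : B.stratum g = Set.univ :=
  Set.eq_univ_of_forall fun _ _ h h' => absurd h' (not_lt.2 h)

/-- A vector with integral coordinates in a lattice basis lies in Λ. -/
theorem stratum_zero : B.stratum 0 = {torusMk Λ 0} := by
  ext t
  obtain ⟨x, rfl⟩ := torusMk_surjective t
  constructor
  · intro h
    rw [Set.mem_singleton_iff, torusMk_eq_iff, sub_zero, B.expand x]
    refine sum_mem fun k hk => ?_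
    obtain ⟨n, hn⟩ := (B.e_eq_one_iff k x).1 (h k (Nat.zero_le _) (Finset.mem_range.1 hk))
    rw [hn, Int.cast_smul_eq_zsmul]
    exact Submodule.smul_mem _ _ (B.b_mem k)
  · intro h j _ _
    rw [Set.mem_singleton_iff] at h
    rw [h, e_eq_one_iff]
    exact ⟨0, by simp⟩

theorem isTriple_stratum [FiniteDimensional ℝ V] [DiscreteTopology Λ] {k : ℕ} (hk : k < g) :
    IsTriple (smoothOn (B.stratum (k + 1))) (smoothOn (B.stratum k)) (fun t => 1 - B.e k t)
      ({t | B.e k t = 1}.indicator 1) :=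
  B.isTriple hk (B.add_mem_stratum hk) (B.stratum_eq_inter hk)

end LatticeFrame

end Base


/-! ### Iterating over the circles. -/

section Tower

open Limits

variable {V : Type} [NormedAddCommGroup V] [NormedSpace ℝ V] {Λ : Submodule ℤ V}

/-- The product of the torus and `k` circles. -/
def tower (Λ : Submodule ℤ V) : ℕ → TopCat.{0}
  | 0 => Torus Λ
  | k + 1 => prodCirc (tower Λ k)

/-- The projection to the torus. -/
def towerMap (Λ : Submodule ℤ V) : ∀ k, tower Λ k ⟶ Torus Λ
  | 0 => 𝟙 _
  | k + 1 => prodFst (tower Λ k) ≫ towerMap Λ k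

theorem t2Space_tower [T2Space (Torus Λ)] : ∀ k, T2Space (tower Λ k)
  | 0 => inferInstanceAs (T2Space (Torus Λ))
  | k + 1 =>
    have := t2Space_tower k
    inferInstanceAs (T2Space (tower Λ k × Circ))

namespace LatticeFrame

variable {g : ℕ} (B : LatticeFrame Λ g)

/-- The iterated twist of the functions smooth along `A`. -/
def towerData (A : Set (Torus Λ)) : ∀ k, {N : FunPred (tower Λ k) (id : tower Λ k → tower Λ k) //
    ∀ j, IsMultiplier N (fun x => B.e j (towerMap Λ k x))}
  | 0 => ⟨smoothOn A, B.isMultiplier A⟩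
  | k + 1 => ⟨twist (towerData A k).1 ((towerData A k).2 k),
      fun j => IsMultiplier.twist ((towerData A k).2 k) ((towerData A k).2 j)⟩

/-- The local condition of `towerData`. -/
def towerCond (A : Set (Torus Λ)) (k : ℕ) : FunPred (tower Λ k) (id : tower Λ k → tower Λ k) :=
  (B.towerData A k).1

theorem towerCond_isMultiplier (A : Set (Torus Λ)) (k j : ℕ) :
    IsMultiplier (B.towerCond A k) (fun x => B.e j (towerMap Λ k x)) := (B.towerData A k).2 j

theorem isTriple_tower [FiniteDimensional ℝ V] [DiscreteTopology Λ] {j : ℕ} (hj : j < g) (k : ℕ) :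
    IsTriple (B.towerCond (B.stratum (j + 1)) k) (B.towerCond (B.stratum j) k)
      (fun x => 1 - B.e j (towerMap Λ k x))
      (fun x => {t | B.e j t = 1}.indicator 1 (towerMap Λ k x)) := by
  induction k with
  | zero => exact B.isTriple_stratum hj
  | succ k ih => exact ih.twist (B.towerCond_isMultiplier _ k k) (B.towerCond_isMultiplier _ k k)

end LatticeFrame

variable {E : Type*} [Category E]

/-- The pushforward to the torus followed by `Q`. -/
def towerFun (Q : Sh (Torus Λ) ⥤ E) : ∀ k, Sh (tower Λ k) ⥤ E
  | 0 => Q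
  | k + 1 => TopCat.Sheaf.pushforward (ModuleCat.{0} ℂ) (prodFst (tower Λ k)) ⋙ towerFun Q k

/-- `towerFun` is a pushforward followed by `Q`. -/
def towerFunIso (Q : Sh (Torus Λ) ⥤ E) : ∀ k,
    towerFun Q k ≅ TopCat.Sheaf.pushforward (ModuleCat.{0} ℂ) (towerMap Λ k) ⋙ Q
  | 0 => Q.leftUnitor.symm ≪≫ Functor.isoWhiskerRight (Iso.refl _) Q
  | k + 1 => Functor.isoWhiskerLeft _ (towerFunIso Q k) ≪≫ (Functor.associator _ _ _).symm ≪≫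
      Functor.isoWhiskerRight (Iso.refl _) Q

variable [Abelian E] (Q : Sh (Torus Λ) ⥤ E) [Q.Additive] [PreservesFiniteLimits Q]

instance towerFun_additive : ∀ k, (towerFun Q k).Additive
  | 0 => inferInstanceAs Q.Additive
  | k + 1 =>
    have := towerFun_additive k
    inferInstanceAs (TopCat.Sheaf.pushforward (ModuleCat.{0} ℂ) (prodFst (tower Λ k)) ⋙
      towerFun Q k).Additive

instance towerFun_preservesFiniteLimits : ∀ k, PreservesFiniteLimits (towerFun Q k)
  | 0 => inferInstanceAs (PreservesFiniteLimits Q)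
  | k + 1 =>
    have := towerFun_preservesFiniteLimits k
    inferInstanceAs (PreservesFiniteLimits
      (TopCat.Sheaf.pushforward (ModuleCat.{0} ℂ) (prodFst (tower Λ k)) ⋙ towerFun Q k))

/-- The derived functors of the pushforward to the torus at the iterated twist. -/
theorem rightDerived_towerFun [FiniteDimensional ℝ V] [DiscreteTopology Λ] [T2Space (Torus Λ)]
    {g : ℕ} (B : LatticeFrame Λ g) (k : ℕ) (hk : k ≤ g) :
    (∀ j < k, IsZero (((towerFun Q k).rightDerived j).obj (B.towerCond (B.stratum k) k).sheaf)) ∧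
      Nonempty (((towerFun Q k).rightDerived k).obj (B.towerCond (B.stratum k) k).sheaf ≅
        Q.obj (smoothOn (B.stratum 0)).sheaf) := by
  induction k with
  | zero => exact ⟨fun j hj => absurd hj (Nat.not_lt_zero j), ⟨Q.rightDerivedZeroIsoSelf.app _⟩⟩
  | succ k ih =>
    obtain ⟨h0, h1⟩ := ih (by omega)
    have := t2Space_tower (Λ := Λ) k
    -- Pushing forward along the last circle lowers the degree by one and replaces `stratum (k + 1)`
    -- by `stratum k`, which adds the condition x_k ∈ ℤ.
    obtain ⟨hz, hs⟩ := rightDerived_twist (towerFun Q k) (B.towerCond_isMultiplier _ k k)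
      (B.isTriple_tower (j := k) (by omega) k)
    refine ⟨fun j hj => ?_, ⟨(hs k).some ≪≫ h1.some⟩⟩
    cases j with
    | zero => exact hz
    | succ j => exact (h0 j (by omega)).of_iso (hs j).some

end Tower

/-! ### Invariance of derived functors under natural isomorphisms and homeomorphisms. -/

section Derived

open Limits

theorem rightDerived_congr {C D : Type*} [Category C] [Category D] [Abelian C]
    [HasInjectiveResolutions C] [Abelian D] {F G : C ⥤ D} [F.Additive] [G.Additive] (α : F ≅ G)
    (n : ℕ) (A : C) : Nonempty ((F.rightDerived n).obj A ≅ (G.rightDerived n).obj A) :=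
  ⟨{ hom := (NatTrans.rightDerived α.hom n).app A
     inv := (NatTrans.rightDerived α.inv n).app A
     hom_inv_id := by
      rw [← NatTrans.comp_app, ← NatTrans.rightDerived_comp, α.hom_inv_id,
        NatTrans.rightDerived_id]
      rfl
     inv_hom_id := by
      rw [← NatTrans.comp_app, ← NatTrans.rightDerived_comp, α.inv_hom_id,
        NatTrans.rightDerived_id]
      rfl }⟩

theorem epi_pushforward_of_iso {X Y : TopCat.{0}} (f : X ≅ Y) {F G : Sh X} (φ : F ⟶ G) [Epi φ] :
    Epi ((TopCat.Sheaf.pushforward (ModuleCat.{0} ℂ) f.hom).map φ) := by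
  rw [epi_iff_sec]
  intro U t y hy
  have hy' : f.hom (f.inv y) = y := by simp
  obtain ⟨W, hW, hxW, s, hs⟩ := (epi_iff_sec φ).1 inferInstance ((Opens.map f.hom).obj U) t
    (f.inv y) (by change f.hom (f.inv y) ∈ U; rw [hy']; exact hy)
  let W' : Opens Y := (Opens.map f.inv).obj W
  have hle : (Opens.map f.hom).obj W' ≤ W := by
    intro x hx
    have hx' : f.inv (f.hom x) ∈ W := hx
    simpa using hx'
  have hW' : W' ≤ U := by
    intro z hz
    have h1 : f.hom (f.inv z) ∈ U := hW hz
    simpa using h1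
  refine ⟨W', hW', hxW, res F hle s, ?_⟩
  exact (secMap_res φ hle s).trans ((congrArg _ hs).trans (res_res G hW hle t))

/-- Derived functors are transported along homeomorphisms. -/
theorem rightDerived_pushforward_iso {X Y : TopCat.{0}} (f : X ≅ Y) {E : Type*} [Category E]
    [Abelian E] (Q : Sh Y ⥤ E) [Q.Additive] [PreservesFiniteLimits Q] (n : ℕ) (F : Sh X) :
    Nonempty (((TopCat.Sheaf.pushforward (ModuleCat.{0} ℂ) f.hom ⋙ Q).rightDerived n).obj F ≅
      (Q.rightDerived n).obj ((TopCat.Sheaf.pushforward (ModuleCat.{0} ℂ) f.hom).obj F)) :=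
  rightDerived_comp_of_adapted _ Q (fun I hI => injective_pushforward _ I hI) (fun _ => True)
    (fun S hS _ _ => ⟨have := hS.epi_g; epi_pushforward_of_iso f S.g, trivial⟩) n F trivial

end Derived


/-! ### The homeomorphism of T × T̂ with T × (ℝ/ℤ)^g. -/

section Coordinates

open Limits

variable {V : Type} [NormedAddCommGroup V] [NormedSpace ℝ V] {Λ : Submodule ℤ V}

/-- Taking fractional parts of coordinates shows that a compact cube maps onto the quotient.
Compactness then turns the continuous bijection of `coordIso` into a homeomorphism. -/
theorem compactSpace_quotient {W : Type} [NormedAddCommGroup W] [NormedSpace ℝ W]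
    (L : Submodule ℤ W) {g : ℕ} (w : ℕ → W) (hw : ∀ k, w k ∈ L) (c : W → ℕ → ℝ)
    (hc : ∀ x, x = ∑ k ∈ Finset.range g, c x k • w k) : CompactSpace (W ⧸ L) := by
  let F : (ℕ → ℝ) → W ⧸ L := fun y =>
    Submodule.Quotient.mk (∑ k ∈ Finset.range g, y k • w k)
  have hF : Continuous F := by
    have h1 : Continuous fun y : ℕ → ℝ => ∑ k ∈ Finset.range g, y k • w k := by fun_prop
    exact (continuous_quot_mk : Continuous (Quot.mk _ : W → W ⧸ L)).comp h1
  have hK : IsCompact (Set.univ.pi fun _ : ℕ => Set.Icc (0 : ℝ) 1) :=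
    isCompact_univ_pi fun _ => isCompact_Icc
  refine ⟨?_⟩
  convert hK.image hF
  symm
  refine Set.eq_univ_of_forall fun q => ?_
  obtain ⟨x, rfl⟩ := Submodule.Quotient.mk_surjective L q
  refine ⟨fun k => Int.fract (c x k), fun k _ => ⟨Int.fract_nonneg _, (Int.fract_lt_one _).le⟩, ?_⟩
  refine (Submodule.Quotient.eq L).2 ?_
  have hx : ∑ k ∈ Finset.range g, Int.fract (c x k) • w k - x =
      ∑ k ∈ Finset.range g, (Int.fract (c x k) - c x k) • w k := by
    simp only [sub_smul, Finset.sum_sub_distrib]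
    rw [← hc x]
  rw [hx]
  refine sum_mem fun k _ => ?_
  rw [show Int.fract (c x k) - c x k = ((-⌊c x k⌋ : ℤ) : ℝ) by
    push_cast; linarith [Int.self_sub_floor (c x k)], Int.cast_smul_eq_zsmul]
  exact Submodule.smul_mem _ _ (hw k)

theorem t2Space_torus [DiscreteTopology Λ] : T2Space (Torus Λ) := by
  have : DiscreteTopology Λ.toAddSubgroup := ‹DiscreteTopology Λ›
  have h : IsClosed (Λ : Set V) := AddSubgroup.isClosed_of_discrete (H := Λ.toAddSubgroup)
  have : T3Space (V ⧸ Λ) := Submodule.t3_quotient_of_isClosed Λ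
  exact inferInstanceAs (T2Space (V ⧸ Λ))

/-- The covering `V^∨ → T̂`. -/
def dualMk (Λ : Submodule ℤ V) (φ : StrongDual ℝ V) : DualTorus Λ := Submodule.Quotient.mk φ

theorem continuous_dualMk : Continuous (dualMk Λ) := continuous_quot_mk

theorem isOpenMap_dualMk : IsOpenMap (dualMk Λ) :=
  QuotientAddGroup.isOpenMap_coe (N := (dualLattice Λ).toAddSubgroup)

theorem dualMk_surjective : Function.Surjective (dualMk Λ) :=
  Submodule.Quotient.mk_surjective (dualLattice Λ)

theorem dualMk_eq_iff {φ ψ : StrongDual ℝ V} :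
    dualMk Λ φ = dualMk Λ ψ ↔ φ - ψ ∈ dualLattice Λ := Submodule.Quotient.eq _

theorem isOpenMap_cover : IsOpenMap (cover Λ) := isOpenMap_torusMk.prodMap isOpenMap_dualMk

theorem cover_surjective : Function.Surjective (cover Λ) :=
  Function.Surjective.prodMap torusMk_surjective dualMk_surjective

theorem cover_eq_iff {v w : V × StrongDual ℝ V} :
    cover Λ v = cover Λ w ↔ v.1 - w.1 ∈ Λ ∧ v.2 - w.2 ∈ dualLattice Λ :=
  Prod.ext_iff.trans (and_congr torusMk_eq_iff dualMk_eq_iff)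

namespace LatticeFrame

variable {g : ℕ} (B : LatticeFrame Λ g)

theorem u_mem (k : ℕ) : B.u k ∈ dualLattice Λ := B.integral k

theorem dual_expand (φ : StrongDual ℝ V) : φ = ∑ k ∈ Finset.range g, φ (B.b k) • B.u k := by
  ext x
  conv_lhs => rw [B.expand x, map_sum]
  rw [sum_apply]
  refine Finset.sum_congr rfl fun k _ => ?_
  simp [mul_comm]

theorem compactSpace_torusProd (B : LatticeFrame Λ g) : CompactSpace (TorusProd Λ) := by
  have : CompactSpace (V ⧸ Λ) :=
    compactSpace_quotient Λ B.b B.b_mem (fun x k => B.u k x) B.expand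
  have : CompactSpace (StrongDual ℝ V ⧸ dualLattice Λ) :=
    compactSpace_quotient (dualLattice Λ) B.u B.u_mem (fun φ k => φ (B.b k)) B.dual_expand
  exact inferInstanceAs (CompactSpace ((V ⧸ Λ) × (StrongDual ℝ V ⧸ dualLattice Λ)))

/-- The `k`-th coordinate on the dual torus. -/
def y (k : ℕ) (t : DualTorus Λ) : Circ :=
  ((Function.surjInv dualMk_surjective t (B.b k) : ℝ) : Circ)

theorem y_dualMk (k : ℕ) (φ : StrongDual ℝ V) : B.y k (dualMk Λ φ) = ((φ (B.b k) : ℝ) : Circ) := by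
  have h := Function.surjInv_eq (dualMk_surjective (Λ := Λ)) (dualMk Λ φ)
  obtain ⟨n, hn⟩ := dualMk_eq_iff.1 h.symm (B.b k) (B.b_mem k)
  refine circ_eq_iff.2 ⟨n, ?_⟩
  rw [← hn]
  simp

theorem continuous_y (k : ℕ) : Continuous (B.y k) := by
  have hq : IsOpenQuotientMap (dualMk Λ) := ⟨dualMk_surjective, continuous_dualMk, isOpenMap_dualMk⟩
  rw [hq.isQuotientMap.continuous_iff]
  have : B.y k ∘ dualMk Λ = fun φ => ((φ (B.b k) : ℝ) : Circ) := funext fun φ => B.y_dualMk k φ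
  rw [this]
  exact (AddCircle.continuous_mk' 1).comp (by fun_prop)

/-- The coordinates `T × T̂ → T × (ℝ / ℤ)^k`. -/
def coord : ∀ k, TorusProd Λ → tower Λ k
  | 0 => fun p => p.1
  | k + 1 => fun p => (coord k p, B.y k p.2)

theorem continuous_coord : ∀ k, Continuous (B.coord k)
  | 0 => continuous_fst
  | k + 1 => (continuous_coord k).prodMk ((B.continuous_y k).comp continuous_snd)

theorem towerMap_coord (k : ℕ) (p : TorusProd Λ) : towerMap Λ k (B.coord k p) = p.1 := by
  induction k with
  | zero => rfl
  | succ k ih => exact ih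

theorem coord_eq {k : ℕ} {p p' : TorusProd Λ} (h : B.coord k p = B.coord k p') :
    p.1 = p'.1 ∧ ∀ j < k, B.y j p.2 = B.y j p'.2 := by
  induction k with
  | zero => exact ⟨h, fun j hj => absurd hj (Nat.not_lt_zero j)⟩
  | succ k ih =>
    obtain ⟨h1, h2⟩ := ih (congrArg Prod.fst h)
    refine ⟨h1, fun j hj => ?_⟩
    rcases Nat.lt_succ_iff_lt_or_eq.1 hj with hj | rfl
    · exact h2 j hj
    · exact congrArg Prod.snd h

theorem coord_injective : Function.Injective (B.coord g) := by
  intro p p' h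
  obtain ⟨h1, h2⟩ := B.coord_eq h
  refine Prod.ext h1 ?_
  obtain ⟨φ, hφ⟩ := dualMk_surjective p.2
  obtain ⟨φ', hφ'⟩ := dualMk_surjective p'.2
  rw [← hφ, ← hφ'] at h2 ⊢
  refine dualMk_eq_iff.2 ?_
  rw [B.dual_expand (φ - φ')]
  refine sum_mem fun k hk => ?_
  have h3 := h2 k (Finset.mem_range.1 hk)
  rw [y_dualMk, y_dualMk] at h3
  obtain ⟨n, hn⟩ := circ_eq_iff.1 h3.symm
  rw [show (φ - φ') (B.b k) = (n : ℝ) by simp [hn],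
    show (n : ℝ) • B.u k = n • B.u k by ext; simp]
  exact Submodule.smul_mem _ _ (B.u_mem k)

theorem exists_coord_eq (k : ℕ) (x : tower Λ k) : ∃ (t : Torus Λ) (r : ℕ → ℝ),
    ∀ p : TorusProd Λ, p.1 = t → (∀ j < k, B.y j p.2 = ((r j : ℝ) : Circ)) → B.coord k p = x := by
  induction k with
  | zero => exact ⟨x, 0, fun p hp _ => hp⟩
  | succ k ih =>
    obtain ⟨x, θ⟩ := x
    obtain ⟨t, r, h⟩ := ih x
    obtain ⟨s, rfl⟩ := QuotientAddGroup.mk_surjective θ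
    refine ⟨t, Function.update r k s, fun p hp hj => Prod.ext (h p hp fun j hj' => ?_) ?_⟩
    · rw [hj j (by omega), Function.update_of_ne (by omega)]
    · exact (hj k (by omega)).trans (by rw [Function.update_self])

theorem coord_surjective : Function.Surjective (B.coord g) := by
  intro x
  obtain ⟨t, r, h⟩ := B.exists_coord_eq g x
  -- The functional with prescribed values on the lattice basis is the combination of the dual basis
  -- with these coefficients.
  refine ⟨(t, dualMk Λ (∑ k ∈ Finset.range g, r k • B.u k)), h _ rfl fun j hj => ?_⟩
  rw [y_dualMk, sum_apply]
  congr 1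
  rw [Finset.sum_eq_single j]
  · simp [B.u_b j hj]
  · intro i _ hij
    simp [B.u_b j hj, hij]
  · intro h
    exact absurd (Finset.mem_range.2 hj) h

/-- The coordinates as an isomorphism of spaces. -/
def coordIso [DiscreteTopology Λ] : TorusProd Λ ≅ tower Λ g :=
  have := B.compactSpace_torusProd
  have := t2Space_torus (Λ := Λ)
  have := t2Space_tower (Λ := Λ) g
  TopCat.isoOfHomeo (Continuous.homeoOfEquivCompactToT2
    (f := Equiv.ofBijective (B.coord g) ⟨B.coord_injective, B.coord_surjective⟩)
    (B.continuous_coord g))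

theorem isOpenMap_coord [DiscreteTopology Λ] : IsOpenMap (B.coord g) :=
  (TopCat.homeoOfIso B.coordIso).isOpenMap

theorem coordIso_towerMap [DiscreteTopology Λ] : B.coordIso.hom ≫ towerMap Λ g = proj Λ := by
  ext p
  exact B.towerMap_coord g p

end LatticeFrame

end Coordinates


/-! ### Identification of ker ∇̂₂ with the iterated twist. -/

section Identification

open Limits

variable {V : Type} [NormedAddCommGroup V] [NormedSpace ℝ V] {Λ : Submodule ℤ V}

namespace LatticeFrame

variable {g : ℕ} (B : LatticeFrame Λ g)

/-- The automorphy weight that trivialises the dual Poincaré bundle in the `y`-directions. -/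
def weight (k : ℕ) (v : V × StrongDual ℝ V) : ℂ :=
  ∏ j ∈ Finset.range k, B.e j (torusMk Λ v.1) ^ ⌊v.2 (B.b j)⌋

theorem weight_ne_zero (k : ℕ) (v : V × StrongDual ℝ V) : B.weight k v ≠ 0 :=
  Finset.prod_ne_zero_iff.2 fun _ _ => zpow_ne_zero _ (B.e_ne_zero _ _)

theorem weight_succ (k : ℕ) (v : V × StrongDual ℝ V) :
    B.weight (k + 1) v = B.weight k v * B.e k (torusMk Λ v.1) ^ ⌊v.2 (B.b k)⌋ :=
  Finset.prod_range_succ _ _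

/-- Translating by μ changes ⌊y_j⌋ by the integer μ(b_j), so the weight picks up ∏ exp(2πi μ(b_j)
x_j) = exp(2πi μ(x)), the automorphy factor of the dual bundle. Sections divided by the weight are
thus honest functions on T × T̂. -/
theorem weight_add (v l : V × StrongDual ℝ V) (h1 : l.1 ∈ Λ) (h2 : l.2 ∈ dualLattice Λ) :
    B.weight g (v + l) = dualFactor v l * B.weight g v := by
  have hl : torusMk Λ (v.1 + l.1) = torusMk Λ v.1 := torusMk_eq_iff.2 (by simpa using h1)
  have hf : dualFactor v l =
      ∏ j ∈ Finset.range g,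
        Complex.exp (2 * Real.pi * Complex.I * (l.2 (B.b j) * B.u j v.1 : ℝ)) := by
    rw [dualFactor_eq, ← Complex.exp_sum, ← Finset.mul_sum]
    congr 2
    have : l.2 v.1 = ∑ j ∈ Finset.range g, l.2 (B.b j) * B.u j v.1 := by
      conv_lhs => rw [B.expand v.1, map_sum]
      simp [mul_comm]
    rw [this]
    push_cast
    rfl
  rw [hf, weight, weight, ← Finset.prod_mul_distrib]
  refine Finset.prod_congr rfl fun j _ => ?_
  obtain ⟨n, hn⟩ := h2 (B.b j) (B.b_mem j)
  rw [Prod.fst_add, hl, Prod.snd_add, add_apply, hn, Int.floor_add_intCast,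
    zpow_add₀ (B.e_ne_zero _ _), mul_comm]
  congr 1
  rw [e_torusMk, ← Complex.exp_int_mul]
  congr 1
  push_cast
  ring

/-- The coordinates on the universal cover. -/
def cov (k : ℕ) (v : V × StrongDual ℝ V) : tower Λ k := B.coord k (cover Λ v)

theorem continuous_cov (k : ℕ) : Continuous (B.cov k) :=
  (B.continuous_coord k).comp (continuous_cover Λ)

theorem cov_succ (k : ℕ) (v : V × StrongDual ℝ V) :
    B.cov (k + 1) v = covCirc (tower Λ k) (B.cov k v, v.2 (B.b k)) :=
  Prod.ext rfl (B.y_dualMk k v.2)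

theorem towerMap_cov (k : ℕ) (v : V × StrongDual ℝ V) : towerMap Λ k (B.cov k v) = torusMk Λ v.1 :=
  B.towerMap_coord k _

theorem continuous_cov_prod (k : ℕ) :
    Continuous fun v => ((B.cov k v, v.2 (B.b k)) : tower Λ k × ℝ) :=
  (B.continuous_cov k).prodMk (by fun_prop)

/-- Unwinding the twists one circle at a time collects the factors e_j^⌊y_j⌋ into the weight. The
jumps of the weight are compensated by those of f, so the product is smooth in x and locally
constant in y where A is everything. -/
theorem exists_smooth_of_mem {A : Set (Torus Λ)} {k : ℕ} {f : tower Λ k → ℂ}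
    {v : V × StrongDual ℝ V} (hf : f ∈ (B.towerCond A k).S (B.cov k v)) :
    ∃ H : V → ℂ, (∀ᶠ x in 𝓝 v.1, ContDiffAt ℝ ∞ H x) ∧
      ∀ᶠ v' in 𝓝 v, B.weight k v' * f (B.cov k v') = A.indicator 1 (torusMk Λ v'.1) * H v'.1 := by
  induction k with
  | zero =>
    obtain ⟨H, hH, hfH⟩ := hf v.1 rfl
    refine ⟨H, hH, ?_⟩
    filter_upwards [(continuous_fst.tendsto v).eventually hfH] with v' hv'
    rw [← hv']
    exact one_mul _
  | succ k ih =>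
    rw [cov_succ] at hf
    obtain ⟨h, hh, hf⟩ := (mem_twist (B.towerCond_isMultiplier A k k)).1 hf
    obtain ⟨H, hH, hhH⟩ := ih hh
    refine ⟨H, hH, ?_⟩
    filter_upwards [hhH, ((B.continuous_cov_prod k).tendsto v).eventually hf] with v' h1 h2
    rw [← h1, ← h2, weight_succ, cov_succ, towerMap_cov, mul_assoc]

theorem exists_mem_of_smooth [DiscreteTopology Λ] (A : Set (Torus Λ)) (k : ℕ)
    {v : V × StrongDual ℝ V} {H : V → ℂ} (hH : ∀ᶠ x in 𝓝 v.1, ContDiffAt ℝ ∞ H x) :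
    ∃ f ∈ (B.towerCond A k).S (B.cov k v),
      ∀ᶠ v' in 𝓝 v, B.weight k v' * f (B.cov k v') = A.indicator 1 (torusMk Λ v'.1) * H v'.1 := by
  induction k with
  | zero =>
    obtain ⟨f, hf, hfH⟩ := exists_mem_smoothOn A hH
    refine ⟨f, hf, ?_⟩
    filter_upwards [(continuous_fst.tendsto v).eventually hfH] with v' hv'
    rw [← hv']
    exact one_mul _
  | succ k ih =>
    obtain ⟨h, hh, hhH⟩ := ih
    obtain ⟨f, hf, hfh⟩ := exists_mem_twist (B.towerCond_isMultiplier A k k)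
      (p := (B.cov k v, v.2 (B.b k))) hh
    refine ⟨f, by rw [cov_succ]; exact hf, ?_⟩
    filter_upwards [hhH, ((B.continuous_cov_prod k).tendsto v).eventually hfh] with v' h1 h2
    rw [← h1, ← h2, weight_succ, cov_succ, towerMap_cov, mul_assoc]

theorem isOpenMap_cov [DiscreteTopology Λ] : IsOpenMap (B.cov g) :=
  B.isOpenMap_coord.comp isOpenMap_cover

theorem cov_surjective : Function.Surjective (B.cov g) :=
  B.coord_surjective.comp cover_surjective

theorem cov_add (v l : V × StrongDual ℝ V) (h1 : l.1 ∈ Λ) (h2 : l.2 ∈ dualLattice Λ) :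
    B.cov g (v + l) = B.cov g v :=
  congrArg (B.coord g) (cover_eq_iff.2 ⟨by simpa using h1, by simpa using h2⟩)

/-- The sheaf of functions on `T × (ℝ / ℤ)^g` that corresponds to `ker ∇̂₂`. -/
abbrev kerCond : FunPred (tower Λ g) (id : tower Λ g → tower Λ g) := B.towerCond Set.univ g

theorem exists_smooth_of_mem_kerCond {f : tower Λ g → ℂ} {v : V × StrongDual ℝ V}
    (hf : f ∈ B.kerCond.S (B.cov g v)) :
    ∃ H : V → ℂ, ContDiffAt ℝ ∞ H v.1 ∧
      ∀ᶠ v' in 𝓝 v, B.weight g v' * f (B.cov g v') = H v'.1 := by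
  obtain ⟨H, hH, hf⟩ := B.exists_smooth_of_mem hf
  exact ⟨H, hH.self_of_nhds, hf.mono fun v' h => by simpa using h⟩

theorem eventually_const_of_mem_kerSections {W : Opens (TorusProd Λ)} {s : coverOpen Λ W → ℂ}
    (hs : s ∈ kerSections Λ W) (v : coverOpen Λ W) : ∃ H : V → ℂ,
    (∀ᶠ x in 𝓝 (v : V × StrongDual ℝ V).1, ContDiffAt ℝ ∞ H x) ∧
      ∀ᶠ v' in 𝓝 (v : V × StrongDual ℝ V), extendZero s v' = H v'.1 := by
  obtain ⟨v, hv⟩ := v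
  dsimp only
  obtain ⟨O₁, hO₁, O₂, hO₂, hO⟩ := mem_nhds_prod_iff.1 ((coverOpen Λ W).isOpen.mem_nhds hv)
  obtain ⟨r, hr, hr₂⟩ := Metric.mem_nhds_iff.1 hO₂
  refine ⟨fun x => extendZero s (x, v.2), ?_, ?_⟩
  · filter_upwards [hO₁] with x hx
    have h1 := hs.1.1 ⟨(x, v.2), hO ⟨hx, mem_of_mem_nhds hO₂⟩⟩
    exact ContDiffAt.comp x h1 (contDiffAt_id.prodMk contDiffAt_const)
  · filter_upwards [prod_mem_nhds hO₁ (Metric.ball_mem_nhds v.2 hr)] with v' hv'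
    -- The connection form contains only dx, so ∇̂₂ is the plain derivative in the y-directions; on
    -- a ball its vanishing forces the section to be independent of y.
    have hd : ∀ φ ∈ Metric.ball v.2 r,
        HasFDerivAt (fun φ => extendZero s (v'.1, φ)) (0 : StrongDual ℝ V →L[ℝ] ℂ) φ := by
      intro φ hφ
      have hm : (v'.1, φ) ∈ coverOpen Λ W := hO ⟨hv'.1, hr₂ hφ⟩
      have h1 := ((hs.1.1 ⟨_, hm⟩).differentiableAt (by simp)).hasFDerivAt
      have h2 := h1.comp φ (hasFDerivAt_prodMk_right v'.1 φ)
      have h0 : (fderiv ℝ (extendZero s) (v'.1, φ)).comp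
          (ContinuousLinearMap.inr ℝ V (StrongDual ℝ V)) = 0 := by
        ext e
        have h3 := hs.2 ⟨_, hm⟩ e
        simp only [nablaHat2, dualConnection, map_zero, Complex.ofReal_zero, mul_zero, zero_mul,
          sub_zero] at h3
        exact h3
      rw [h0] at h2
      exact h2
    have hconst := Metric.isOpen_ball.is_const_of_fderiv_eq_zero
      (convex_ball v.2 r).isPreconnected
      (fun φ hφ => (hd φ hφ).differentiableAt.differentiableWithinAt)
      (fun φ hφ => (hd φ hφ).fderiv) hv'.2 (Metric.mem_ball_self hr)
    exact hconst

variable [DiscreteTopology Λ]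

theorem weight_mul_mem_kerSections {U : Opens (tower Λ g)} {f : tower Λ g → ℂ}
    (hf : ∀ x ∈ U, f ∈ B.kerCond.S x) :
    (fun v : coverOpen Λ ((Opens.map B.coordIso.hom).obj U) =>
      B.weight g v * f (B.cov g v)) ∈ kerSections Λ ((Opens.map B.coordIso.hom).obj U) := by
  set W := coverOpen Λ ((Opens.map B.coordIso.hom).obj U) with hW
  set s : W → ℂ := fun v => B.weight g v * f (B.cov g v) with hs
  have hev : ∀ v : W, ∃ H : V → ℂ, ContDiffAt ℝ ∞ H (v : V × StrongDual ℝ V).1 ∧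
      extendZero s =ᶠ[𝓝 (v : V × StrongDual ℝ V)] fun v' => H v'.1 := by
    intro v
    obtain ⟨H, hH, hfH⟩ := B.exists_smooth_of_mem_kerCond (v := v) (hf _ v.2)
    refine ⟨H, hH, ?_⟩
    filter_upwards [hfH, W.isOpen.mem_nhds v.2] with v' h1 h2
    rw [← h1]
    exact extendZero_apply s ⟨v', h2⟩
  refine ⟨⟨fun v => ?_, fun v l h1 h2 => ?_⟩, fun v e => ?_⟩
  · obtain ⟨H, hH, hs⟩ := hev v
    exact (hH.comp (v : V × StrongDual ℝ V) contDiffAt_fst).congr_of_eventuallyEq hs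
  · have hm : (v : V × StrongDual ℝ V) + l ∈ W := add_mem_coverOpen Λ _ v.2 h1 h2
    rw [show extendZero s (v + l) = s ⟨v + l, hm⟩ from extendZero_apply s ⟨v + l, hm⟩,
      extendZero_apply s v]
    simp only [hs]
    rw [B.weight_add _ _ h1 h2, B.cov_add _ _ h1 h2, mul_assoc]
  · obtain ⟨H, hH, hs⟩ := hev v
    simp only [nablaHat2, dualConnection]
    rw [hs.fderiv_eq]
    have hd : HasFDerivAt (fun v' : V × StrongDual ℝ V => H v'.1)
        ((fderiv ℝ H (v : V × StrongDual ℝ V).1).comp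
          (ContinuousLinearMap.fst ℝ V (StrongDual ℝ V))) v :=
      (hH.differentiableAt (by simp)).hasFDerivAt.comp (v : V × StrongDual ℝ V) hasFDerivAt_fst
    rw [hd.fderiv]
    simp

/-- The comparison morphism between the function sheaf and `ker ∇̂₂`. -/
def kerHom : B.kerCond.sheaf ⟶
    (TopCat.Sheaf.pushforward (ModuleCat.{0} ℂ) B.coordIso.hom).obj (kerSheaf Λ) :=
  ⟨{ app U := ModuleCat.ofHom
      { toFun := fun f => (⟨fun v => B.weight g v * B.kerCond.val (W := U.unop) f (B.cov g v),
          B.weight_mul_mem_kerSections fun x hx => B.kerCond.val_mem (W := U.unop) f hx⟩ :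
            kerSections Λ ((Opens.map B.coordIso.hom).obj U.unop))
        map_add' := fun f f' => Subtype.ext (funext fun v => mul_add _ _ _)
        map_smul' := fun c f => Subtype.ext (funext fun v => mul_left_comm _ _ _) }
     naturality U U' i := by
      ext1
      refine LinearMap.ext fun f => Subtype.ext (funext fun v => ?_)
      exact congrArg (B.weight g v * ·) (FunPred.cut_of_mem
        (π := (id : tower Λ g → tower Λ g)) (y := B.cov g v) (W := U'.unop) v.2 _) }⟩

theorem secMap_kerHom {U : Opens (tower Λ g)} (f : Sec B.kerCond.sheaf U)
    (v : coverOpen Λ ((Opens.map B.coordIso.hom).obj U)) :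
    (secMap B.kerHom U f : kerSections Λ ((Opens.map B.coordIso.hom).obj U)).1 v =
      B.weight g v * B.kerCond.val f (B.cov g v) := rfl

theorem kerHom_surjective (U : Opens (tower Λ g)) : Function.Surjective (secMap B.kerHom U) := by
  classical
  intro s
  let W := (Opens.map B.coordIso.hom).obj U
  let s' : kerSections Λ W := s
  -- The quotient of an automorphic section by the weight is invariant under Λ × Λ^∨, so evaluating
  -- it at any chosen preimage gives a well-defined function on the tower.
  let σ : V × StrongDual ℝ V → ℂ := fun v => (B.weight g v)⁻¹ * extendZero s'.1 v
  let f : tower Λ g → ℂ := fun x => σ (Function.surjInv B.cov_surjective x)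
  have hf : ∀ v ∈ coverOpen Λ W, f (B.cov g v) = σ v := by
    intro v hv
    have h := Function.surjInv_eq B.cov_surjective (B.cov g v)
    set w := Function.surjInv B.cov_surjective (B.cov g v) with hw
    obtain ⟨h1, h2⟩ := cover_eq_iff.1 (B.coord_injective h)
    have h3 := s'.2.1.2 ⟨v, hv⟩ (w - v) h1 h2
    have h4 := B.weight_add v (w - v) h1 h2
    rw [show ((⟨v, hv⟩ : coverOpen Λ W) : V × StrongDual ℝ V) = v from rfl, add_sub_cancel] at h3
    rw [add_sub_cancel] at h4
    have h5 : dualFactor v (w - v) ≠ 0 := by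
      rw [dualFactor_eq]; exact Complex.exp_ne_zero _
    change (B.weight g w)⁻¹ * extendZero s'.1 w = (B.weight g v)⁻¹ * extendZero s'.1 v
    rw [h3, h4]
    field_simp
  have hmem : ∀ x ∈ U, f ∈ B.kerCond.S x := by
    intro x hx
    obtain ⟨v, rfl⟩ := B.cov_surjective x
    have hv : v ∈ coverOpen Λ W := hx
    obtain ⟨H, hH, hsH⟩ := eventually_const_of_mem_kerSections s'.2 ⟨v, hv⟩
    -- The smooth function of x that represents the section near v also comes from a germ of the
    -- iterated twist; dividing by the weight shows that this germ is f.
    obtain ⟨f', hf', hfH⟩ := B.exists_mem_of_smooth Set.univ g hH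
    refine B.kerCond.congr ?_ hf'
    refine B.isOpenMap_cov.nhds_le v ?_
    change ∀ᶠ v' in 𝓝 v, f' (B.cov g v') = f (B.cov g v')
    filter_upwards [hsH, hfH, (coverOpen Λ W).isOpen.mem_nhds hv] with v' h1 h2 h3
    rw [Set.indicator_univ, Pi.one_apply, one_mul] at h2
    rw [hf v' h3]
    change f' (B.cov g v') = (B.weight g v')⁻¹ * extendZero s'.1 v'
    rw [h1, ← h2, inv_mul_cancel_left₀ (B.weight_ne_zero g v')]
  refine ⟨B.kerCond.sec U f hmem, ?_⟩
  refine Subtype.ext (funext fun v => ?_)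
  change _ = s'.1 v
  refine (B.secMap_kerHom _ v).trans ?_
  rw [B.kerCond.val_sec (y := B.cov g v) v.2, hf v v.2]
  change B.weight g v * ((B.weight g v)⁻¹ * extendZero s'.1 v) = _
  rw [mul_inv_cancel_left₀ (B.weight_ne_zero g v), extendZero_apply]

theorem kerHom_injective (U : Opens (tower Λ g)) : Function.Injective (secMap B.kerHom U) := by
  refine (injective_iff_map_eq_zero _).2 fun f hf => B.kerCond.sec_ext fun x hx => ?_
  obtain ⟨v, rfl⟩ := B.cov_surjective x
  have h : B.weight g v * B.kerCond.val f (B.cov g v) = 0 :=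
    (B.secMap_kerHom f ⟨v, hx⟩).symm.trans (congrFun (congrArg Subtype.val hf) ⟨v, hx⟩)
  exact (mul_eq_zero.1 h).resolve_left (B.weight_ne_zero g v)

theorem isIso_kerHom : IsIso B.kerHom := by
  have := mono_of_secMap_injective B.kerHom B.kerHom_injective
  have : Epi B.kerHom := (epi_iff_sec _).2 fun U t x hx => by
    obtain ⟨s, hs⟩ := B.kerHom_surjective U t
    exact ⟨U, le_rfl, hx, s, hs.trans (res_self _ _ _).symm⟩
  exact isIso_of_mono_of_epi B.kerHom

end LatticeFrame

end Identification


/-! ### Functions supported at a point form the skyscraper sheaf. -/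

section Skyscraper

open Limits

variable {V : Type} [NormedAddCommGroup V] [NormedSpace ℝ V] {Λ : Submodule ℤ V}

theorem indicator_mem_smoothOn (A : Set (Torus Λ)) (c : ℂ) (t : Torus Λ) :
    (fun t => A.indicator 1 t * c) ∈ (smoothOn A).S t := fun _ _ =>
  ⟨fun _ => c, Filter.Eventually.of_forall fun _ => contDiffAt_const,
    Filter.Eventually.of_forall fun _ => rfl⟩

theorem eq_zero_of_mem_smoothOn {A : Set (Torus Λ)} {t : Torus Λ} {f : Torus Λ → ℂ}
    (hf : f ∈ (smoothOn A).S t) (ht : t ∉ A) : f t = 0 := by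
  obtain ⟨x, rfl⟩ := torusMk_surjective t
  obtain ⟨h, -, hf⟩ := hf x rfl
  rw [hf.self_of_nhds, Set.indicator_of_notMem ht, zero_mul]

/-- Evaluation at a point of the sheaf of functions supported at this point. -/
def evalPoint (t : Torus Λ) {U : Opens (Torus Λ)} (ht : t ∈ U) :
    Sec (smoothOn {t}).sheaf U ≃ₗ[ℂ] ℂ where
  toFun f := (smoothOn {t}).val f t
  map_add' _ _ := rfl
  map_smul' _ _ := rfl
  invFun c := (smoothOn {t}).sec U _ fun t' _ => indicator_mem_smoothOn {t} c t'
  left_inv f := by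
    refine (smoothOn {t}).sec_ext fun t' ht' => ?_
    refine ((smoothOn {t}).val_sec ht').trans ?_
    by_cases h : t' = t
    · subst h
      simp
    · refine Eq.trans ?_ (eq_zero_of_mem_smoothOn ((smoothOn {t}).val_mem f ht') h).symm
      simp [h]
  right_inv c := ((smoothOn {t}).val_sec (y := t) ht).trans (by simp)

theorem evalPoint_res (t : Torus Λ) {U U' : Opens (Torus Λ)} (h : U' ≤ U) (ht : t ∈ U')
    (f : Sec (smoothOn {t}).sheaf U) :
    evalPoint t ht (res (smoothOn {t}).sheaf h f) = evalPoint t (h ht) f :=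
  (smoothOn {t}).val_res h f (y := t) ht

theorem isZero_sec {t : Torus Λ} {U : Opens (Torus Λ)} (ht : t ∉ U) :
    IsZero (Sec (smoothOn {t}).sheaf U) := by
  have : Subsingleton (Sec (smoothOn {t}).sheaf U) := by
    refine ⟨fun f f' => (smoothOn {t}).sec_ext fun t' ht' => ?_⟩
    have h : t' ∉ ({t} : Set (Torus Λ)) := by
      rintro rfl
      exact ht ht'
    exact (eq_zero_of_mem_smoothOn ((smoothOn {t}).val_mem f ht') h).trans
      (eq_zero_of_mem_smoothOn ((smoothOn {t}).val_mem f' ht') h).symm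
  exact ModuleCat.isZero_of_subsingleton _

open Classical in
/-- A presheaf that has value `M`, compatibly with restrictions, on the neighbourhoods of a point,
and trivial value on the other open subsets, is isomorphic to the skyscraper presheaf. -/
theorem nonempty_iso_skyscraperPresheaf {C : Type*} [Category C] [HasTerminal C] {X : TopCat.{0}}
    (t : X) (M : C) (G : (Opens X)ᵒᵖ ⥤ C) (e : ∀ U : (Opens X)ᵒᵖ, t ∈ U.unop → (G.obj U ≅ M))
    (he : ∀ {U U' : (Opens X)ᵒᵖ} (i : U ⟶ U') (h : t ∈ U'.unop),
      G.map i ≫ (e U' h).hom = (e U (i.unop.le h)).hom)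
    (hG : ∀ U : (Opens X)ᵒᵖ, t ∉ U.unop → Nonempty (IsTerminal (G.obj U))) :
    Nonempty (G ≅ skyscraperPresheaf t M) := by
  have hT : ∀ U : (Opens X)ᵒᵖ, t ∉ U.unop →
      Nonempty (IsTerminal ((skyscraperPresheaf t M).obj U)) := fun U h =>
    ⟨terminalIsTerminal.ofIso (eqToIso (if_neg h).symm)⟩
  have hP : ∀ U : (Opens X)ᵒᵖ, t ∈ U.unop → (skyscraperPresheaf t M).obj U = M := fun U h =>
    if_pos h
  let a : ∀ U : (Opens X)ᵒᵖ, G.obj U ≅ (skyscraperPresheaf t M).obj U := fun U =>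
    if h : t ∈ U.unop then e U h ≪≫ eqToIso (hP U h).symm
    else (hG U h).some.uniqueUpToIso (hT U h).some
  refine ⟨NatIso.ofComponents a fun {U U'} i => ?_⟩
  by_cases h : t ∈ U'.unop
  · have hU : t ∈ U.unop := i.unop.le h
    have h1 : (a U').hom = (e U' h).hom ≫ eqToHom (hP U' h).symm := by simp [a, h]
    have h2 : (a U).hom = (e U hU).hom ≫ eqToHom (hP U hU).symm := by simp [a, hU]
    have h3 : (skyscraperPresheaf t M).map i = eqToHom ((hP U hU).trans (hP U' h).symm) :=
      dif_pos h
    rw [h1, h2, h3, ← Category.assoc, he i h, Category.assoc, eqToHom_trans]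
  -- Away from the point the target is terminal, so naturality is automatic.
  · exact (hT U' h).some.hom_ext _ _

theorem nonempty_iso_skyscraper (t : Torus Λ) :
    Nonempty ((smoothOn {t}).sheaf ≅ skyscraper (Torus Λ) t) := by
  obtain ⟨f⟩ := nonempty_iso_skyscraperPresheaf t (ModuleCat.of ℂ ℂ) (smoothOn {t}).presheaf
    (fun U h => (evalPoint t h).toModuleIso)
    (fun i h => ModuleCat.hom_ext (LinearMap.ext fun f => evalPoint_res t i.unop.le h f))
    (fun U h => ⟨(isZero_sec h).isTerminal⟩)
  exact ⟨(fullyFaithfulSheafToPresheaf (Opens.grothendieckTopology (Torus Λ))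
    (ModuleCat.{0} ℂ)).preimageIso (X := (smoothOn {t}).sheaf) (Y := skyscraper (Torus Λ) t) f⟩

end Skyscraper

/-! ### Assembly: p_* followed by a left exact functor. -/

section Main

open Limits

instance sections_preservesFiniteLimits (X : TopCat.{0}) : PreservesFiniteLimits
    ((sheafSections (Opens.grothendieckTopology X) (ModuleCat.{0} ℂ)).obj (op ⊤)) :=
  preservesFiniteLimits_of_natIso
    (F := TopCat.Sheaf.forget (ModuleCat.{0} ℂ) X ⋙ (evaluation _ _).obj (op ⊤)) (Iso.refl _)

variable {V : Type} [NormedAddCommGroup V] [NormedSpace ℝ V] [FiniteDimensional ℝ V]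
  (Λ : Submodule ℤ V) [DiscreteTopology Λ] [IsZLattice ℝ Λ]

/-- The derived functors of `p_*` followed by a left exact functor at `ker ∇̂₂`. -/
theorem rightDerived_proj {E : Type*} [Category E] [Abelian E] (Q : Sh (Torus Λ) ⥤ E)
    [Q.Additive] [PreservesFiniteLimits Q] :
    (∀ j < Module.finrank ℝ V, IsZero
      (((TopCat.Sheaf.pushforward (ModuleCat.{0} ℂ) (proj Λ) ⋙ Q).rightDerived j).obj
        (kerSheaf Λ))) ∧
    Nonempty (((TopCat.Sheaf.pushforward (ModuleCat.{0} ℂ) (proj Λ) ⋙ Q).rightDerived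
      (Module.finrank ℝ V)).obj (kerSheaf Λ) ≅ Q.obj (smoothOn {torusMk Λ 0}).sheaf) := by
  obtain ⟨B⟩ := exists_latticeFrame Λ
  have := t2Space_torus (Λ := Λ)
  -- In coordinates p is the projection of the tower, so p_* followed by `Q` is transport along the
  -- homeomorphism followed by successive pushforwards along the circles.
  have α : Nonempty (TopCat.Sheaf.pushforward (ModuleCat.{0} ℂ) (proj Λ) ⋙ Q ≅
      TopCat.Sheaf.pushforward (ModuleCat.{0} ℂ) B.coordIso.hom ⋙
        towerFun Q (Module.finrank ℝ V)) := by
    rw [← B.coordIso_towerMap]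
    let β : TopCat.Sheaf.pushforward (ModuleCat.{0} ℂ)
        (B.coordIso.hom ≫ towerMap Λ (Module.finrank ℝ V)) ≅
          TopCat.Sheaf.pushforward (ModuleCat.{0} ℂ) B.coordIso.hom ⋙
            TopCat.Sheaf.pushforward (ModuleCat.{0} ℂ) (towerMap Λ (Module.finrank ℝ V)) :=
      Iso.refl _
    exact ⟨Functor.isoWhiskerRight β Q ≪≫ Functor.associator _ _ _ ≪≫
      Functor.isoWhiskerLeft _ (towerFunIso Q _).symm⟩
  have hB := B.isIso_kerHom
  have key : ∀ j, Nonempty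
      (((TopCat.Sheaf.pushforward (ModuleCat.{0} ℂ) (proj Λ) ⋙ Q).rightDerived j).obj
        (kerSheaf Λ) ≅ ((towerFun Q (Module.finrank ℝ V)).rightDerived j).obj
          B.kerCond.sheaf) := fun j =>
    ⟨(rightDerived_congr α.some j _).some ≪≫ (rightDerived_pushforward_iso B.coordIso _ j _).some ≪≫
      (Functor.mapIso _ (asIso B.kerHom)).symm⟩
  obtain ⟨h0, h1⟩ := rightDerived_towerFun Q B _ le_rfl
  rw [B.stratum_self] at h0 h1
  rw [B.stratum_zero] at h1
  exact ⟨fun j hj => (h0 j hj).of_iso (key j).some, ⟨(key _).some ≪≫ h1.some⟩⟩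

end Main

end PoincareTorus

end

theorem mainTheorem7 (V : Type) [NormedAddCommGroup V] [NormedSpace ℝ V] [FiniteDimensional ℝ V]
    (Λ : Submodule ℤ V) [DiscreteTopology Λ] [IsZLattice ℝ Λ] :
    (∀ j : ℕ, j < Module.finrank ℝ V →
      Limits.IsZero (PoincareTorus.higherDirectImage (PoincareTorus.proj Λ) j
        (PoincareTorus.kerSheaf Λ))) ∧
    Nonempty (PoincareTorus.higherDirectImage (PoincareTorus.proj Λ) (Module.finrank ℝ V)
        (PoincareTorus.kerSheaf Λ) ≅
      PoincareTorus.skyscraper (PoincareTorus.Torus Λ) (0 : V ⧸ Λ)) ∧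
    (∀ j : ℕ, j < Module.finrank ℝ V →
      Limits.IsZero (PoincareTorus.sheafCohomology (PoincareTorus.TorusProd Λ) j
        (PoincareTorus.kerSheaf Λ))) ∧
    Nonempty (PoincareTorus.sheafCohomology (PoincareTorus.TorusProd Λ) (Module.finrank ℝ V)
        (PoincareTorus.kerSheaf Λ) ≅ ModuleCat.of ℂ ℂ) := by
  let P := TopCat.Sheaf.pushforward (ModuleCat.{0} ℂ) (PoincareTorus.proj Λ)
  let Γ' : PoincareTorus.Sh (PoincareTorus.TorusProd Λ) ⥤ ModuleCat.{0} ℂ :=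
    (sheafSections (Opens.grothendieckTopology (PoincareTorus.TorusProd Λ))
      (ModuleCat.{0} ℂ)).obj (op ⊤)
  have : Γ'.Additive := PoincareTorus.sections_additive _
  let Γ : PoincareTorus.Sh (PoincareTorus.Torus Λ) ⥤ ModuleCat.{0} ℂ :=
    (sheafSections (Opens.grothendieckTopology (PoincareTorus.Torus Λ))
      (ModuleCat.{0} ℂ)).obj (op ⊤)
  -- The identity functor yields the direct images. Below, the global sections functor of T yields
  -- the cohomology of T × T̂, because global sections of p_*F are those of F.
  obtain ⟨h0, h1⟩ := PoincareTorus.rightDerived_proj Λ (𝟭 _)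
  have : Γ.Additive := PoincareTorus.sections_additive _
  have : Limits.PreservesFiniteLimits Γ := PoincareTorus.sections_preservesFiniteLimits _
  obtain ⟨h0', h1'⟩ := PoincareTorus.rightDerived_proj Λ Γ
  have key : ∀ j, Nonempty (PoincareTorus.higherDirectImage (PoincareTorus.proj Λ) j
      (PoincareTorus.kerSheaf Λ) ≅ ((P ⋙ 𝟭 _).rightDerived j).obj (PoincareTorus.kerSheaf Λ)) :=
    fun j => PoincareTorus.rightDerived_congr P.rightUnitor.symm j _
  have key' : ∀ j, Nonempty (PoincareTorus.sheafCohomology (PoincareTorus.TorusProd Λ) j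
      (PoincareTorus.kerSheaf Λ) ≅ ((P ⋙ Γ).rightDerived j).obj (PoincareTorus.kerSheaf Λ)) :=
    fun j => PoincareTorus.rightDerived_congr (F := Γ') (Iso.refl _) j _
  refine ⟨fun j hj => (h0 j hj).of_iso (key j).some, ⟨(key _).some ≪≫ h1.some ≪≫
    (PoincareTorus.nonempty_iso_skyscraper _).some⟩,
    fun j hj => (h0' j hj).of_iso (key' j).some, ⟨(key' _).some ≪≫ h1'.some ≪≫
    (PoincareTorus.evalPoint (U := ⊤) _ (Opens.mem_top _)).toModuleIso⟩⟩
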